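/- Let $G=(V,E)$ be a finite simple undirected graph with $n$ vertices. For $t\in\mathbb N$ let $\xi_t(G)$ be the minimum number of edges of $G$ whose deletion leaves a graph of maximum degree at most $t$. For $c\in\mathbb N$, a $c$-colored labeling $L$ of $G$ is a partition of $E$ into strong classes $S^1_L,\dots,S^c_L$ and a class $W_L$ of weak edges. It is proper if no two distinct edges with a common endpoint lie in the same strong class, and it is an STC-labeling if $\{u,w\}\in E$ whenever $\{u,v\}$ and $\{v,w\}$ with $u\ne w$ are edges of the same strong class. Given lists $\Psi:E\to 2^{\{1,\dots,c\}}$, the labeling is $\Psi$-satisfying if $i\in\Psi(e)$ for every strong class $S^i_L$ and every $e\in S^i_L$. For fixed $c$, an instance of Edge-List ECS (respectively Edge-List Multi-STC) is a triple $(G,\Psi,k)$ with $k\in\mathbb Z$, and the question is whether $G$ has a proper (respectively STC-) $\Psi$-satisfying $c$-colored labeling $L$ with $|W_L|\le k$. Theorem. For every $c\in\mathbb N$, each of the two problems Edge-List ECS and Edge-List Multi-STC with $c$ colors has a kernel with at most $11\,\xi_2$ edges and at most $10\,\xi_2$ vertices that is computable in $O(n^2)$ time. That is, there are a program for a unit-cost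 random access machine with integer words, addition and subtraction, and a constant $C$ (both may depend on $c$) such that, on every instance $(G,\Psi,k)$, given by its edge list with the color lists, the program halts after at most $C\,(n^2+1)$ steps and outputs an instance $(G',\Psi',k')$ of the same problem such that $(G',\Psi',k')$ is a yes-instance if and only if $(G,\Psi,k)$ is one, $|E(G')|\le 11\,\xi_2(G)$, $|V(G')|\le 10\,\xi_2(G)$, and $0\le k'\le |E(G')|$, except that $k'=-1$ is also allowed if $\xi_2(G)=0$ (then $G'$ is the empty graph, and only a negative budget gives a no-instance). -/

import Mathlib

/-! ## Graphs: edge-deletion distance to bounded maximum degree -/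

/-- `D` is a set of edges of `G` whose deletion leaves a graph of maximum degree at most `t`. -/
def IsEdgeDeletionSet {V : Type*} (G : SimpleGraph V) (t : ℕ) (D : Set (Sym2 V)) : Prop :=
  D ⊆ G.edgeSet ∧ ∀ v, ((G.deleteEdges D).neighborSet v).ncard ≤ t

/-- The parameter `ξ_t` of a finite graph: the minimum size of an edge-deletion set.
(The set of sizes is never empty, because all edges may be deleted.) -/
noncomputable def xi {V : Type*} [Finite V] (G : SimpleGraph V) (t : ℕ) : ℕ :=
  sInf {d | ∃ D : Set (Sym2 V), IsEdgeDeletionSet G t D ∧ D.ncard = d}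

/-! ## Labelings -/

/-- A `c`-colored labeling. The label of an edge is `some i` if it is in the strong class `i`, and
`none` if it is weak. Only the labels of edges matter in the notions below. -/
abbrev Labeling (V : Type*) (c : ℕ) := Sym2 V → Option (Fin c)

/-- No two distinct edges with a common endpoint are in the same strong class. -/
def IsProperLabeling {V : Type*} {c : ℕ} (G : SimpleGraph V) (L : Labeling V c) : Prop :=
  ∀ e₁ ∈ G.edgeSet, ∀ e₂ ∈ G.edgeSet, e₁ ≠ e₂ → (∃ v, v ∈ e₁ ∧ v ∈ e₂) →
    ∀ i : Fin c, ¬ (L e₁ = some i ∧ L e₂ = some i)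

/-- Two distinct edges `{u, v}` and `{v, w}` in the same strong class have `{u, w}` as an edge. -/
def IsSTCLabeling {V : Type*} {c : ℕ} (G : SimpleGraph V) (L : Labeling V c) : Prop :=
  ∀ u v w : V, u ≠ w → G.Adj u v → G.Adj v w →
    ∀ i : Fin c, L s(u, v) = some i → L s(v, w) = some i → G.Adj u w

/-- Every strong edge has a color from its list. -/
def IsListSatisfying {V : Type*} {c : ℕ} (G : SimpleGraph V) (Ψ : Sym2 V → Finset (Fin c))
    (L : Labeling V c) : Prop :=
  ∀ e ∈ G.edgeSet, ∀ i : Fin c, L e = some i → i ∈ Ψ e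

/-- The set of weak edges. -/
def weakEdges {V : Type*} {c : ℕ} (G : SimpleGraph V) (L : Labeling V c) : Set (Sym2 V) :=
  {e | e ∈ G.edgeSet ∧ L e = none}

/-! ## The two edge-list problems -/

/-- An input with `c` colors: a graph with vertices `0, …, n - 1`, a list of colors for every
edge (the values of `Ψ` outside the edge set play no role), and a budget `k`, which may be
negative (it then is a no-instance). -/
structure ELInstance (c : ℕ) where
  n : ℕ
  G : SimpleGraph (Fin n)
  Ψ : Sym2 (Fin n) → Finset (Fin c)
  k : ℤ

/-- The number of edges. -/
noncomputable def ELInstance.numEdges {c : ℕ} (I : ELInstance c) : ℕ := I.G.edgeSet.ncard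

/-- Edge-List ECS. -/
def ELInstance.IsYesECS {c : ℕ} (I : ELInstance c) : Prop :=
  ∃ L : Labeling (Fin I.n) c, IsProperLabeling I.G L ∧ IsListSatisfying I.G I.Ψ L ∧
    ((weakEdges I.G L).ncard : ℤ) ≤ I.k

/-- Edge-List Multi-STC. -/
def ELInstance.IsYesMultiSTC {c : ℕ} (I : ELInstance c) : Prop :=
  ∃ L : Labeling (Fin I.n) c, IsSTCLabeling I.G L ∧ IsListSatisfying I.G I.Ψ L ∧
    ((weakEdges I.G L).ncard : ℤ) ≤ I.k

/-! ## The machine model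

Programs of a unit-cost random access machine with integer words, written in structured form.
There are integer registers and integer arrays with unit-cost access; the arithmetic operations
are addition and subtraction only. A program mentions finitely many registers and arrays. -/

namespace RAM

/-- Contents of the registers and of the arrays. -/
structure Store where
  reg : ℕ → ℤ
  arr : ℕ → ℤ → ℤ

/-- Arithmetic expressions; `read a e` is the entry of array `a` at index `e`. -/
inductive Expr where
  | const (z : ℤ)
  | reg (x : ℕ)
  | read (a : ℕ) (e : Expr)
  | add (e₁ e₂ : Expr)
  | sub (e₁ e₂ : Expr)

/-- The value of an expression. -/
def Expr.eval (s : Store) : Expr → ℤ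
  | .const z => z
  | .reg x => s.reg x
  | .read a e => s.arr a (e.eval s)
  | .add e₁ e₂ => e₁.eval s + e₂.eval s
  | .sub e₁ e₂ => e₁.eval s - e₂.eval s

/-- Evaluating an expression takes one step per operation. -/
def Expr.cost : Expr → ℕ
  | .const _ => 1
  | .reg _ => 1
  | .read _ e => e.cost + 1
  | .add e₁ e₂ => e₁.cost + e₂.cost + 1
  | .sub e₁ e₂ => e₁.cost + e₂.cost + 1

/-- Programs. The tests of `ite` and `loop` are comparisons `e₁ ≤ e₂`. -/
inductive Prog where
  | skip
  | assign (x : ℕ) (e : Expr)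
  | write (a : ℕ) (i e : Expr)
  | seq (p q : Prog)
  | ite (e₁ e₂ : Expr) (p q : Prog)
  | loop (e₁ e₂ : Expr) (p : Prog)

/-- Put `z` into register `x`. -/
def Store.setReg (s : Store) (x : ℕ) (z : ℤ) : Store :=
  { s with reg := Function.update s.reg x z }

/-- Put `z` into array `a` at index `i`. -/
def Store.setArr (s : Store) (a : ℕ) (i z : ℤ) : Store :=
  { s with arr := Function.update s.arr a (Function.update (s.arr a) i z) }

/-- `Exec p s t s'`: started on `s`, the program `p` halts after exactly `t` steps on `s'`. -/
inductive Exec : Prog → Store → ℕ → Store → Prop where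
  | skip (s : Store) : Exec .skip s 1 s
  | assign (s : Store) (x : ℕ) (e : Expr) :
      Exec (.assign x e) s (e.cost + 1) (s.setReg x (e.eval s))
  | write (s : Store) (a : ℕ) (i e : Expr) :
      Exec (.write a i e) s (i.cost + e.cost + 1) (s.setArr a (i.eval s) (e.eval s))
  | seq {p q : Prog} {s₁ s₂ s₃ : Store} {t₁ t₂ : ℕ} :
      Exec p s₁ t₁ s₂ → Exec q s₂ t₂ s₃ → Exec (.seq p q) s₁ (t₁ + t₂) s₃
  | iteTrue {e₁ e₂ : Expr} {p q : Prog} {s s' : Store} {t : ℕ} :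
      e₁.eval s ≤ e₂.eval s → Exec p s t s' →
      Exec (.ite e₁ e₂ p q) s (e₁.cost + e₂.cost + 1 + t) s'
  | iteFalse {e₁ e₂ : Expr} {p q : Prog} {s s' : Store} {t : ℕ} :
      ¬ e₁.eval s ≤ e₂.eval s → Exec q s t s' →
      Exec (.ite e₁ e₂ p q) s (e₁.cost + e₂.cost + 1 + t) s'
  | loopStop {e₁ e₂ : Expr} {p : Prog} {s : Store} :
      ¬ e₁.eval s ≤ e₂.eval s → Exec (.loop e₁ e₂ p) s (e₁.cost + e₂.cost + 1) s
  | loopStep {e₁ e₂ : Expr} {p : Prog} {s₁ s₂ s₃ : Store} {t₁ t₂ : ℕ} :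
      e₁.eval s₁ ≤ e₂.eval s₁ → Exec p s₁ t₁ s₂ → Exec (.loop e₁ e₂ p) s₂ t₂ s₃ →
      Exec (.loop e₁ e₂ p) s₁ (e₁.cost + e₂.cost + 1 + t₁ + t₂) s₃

end RAM

/-- The store `s` contains the instance `I`. Registers 0, 1, 2 hold the number of vertices, the
number `m` of edges, and the budget. The edges are listed, each once, in an arbitrary order and
orientation: entry `i < m` of the arrays 0 and 1 gives the endpoints of the `i`-th edge, and entry
`i` of array `2 + a` is 1 or 0 depending on whether color `a` is in the list of that edge.
All other registers and entries are arbitrary. -/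
def Encodes {c : ℕ} (s : RAM.Store) (I : ELInstance c) : Prop :=
  s.reg 0 = I.n ∧ s.reg 1 = I.numEdges ∧ s.reg 2 = I.k ∧
    ∃ edge : Fin I.numEdges ≃ I.G.edgeSet, ∀ i : Fin I.numEdges,
      (∃ u v : Fin I.n, (edge i : Sym2 (Fin I.n)) = s(u, v) ∧
        s.arr 0 (i : ℕ) = (u : ℕ) ∧ s.arr 1 (i : ℕ) = (v : ℕ)) ∧
      ∀ a : Fin c, s.arr (2 + a) (i : ℕ) = if a ∈ I.Ψ (edge i) then 1 else 0

/-- `I'` is an equivalent instance of the problem `Q` that meets the size bounds of the kernel in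
terms of `ξ₂` of the graph of `I`. The new budget lies between 0 and the new number of edges,
except that it may be `-1` if `ξ₂ = 0`: there the new graph is empty, and only a negative budget
gives a no-instance. -/
def IsKernelOf {c : ℕ} (Q : ELInstance c → Prop) (I' I : ELInstance c) : Prop :=
  (Q I' ↔ Q I) ∧
    I'.numEdges ≤ 11 * xi I.G 2 ∧ I'.n ≤ 10 * xi I.G 2 ∧
    I'.k ≤ I'.numEdges ∧ (0 ≤ I'.k ∨ (xi I.G 2 = 0 ∧ I'.k = -1))

/-- On every instance `I` of `Q`, the program `P` halts within `C * (n ^ 2 + 1)` steps, where `n`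
is the number of vertices, and leaves a kernel of `I` in the store. -/
def ComputesKernel {c : ℕ} (Q : ELInstance c → Prop) (P : RAM.Prog) (C : ℕ) : Prop :=
  ∀ (I : ELInstance c) (s : RAM.Store), Encodes s I →
    ∃ (t : ℕ) (s' : RAM.Store) (I' : ELInstance c),
      RAM.Exec P s t s' ∧ t ≤ C * (I.n ^ 2 + 1) ∧ Encodes s' I' ∧ IsKernelOf Q I' I

/-! ## Chains of lists -/

/-! Both problems ask for edge labels in which conflicting edges never share a strong color, with
few weak edges. In ECS, edges conflict when they meet; in Multi-STC, when they meet and no third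
edge completes a triangle. `St.Conf` covers both by the parameter `tri`, and the whole argument is
carried out for either value.

The kernel comes from local rules at vertices of degree at most two. A component that is a single
edge or a cycle of length three to five is deleted, and its optimum is subtracted from the budget. A
leaf attached to a vertex of degree two is deleted after possibly removing one color from the list
of the neighboring edge (`pendant_equiv`). The main rule shortens a path of six edges whose five
inner vertices have degree two. The rest of the graph sees the four middle edges only through the
labels of the first and last edge. By `exists_shorter_chain`, the minimum cost of the four edges is,
up to an additive constant, one of seven functions of these two labels, and each of them is the cost
of a path of two or three edges with suitable lists. The first and last edge stay, so the new middle
edges lie in no triangle even if the path closes up to a cycle.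

If no rule applies, every leaf is adjacent to a vertex of degree at least three, and every vertex of
degree two is within distance two of one. Low vertices can then be charged to the edges between high
and low vertices. The number of those is bounded by the degree sum of the high vertices, which a
deletion set controls. This is `bounds_of_stuck`, the source of the constants 11 and 10. The rules
change incidences only at vertices whose degree is at most two before and after. So a deletion set
restricts to one for the reduced graph, and conversely an edgeless result means that the original
graph had maximum degree two.

For the running time, each vertex stores its degree and the sum of its incident edge numbers, so
that the other edge at a vertex of degree two, and the other end of an edge, are found by
subtraction. A rule attempt takes time depending only on `c`: the lists are read by a decision tree
(`dispatch`) whose leaves contain the required costs and replacement lists as constants. Every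
successful attempt isolates a vertex for good, so at most n + 1 sweeps over the vertices suffice.
Finally the graph is renumbered and the budget is capped at the number of edges; a negative budget
is replaced by a trivial no-instance. -/

/-- Two labels do not clash: they are not the same strong color. -/
def Compat {c : ℕ} (i j : Option (Fin c)) : Prop := ∀ a, ¬ (i = some a ∧ j = some a)

/-- The label is weak or from the list. -/
def Allowed {c : ℕ} (l : Finset (Fin c)) (y : Option (Fin c)) : Prop := ∀ a, y = some a → a ∈ l

/-- The cost of a label: one if weak. -/
def wt {c : ℕ} (y : Option (Fin c)) : ℤ := if y = none then 1 else 0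

/-- The edges of a path with lists `ls` whose outer neighbors are labeled `i` and `j` have a
labeling with at most `w` weak edges. -/
def Feas {c : ℕ} : List (Finset (Fin c)) → Option (Fin c) → Option (Fin c) → ℤ → Prop
  | [], i, j, w => Compat i j ∧ 0 ≤ w
  | l :: ls, i, j, w => ∃ y, Allowed l y ∧ Compat i y ∧ Feas ls y j (w - wt y)

section
variable {c : ℕ}

@[simp] lemma compat_none_left (j : Option (Fin c)) : Compat none j := by simp [Compat]
@[simp] lemma compat_none_right (j : Option (Fin c)) : Compat j none := by simp [Compat]
@[simp] lemma compat_some (i j : Fin c) : Compat (some i) (some j) ↔ i ≠ j := by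
  simp [Compat, eq_comm]
lemma Compat.symm {i j : Option (Fin c)} (h : Compat i j) : Compat j i := fun a ha => h a ha.symm
lemma compat_some_left (i : Fin c) (j : Option (Fin c)) : Compat (some i) j ↔ j ≠ some i := by
  cases j <;> simp [eq_comm]
lemma compat_some_right (i : Fin c) (j : Option (Fin c)) : Compat j (some i) ↔ j ≠ some i := by
  cases j <;> simp
@[simp] lemma allowed_none (l : Finset (Fin c)) : Allowed l none := by simp [Allowed]
@[simp] lemma allowed_some (l : Finset (Fin c)) (a : Fin c) : Allowed l (some a) ↔ a ∈ l := by
  simp [Allowed]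
@[simp] lemma wt_none : wt (none : Option (Fin c)) = 1 := by simp [wt]
@[simp] lemma wt_some (a : Fin c) : wt (some a) = 0 := by simp [wt]
lemma wt_nonneg (y : Option (Fin c)) : 0 ≤ wt y := by unfold wt; split_ifs <;> simp
/-- Labels of four consecutive edges that respect the lists and do not clash. -/
structure Valid4 (l₁ l₂ l₃ l₄ : Finset (Fin c)) (y₁ y₂ y₃ y₄ : Option (Fin c)) : Prop where
  a₁ : Allowed l₁ y₁
  a₂ : Allowed l₂ y₂
  a₃ : Allowed l₃ y₃
  a₄ : Allowed l₄ y₄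
  c₁ : Compat y₁ y₂
  c₂ : Compat y₂ y₃
  c₃ : Compat y₃ y₄

/-- The minimum cost of the path `ls` is the function `f` of the outer labels. -/
def HasCost (ls : List (Finset (Fin c))) (f : Option (Fin c) → Option (Fin c) → ℤ) : Prop :=
  ∀ i j w, Feas ls i j w ↔ f i j ≤ w

/-- Splitting the first label into weak and strong lets `simp` evaluate the cost of a concrete short
path. -/
lemma feas_cons (l : Finset (Fin c)) (ls i j w) :
    Feas (l :: ls) i j w ↔ (Compat i none ∧ Feas ls none j (w - 1)) ∨
      ∃ a ∈ l, Compat i (some a) ∧ Feas ls (some a) j w := by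
  simp only [Feas]
  constructor
  · rintro ⟨_ | a, h1, h2, h3⟩
    · exact Or.inl ⟨h2, by simpa using h3⟩
    · exact Or.inr ⟨a, by simpa using h1, h2, by simpa using h3⟩
  · rintro (⟨h2, h3⟩ | ⟨a, h1, h2, h3⟩)
    · exact ⟨none, by simp, h2, by simpa using h3⟩
    · exact ⟨some a, by simpa using h1, h2, by simpa using h3⟩

lemma feas_nil (i j : Option (Fin c)) (w) : Feas [] i j w ↔ Compat i j ∧ 0 ≤ w := Iff.rfl

/-- This is the first of nine gadgets of two or three edges, from which all replacements are taken.
Edges with empty list are always weak, so the two sides do not interact with the path. -/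
lemma hasCost_free : HasCost [(∅ : Finset (Fin c)), ∅] (fun _ _ => 2) := by
  intro i j w
  simp [feas_cons, feas_nil]
  omega

lemma hasCost_left (α : Fin c) :
    HasCost [{α}, ∅] (fun i _ => 1 + if i = some α then 1 else 0) := by
  intro i j w
  simp only [feas_cons, feas_nil]
  by_cases h : i = some α <;> simp [h, compat_some_right] <;> omega

lemma hasCost_right (β : Fin c) :
    HasCost [∅, {β}] (fun _ j => 1 + if j = some β then 1 else 0) := by
  intro i j w
  simp only [feas_cons, feas_nil]
  by_cases h : j = some β <;> simp [h, compat_some_left] <;> omega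

/-- The weak middle edge decouples the ends, so the penalties of the two sides add up. -/
lemma hasCost_both (α β : Fin c) :
    HasCost [{α}, ∅, {β}]
      (fun i j => 1 + ((if i = some α then 1 else 0) + if j = some β then 1 else 0)) := by
  intro i j w
  simp only [feas_cons, feas_nil]
  by_cases h : j = some β <;> by_cases h' : i = some α <;>
    simp [h, h', compat_some_left, compat_some_right] <;> omega

/-- Cost one is possible only as α, weak, α, which needs both sides free of α. With weak, α, weak
the cost is two whatever the outer labels are. -/
lemma hasCost_or_self (α : Fin c) :
    HasCost [{α}, {α}, {α}] (fun i j => 1 + if i = some α ∨ j = some α then 1 else 0) := by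
  intro i j w
  simp only [feas_cons, feas_nil]
  by_cases h : j = some α <;> by_cases h' : i = some α <;>
    simp [h, h', compat_some_left, compat_some_right] <;> omega

/-- The only labeling without weak edges is α, β. If it is blocked, a weak first edge leaves the
second one a choice of two colors, one of which differs from the outer label. -/
lemma hasCost_or_ne (α β : Fin c) (hne : α ≠ β) :
    HasCost [{α}, {α, β}] (fun i j => if i = some α ∨ j = some β then 1 else 0) := by
  intro i j w
  simp only [feas_cons, feas_nil]
  by_cases h : j = some β <;> by_cases h' : i = some α <;> by_cases h'' : j = some α <;>
    simp_all [compat_some_left, compat_some_right] <;> omega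

/-- One of the two edges must be weak, and it can be placed at whichever side is blocked. -/
lemma hasCost_and_self (α : Fin c) :
    HasCost [{α}, {α}] (fun i j => 1 + if i = some α ∧ j = some α then 1 else 0) := by
  intro i j w
  simp only [feas_cons, feas_nil]
  by_cases h : j = some α <;> by_cases h' : i = some α <;>
    simp_all [compat_some_left, compat_some_right] <;> omega

/-- The middle edge clashes with one end whichever color it takes, so one edge is weak, and a
blocked end can take that role. Only blocking both ends forces a second weak edge. -/
lemma hasCost_and_ne (α β : Fin c) (hne : α ≠ β) :
    HasCost [{α}, {α, β}, {β}] (fun i j => 1 + if i = some α ∧ j = some β then 1 else 0) := by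
  intro i j w
  simp only [feas_cons, feas_nil]
  by_cases h : j = some β <;> by_cases h' : i = some α <;>
    simp_all [compat_some_left, compat_some_right] <;> omega

/-- The two labelings without weak edges are α, β and β, α. An outer pair blocks both exactly if it
consists of twice the same of these colors. -/
lemma hasCost_swap (α β : Fin c) (hne : α ≠ β) :
    HasCost [{α, β}, {α, β}]
      (fun i j => if (i = some α ∧ j = some α) ∨ (i = some β ∧ j = some β) then 1 else 0) := by
  intro i j w
  have := hne.symm
  simp only [feas_cons, feas_nil]
  by_cases h : i = some α
  · by_cases h' : j = some α
    · simp_all [compat_some_right]; omega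
    · by_cases h'' : j = some β <;> simp_all [compat_some_left, compat_some_right] <;> omega
  · by_cases h1 : i = some β
    · by_cases h' : j = some α
      · simp_all [compat_some_right]; omega
      · by_cases h'' : j = some β <;> simp_all [compat_some_left, compat_some_right] <;> omega
    · by_cases h' : j = some α
      · simp_all [compat_some_right]; omega
      · by_cases h'' : j = some β <;> simp_all [compat_some_left, compat_some_right] <;> omega

end

/-! ### Excess functions of four consecutive edges -/

section
variable {c : ℕ}

/-- The cost of four labels. -/
def wt4 (y₁ y₂ y₃ y₄ : Option (Fin c)) : ℤ := wt y₁ + wt y₂ + wt y₃ + wt y₄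

lemma feas_four (l₁ l₂ l₃ l₄ : Finset (Fin c)) (i j w) :
    Feas [l₁, l₂, l₃, l₄] i j w ↔ ∃ y₁ y₂ y₃ y₄, Valid4 l₁ l₂ l₃ l₄ y₁ y₂ y₃ y₄ ∧
      Compat i y₁ ∧ Compat y₄ j ∧ wt4 y₁ y₂ y₃ y₄ ≤ w := by
  simp only [Feas, wt4]
  constructor
  · rintro ⟨y₁, h1, h2, y₂, h3, h4, y₃, h5, h6, y₄, h7, h8, h9, h10⟩
    exact ⟨y₁, y₂, y₃, y₄, ⟨h1, h3, h5, h7, h4, h6, h8⟩, h2, h9, by linarith⟩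
  · rintro ⟨y₁, y₂, y₃, y₄, ⟨h1, h3, h5, h7, h4, h6, h8⟩, h2, h9, h10⟩
    exact ⟨y₁, h1, h2, y₂, h3, h4, y₃, h5, h6, y₄, h7, h8, h9, by linarith⟩

/-- The excess over the optimum `O` that the outer labels force is `A`. -/
structure HasExcess (l₁ l₂ l₃ l₄ : Finset (Fin c)) (O : ℤ)
    (A : Option (Fin c) → Option (Fin c) → ℤ) : Prop where
  lower : ∀ i j y₁ y₂ y₃ y₄, Valid4 l₁ l₂ l₃ l₄ y₁ y₂ y₃ y₄ → Compat i y₁ → Compat y₄ j →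
    O + A i j ≤ wt4 y₁ y₂ y₃ y₄
  upper : ∀ i j, ∃ y₁ y₂ y₃ y₄, Valid4 l₁ l₂ l₃ l₄ y₁ y₂ y₃ y₄ ∧ Compat i y₁ ∧ Compat y₄ j ∧
    wt4 y₁ y₂ y₃ y₄ ≤ O + A i j

/-- Four edges and a gadget with the same excess function differ only in their base costs, so
exchanging them shifts the budget by a constant. -/
lemma HasExcess.equiv {l₁ l₂ l₃ l₄ : Finset (Fin c)} {O : ℤ}
    {A : Option (Fin c) → Option (Fin c) → ℤ} (h : HasExcess l₁ l₂ l₃ l₄ O A)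
    {ls : List (Finset (Fin c))} {κ : ℤ} (h' : HasCost ls (fun i j => κ + A i j)) :
    ∀ i j w, Feas [l₁, l₂, l₃, l₄] i j (w + (O - κ)) ↔ Feas ls i j w := by
  intro i j w
  rw [h' i j w, feas_four]
  constructor
  · rintro ⟨y₁, y₂, y₃, y₄, h1, h2, h3, h4⟩
    have := h.lower i j _ _ _ _ h1 h2 h3
    linarith
  · intro hw
    obtain ⟨y₁, y₂, y₃, y₄, h1, h2, h3, h4⟩ := h.upper i j
    exact ⟨y₁, y₂, y₃, y₄, h1, h2, h3, by linarith⟩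

/-- A set of integers that is upward closed, nonempty and bounded below is a half-line. -/
lemma exists_threshold (F : ℤ → Prop) (hmono : ∀ w w', w ≤ w' → F w → F w')
    (hne : ∃ w, F w) (b : ℤ) (hb : ∀ w, F w → b ≤ w) : ∃ m, ∀ w, F w ↔ m ≤ w := by
  obtain ⟨m, hm, hle⟩ := Int.exists_least_of_bdd ⟨b, hb⟩ hne
  exact ⟨m, fun w => ⟨hle w, fun h => hmono m w h hm⟩⟩

variable {l₁ l₂ l₃ l₄ : Finset (Fin c)} {y₁ y₂ y₃ y₄ x₁ x₂ x₃ x₄ : Option (Fin c)}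

/-- A weak end edge clashes with nothing and costs at most one more. Hence a blocked end never costs
more than one. -/
lemma Valid4.weaken_first (h : Valid4 l₁ l₂ l₃ l₄ y₁ y₂ y₃ y₄) :
    Valid4 l₁ l₂ l₃ l₄ none y₂ y₃ y₄ := ⟨by simp, h.a₂, h.a₃, h.a₄, by simp, h.c₂, h.c₃⟩

lemma Valid4.weaken_last (h : Valid4 l₁ l₂ l₃ l₄ y₁ y₂ y₃ y₄) :
    Valid4 l₁ l₂ l₃ l₄ y₁ y₂ y₃ none := ⟨h.a₁, h.a₂, h.a₃, by simp, h.c₁, h.c₂, by simp⟩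

lemma wt4_weaken_first : wt4 none y₂ y₃ y₄ ≤ wt4 y₁ y₂ y₃ y₄ + 1 := by
  have := wt_nonneg y₁
  simp only [wt4, wt_none]; linarith

lemma wt4_weaken_last : wt4 y₁ y₂ y₃ none ≤ wt4 y₁ y₂ y₃ y₄ + 1 := by
  have := wt_nonneg y₄
  simp only [wt4, wt_none]; linarith

/-- The two optimal labelings of four consecutive edges with list-independent crossing ends
alternate between two colors. -/
lemma alternating_of_two_optima {O : ℤ} {a a' b b' : Fin c}
    (hO : ∀ y₁ y₂ y₃ y₄, Valid4 l₁ l₂ l₃ l₄ y₁ y₂ y₃ y₄ → O ≤ wt4 y₁ y₂ y₃ y₄)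
    (hends : ∀ y₁ y₂ y₃ y₄, Valid4 l₁ l₂ l₃ l₄ y₁ y₂ y₃ y₄ → wt4 y₁ y₂ y₃ y₄ = O →
      (y₁ = some a ∧ y₄ = some b') ∨ (y₁ = some a' ∧ y₄ = some b))
    (haa : a ≠ a') (hbb : b ≠ b')
    (hx : Valid4 l₁ l₂ l₃ l₄ (some a) x₂ x₃ (some b'))
    (hxO : wt4 (some a) x₂ x₃ (some b') = O)
    (hy : Valid4 l₁ l₂ l₃ l₄ (some a') y₂ y₃ (some b))
    (hyO : wt4 (some a') y₂ y₃ (some b) = O) : b = a ∧ b' = a' := by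
  -- A valid labeling with any other pair of ends costs at least one more than the optimum.
  have notopt : ∀ z₁ z₂ z₃ z₄, Valid4 l₁ l₂ l₃ l₄ z₁ z₂ z₃ z₄ →
      ¬ ((z₁ = some a ∧ z₄ = some b') ∨ (z₁ = some a' ∧ z₄ = some b)) →
      O + 1 ≤ wt4 z₁ z₂ z₃ z₄ := by
    intro z₁ z₂ z₃ z₄ hz hn
    have h1 := hO _ _ _ _ hz
    have h2 : wt4 z₁ z₂ z₃ z₄ ≠ O := fun h => hn (hends _ _ _ _ hz h)
    omega
  have pa : ∀ l : Finset (Fin c), Allowed l none := fun l => allowed_none l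
  obtain ⟨xa1, xa2, xa3, xa4, xc1, xc2, xc3⟩ := hx
  obtain ⟨ya1, ya2, ya3, ya4, yc1, yc2, yc3⟩ := hy
  have e1 := wt_nonneg x₂; have e2 := wt_nonneg x₃
  have e3 := wt_nonneg y₂; have e4 := wt_nonneg y₃
  have nc : ∀ u v : Option (Fin c), ¬ Compat u v → ∃ a, u = some a ∧ v = some a := by
    intro u v h; simpa [Compat] using h
  simp only [wt4, wt_some] at hxO hyO
  -- Exchange argument: replacing the first edge of the second optimum by that of the first keeps
  -- the cost and produces the ends a, b, which no optimum has. So the exchange must create a clash.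
  -- The steps below repeat this with longer initial segments until every label is determined.
  have k1 : ¬ Compat (some a) y₂ := by
    intro h
    have t1 := notopt (some a) y₂ y₃ (some b) ⟨xa1, ya2, ya3, ya4, h, yc2, yc3⟩
      (by simp [haa, hbb])
    have t2 := notopt (some a') none x₃ (some b') ⟨ya1, pa _, xa3, xa4, by simp, by simp, xc3⟩
      (by simp [haa.symm, hbb.symm])
    simp only [wt4, wt_some, wt_none] at t1 t2
    linarith
  have k2 : ¬ Compat (some a') x₂ := by
    intro h
    have t1 := notopt (some a') x₂ x₃ (some b') ⟨ya1, xa2, xa3, xa4, h, xc2, xc3⟩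
      (by simp [haa.symm, hbb.symm])
    have t2 := notopt (some a) none y₃ (some b) ⟨xa1, pa _, ya3, ya4, by simp, by simp, yc3⟩
      (by simp [haa, hbb])
    simp only [wt4, wt_some, wt_none] at t1 t2
    linarith
  obtain ⟨_, h1, rfl⟩ := nc _ _ k1
  obtain ⟨_, h2, rfl⟩ := nc _ _ k2
  obtain rfl : a = _ := by simpa using h1
  obtain rfl : a' = _ := by simpa using h2
  simp only [wt_some] at *
  have k3 : ¬ Compat (some a') y₃ := by
    intro h
    have t1 := notopt (some a) (some a') y₃ (some b) ⟨xa1, xa2, ya3, ya4, xc1, h, yc3⟩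
      (by simp [haa, hbb])
    have t2 := notopt (some a') none x₃ (some b') ⟨ya1, pa _, xa3, xa4, by simp, by simp, xc3⟩
      (by simp [haa.symm, hbb.symm])
    simp only [wt4, wt_some, wt_none] at t1 t2
    linarith
  have k4 : ¬ Compat (some a) x₃ := by
    intro h
    have t1 := notopt (some a') (some a) x₃ (some b') ⟨ya1, ya2, xa3, xa4, yc1, h, xc3⟩
      (by simp [haa.symm, hbb.symm])
    have t2 := notopt (some a) none y₃ (some b) ⟨xa1, pa _, ya3, ya4, by simp, by simp, yc3⟩
      (by simp [haa, hbb])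
    simp only [wt4, wt_some, wt_none] at t1 t2
    linarith
  obtain ⟨_, h3, rfl⟩ := nc _ _ k3
  obtain ⟨_, h4, rfl⟩ := nc _ _ k4
  obtain rfl : a' = _ := by simpa using h3
  obtain rfl : a = _ := by simpa using h4
  -- All inner edges are now strong and alternate, so the optimum is zero, and the last exchange
  -- fixes the remaining end colors.
  have k5 : ¬ Compat (some a) (some b) := by
    intro h
    have t1 := notopt (some a) (some a') (some a) (some b) ⟨xa1, xa2, xa3, ya4, xc1, xc2, h⟩
      (by simp [haa, hbb])
    have t2 := notopt (some a') (some a) none (some b') ⟨ya1, ya2, pa _, xa4, yc1, by simp, by simp⟩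
      (by simp [haa.symm, hbb.symm])
    have t3 := notopt (some a') none (some a) (some b') ⟨ya1, pa _, xa3, xa4, by simp, by simp, xc3⟩
      (by simp [haa.symm, hbb.symm])
    simp only [wt4, wt_some, wt_none] at t1 t2 hxO hyO
    linarith
  have k6 : ¬ Compat (some a') (some b') := by
    intro h
    have t1 := notopt (some a') (some a) (some a') (some b') ⟨ya1, ya2, ya3, xa4, yc1, yc2, h⟩
      (by simp [haa.symm, hbb.symm])
    simp only [wt4, wt_some] at t1 hxO hyO
    linarith
  simp only [compat_some, not_not] at k5 k6
  exact ⟨k5.symm, k6.symm⟩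

/-- Every path of four edges with lists is equivalent to a path of two or three edges, up to a
change of the budget. -/
theorem exists_shorter_chain (l₁ l₂ l₃ l₄ : Finset (Fin c)) :
    ∃ (ls : List (Finset (Fin c))) (d : ℤ), ((∃ a b, ls = [a, b]) ∨ ∃ a b e, ls = [a, b, e]) ∧
      ∀ i j w, Feas [l₁, l₂, l₃, l₄] i j (w + d) ↔ Feas ls i j w := by
  classical
  -- O is the minimum cost when nothing is imposed from outside; making all four edges weak shows
  -- that it exists.
  obtain ⟨O, hO⟩ := exists_threshold
    (fun w => ∃ y₁ y₂ y₃ y₄, Valid4 l₁ l₂ l₃ l₄ y₁ y₂ y₃ y₄ ∧ wt4 y₁ y₂ y₃ y₄ ≤ w)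
    (fun w w' h ⟨y₁, y₂, y₃, y₄, h1, h2⟩ => ⟨y₁, y₂, y₃, y₄, h1, h2.trans h⟩)
    ⟨4, none, none, none, none, ⟨by simp, by simp, by simp, by simp, by simp, by simp, by simp⟩,
      by simp [wt4]⟩ 0
    (fun w ⟨y₁, y₂, y₃, y₄, _, h2⟩ => le_trans (by
      have := wt_nonneg y₁; have := wt_nonneg y₂; have := wt_nonneg y₃; have := wt_nonneg y₄
      unfold wt4; linarith) h2)
  have hmin : ∀ y₁ y₂ y₃ y₄, Valid4 l₁ l₂ l₃ l₄ y₁ y₂ y₃ y₄ → O ≤ wt4 y₁ y₂ y₃ y₄ :=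
    fun y₁ y₂ y₃ y₄ h => (hO _).1 ⟨y₁, y₂, y₃, y₄, h, le_rfl⟩
  obtain ⟨o₁, o₂, o₃, o₄, ho, hoO⟩ := (hO O).2 le_rfl
  replace hoO : wt4 o₁ o₂ o₃ o₄ = O := le_antisymm hoO (hmin _ _ _ _ ho)
  have key : ∀ (ls : List (Finset (Fin c))) (κ : ℤ) (A : Option (Fin c) → Option (Fin c) → ℤ),
      HasCost ls (fun i j => κ + A i j) → HasExcess l₁ l₂ l₃ l₄ O A →
      ((∃ a b, ls = [a, b]) ∨ ∃ a b e, ls = [a, b, e]) →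
      ∃ (ls : List (Finset (Fin c))) (d : ℤ), ((∃ a b, ls = [a, b]) ∨ ∃ a b e, ls = [a, b, e]) ∧
      ∀ i j w, Feas [l₁, l₂, l₃, l₄] i j (w + d) ↔ Feas ls i j w :=
    fun ls κ A h1 h2 h3 => ⟨ls, O - κ, h3, h2.equiv h1⟩
  have strict : ∀ y₁ y₂ y₃ y₄, Valid4 l₁ l₂ l₃ l₄ y₁ y₂ y₃ y₄ → wt4 y₁ y₂ y₃ y₄ ≠ O →
      O + 1 ≤ wt4 y₁ y₂ y₃ y₄ := by
    intro y₁ y₂ y₃ y₄ h h'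
    have := hmin _ _ _ _ h
    omega
  -- An end is critical if all optima give it the same color. The excess depends on which ends are
  -- critical and on how the end colors of the optima are correlated.
  by_cases hL : ∃ α, ∀ y₁ y₂ y₃ y₄, Valid4 l₁ l₂ l₃ l₄ y₁ y₂ y₃ y₄ → wt4 y₁ y₂ y₃ y₄ = O →
      y₁ = some α
  · obtain ⟨α, hα⟩ := hL
    by_cases hR : ∃ β, ∀ y₁ y₂ y₃ y₄, Valid4 l₁ l₂ l₃ l₄ y₁ y₂ y₃ y₄ → wt4 y₁ y₂ y₃ y₄ = O →
        y₄ = some β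
    · obtain ⟨β, hβ⟩ := hR
      obtain rfl := hα _ _ _ _ ho hoO
      obtain rfl := hβ _ _ _ _ ho hoO
      -- With both ends critical, blocking either one costs exactly one. It remains to see whether
      -- blocking both costs one (disjunction) or two (sum).
      by_cases hs : ∃ y₁ y₂ y₃ y₄, Valid4 l₁ l₂ l₃ l₄ y₁ y₂ y₃ y₄ ∧ wt4 y₁ y₂ y₃ y₄ ≤ O + 1 ∧
          y₁ ≠ some α ∧ y₄ ≠ some β
      · have hex : HasExcess l₁ l₂ l₃ l₄ O (fun i j => if i = some α ∨ j = some β then 1 else 0) := by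
          constructor
          · intro i j y₁ y₂ y₃ y₄ hv h1 h2
            try dsimp only
            split_ifs with h
            · apply strict _ _ _ _ hv
              intro hopt
              have e1 := hα _ _ _ _ hv hopt
              have e2 := hβ _ _ _ _ hv hopt
              subst e1 e2
              rcases h with rfl | rfl <;> simp at h1 h2
            · simpa using hmin _ _ _ _ hv
          · intro i j
            by_cases h1 : i = some α <;> by_cases h2 : j = some β
            · obtain ⟨y₁, y₂, y₃, y₄, hv, hw, n1, n2⟩ := hs
              exact ⟨y₁, y₂, y₃, y₄, hv, by simpa [h1, compat_some_left] using n1,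
                by simpa [h2, compat_some_right] using n2, by simpa [h1] using hw⟩
            · exact ⟨_, _, _, _, ho.weaken_first, by simp, by simpa [compat_some_left] using h2,
                by simp [h1]; linarith [wt4_weaken_first (y₁ := some α) (y₂ := o₂) (y₃ := o₃) (y₄ := some β)]⟩
            · exact ⟨_, _, _, _, ho.weaken_last, by simpa [compat_some_right] using h1, by simp,
                by simp [h2]; linarith [wt4_weaken_last (y₁ := some α) (y₂ := o₂) (y₃ := o₃) (y₄ := some β)]⟩
            · exact ⟨_, _, _, _, ho, by simpa [compat_some_right] using h1,
                by simpa [compat_some_left] using h2, by simp [h1, h2, hoO]⟩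
        by_cases hab : α = β
        · subst hab
          exact key _ 1 _ (hasCost_or_self α) hex (by simp)
        · exact key _ 0 _ (by simpa using hasCost_or_ne α β hab) hex (by simp)
      · refine key _ 1 _ (hasCost_both α β) ⟨?_, ?_⟩ (by simp)
        · intro i j y₁ y₂ y₃ y₄ hv h1 h2
          by_cases hi : i = some α <;> by_cases hj : j = some β
          · subst hi hj
            rw [compat_some_left] at h1
            rw [compat_some_right] at h2
            have : ¬ wt4 y₁ y₂ y₃ y₄ ≤ O + 1 := fun h => hs ⟨_, _, _, _, hv, h, h1, h2⟩
            simp; omega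
          · subst hi
            rw [compat_some_left] at h1
            simpa [hj] using strict _ _ _ _ hv (fun h => h1 (hα _ _ _ _ hv h))
          · subst hj
            rw [compat_some_right] at h2
            simpa [hi] using strict _ _ _ _ hv (fun h => h2 (hβ _ _ _ _ hv h))
          · simpa [hi, hj] using hmin _ _ _ _ hv
        · have w1 := wt4_weaken_first (y₁ := some α) (y₂ := o₂) (y₃ := o₃) (y₄ := some β)
          have w2 := wt4_weaken_last (y₁ := some α) (y₂ := o₂) (y₃ := o₃) (y₄ := some β)
          have w3 := wt4_weaken_last (y₁ := none) (y₂ := o₂) (y₃ := o₃) (y₄ := some β)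
          intro i j
          by_cases h1 : i = some α <;> by_cases h2 : j = some β
          · exact ⟨_, _, _, _, ho.weaken_first.weaken_last, by simp, by simp,
              by simp [h1, h2]; linarith⟩
          · exact ⟨_, _, _, _, ho.weaken_first, by simp, by simpa [compat_some_left] using h2,
              by simp [h1, h2]; linarith⟩
          · exact ⟨_, _, _, _, ho.weaken_last, by simpa [compat_some_right] using h1, by simp,
              by simp [h1, h2]; linarith⟩
          · exact ⟨_, _, _, _, ho, by simpa [compat_some_right] using h1,
              by simpa [compat_some_left] using h2, by simp [h1, h2, hoO]⟩
    · push Not at hR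
      -- The right end is not critical, so every right label is compatible with some optimum, and
      -- only the color α on the left costs anything.
      refine key _ 1 _ (hasCost_left α) ⟨?_, ?_⟩ (by simp)
      · intro i j y₁ y₂ y₃ y₄ hv h1 h2
        by_cases hi : i = some α
        · subst hi
          rw [compat_some_left] at h1
          simpa using strict _ _ _ _ hv (fun h => h1 (hα _ _ _ _ hv h))
        · simpa [hi] using hmin _ _ _ _ hv
      · intro i j
        obtain ⟨y₁, y₂, y₃, y₄, hv, hopt, hc⟩ : ∃ y₁ y₂ y₃ y₄, Valid4 l₁ l₂ l₃ l₄ y₁ y₂ y₃ y₄ ∧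
            wt4 y₁ y₂ y₃ y₄ = O ∧ Compat y₄ j := by
          cases j with
          | none => exact ⟨_, _, _, _, ho, hoO, by simp⟩
          | some b =>
            obtain ⟨y₁, y₂, y₃, y₄, hv, hopt, hc⟩ := hR b
            exact ⟨_, _, _, _, hv, hopt, by rwa [compat_some_right]⟩
        by_cases h1 : i = some α
        · exact ⟨_, _, _, _, hv.weaken_first, by simp, hc, by
            simp [h1]; linarith [wt4_weaken_first (y₁ := y₁) (y₂ := y₂) (y₃ := y₃) (y₄ := y₄)]⟩
        · refine ⟨_, _, _, _, hv, ?_, hc, by simp [h1, hopt]⟩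
          rw [hα _ _ _ _ hv hopt, compat_some_right]
          exact h1
  · by_cases hR : ∃ β, ∀ y₁ y₂ y₃ y₄, Valid4 l₁ l₂ l₃ l₄ y₁ y₂ y₃ y₄ → wt4 y₁ y₂ y₃ y₄ = O →
        y₄ = some β
    · obtain ⟨β, hβ⟩ := hR
      push Not at hL
      refine key _ 1 _ (hasCost_right β) ⟨?_, ?_⟩ (by simp)
      · intro i j y₁ y₂ y₃ y₄ hv h1 h2
        by_cases hj : j = some β
        · subst hj
          rw [compat_some_right] at h2
          simpa using strict _ _ _ _ hv (fun h => h2 (hβ _ _ _ _ hv h))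
        · simpa [hj] using hmin _ _ _ _ hv
      · intro i j
        obtain ⟨y₁, y₂, y₃, y₄, hv, hopt, hc⟩ : ∃ y₁ y₂ y₃ y₄, Valid4 l₁ l₂ l₃ l₄ y₁ y₂ y₃ y₄ ∧
            wt4 y₁ y₂ y₃ y₄ = O ∧ Compat i y₁ := by
          cases i with
          | none => exact ⟨_, _, _, _, ho, hoO, by simp⟩
          | some b =>
            obtain ⟨y₁, y₂, y₃, y₄, hv, hopt, hc⟩ := hL b
            exact ⟨_, _, _, _, hv, hopt, by rwa [compat_some_left]⟩
        by_cases h1 : j = some β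
        · exact ⟨_, _, _, _, hv.weaken_last, hc, by simp, by
            simp [h1]; linarith [wt4_weaken_last (y₁ := y₁) (y₂ := y₂) (y₃ := y₃) (y₄ := y₄)]⟩
        · refine ⟨_, _, _, _, hv, hc, ?_, by simp [h1, hopt]⟩
          rw [hβ _ _ _ _ hv hopt, compat_some_left]
          exact h1
    · push Not at hL hR
      -- With no critical end, some optimum avoids any single outer color. Only a pair of outer
      -- colors can block all optima.
      have good : ∀ i j, (∀ a b, i = some a → j = some b → ∃ y₁ y₂ y₃ y₄,
          Valid4 l₁ l₂ l₃ l₄ y₁ y₂ y₃ y₄ ∧ wt4 y₁ y₂ y₃ y₄ = O ∧ y₁ ≠ some a ∧ y₄ ≠ some b) →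
          ∃ y₁ y₂ y₃ y₄, Valid4 l₁ l₂ l₃ l₄ y₁ y₂ y₃ y₄ ∧ Compat i y₁ ∧ Compat y₄ j ∧
            wt4 y₁ y₂ y₃ y₄ ≤ O := by
        intro i j h
        rcases i with _ | a <;> rcases j with _ | b
        · exact ⟨_, _, _, _, ho, by simp, by simp, hoO.le⟩
        · obtain ⟨y₁, y₂, y₃, y₄, hv, hopt, hc⟩ := hR b
          exact ⟨_, _, _, _, hv, by simp, by rwa [compat_some_right], hopt.le⟩
        · obtain ⟨y₁, y₂, y₃, y₄, hv, hopt, hc⟩ := hL a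
          exact ⟨_, _, _, _, hv, by rwa [compat_some_left], by simp, hopt.le⟩
        · obtain ⟨y₁, y₂, y₃, y₄, hv, hopt, hc1, hc2⟩ := h a b rfl rfl
          exact ⟨_, _, _, _, hv, by rwa [compat_some_left], by rwa [compat_some_right], hopt.le⟩
      -- An excess of one always suffices: take an optimum that respects the left label and make its
      -- last edge weak.
      have upper1 : ∀ i j, ∃ y₁ y₂ y₃ y₄, Valid4 l₁ l₂ l₃ l₄ y₁ y₂ y₃ y₄ ∧ Compat i y₁ ∧
          Compat y₄ j ∧ wt4 y₁ y₂ y₃ y₄ ≤ O + 1 := by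
        intro i j
        obtain ⟨y₁, y₂, y₃, y₄, hv, h1, _, h3⟩ := good i none (by simp)
        refine ⟨_, _, _, _, hv.weaken_last, h1, by simp, ?_⟩
        linarith [wt4_weaken_last (y₁ := y₁) (y₂ := y₂) (y₃ := y₃) (y₄ := y₄)]
      -- A pair of outer colors is bad if every optimum meets one of them at its end. No bad pair
      -- gives the constant gadget, one gives a conjunction, and two give the swap gadget.
      by_cases hbad : ∃ a b, ∀ y₁ y₂ y₃ y₄, Valid4 l₁ l₂ l₃ l₄ y₁ y₂ y₃ y₄ →
          wt4 y₁ y₂ y₃ y₄ = O → y₁ = some a ∨ y₄ = some b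
      · obtain ⟨a, b, hab⟩ := hbad
        by_cases hbad' : ∃ a' b', (a' ≠ a ∨ b' ≠ b) ∧ ∀ y₁ y₂ y₃ y₄,
            Valid4 l₁ l₂ l₃ l₄ y₁ y₂ y₃ y₄ → wt4 y₁ y₂ y₃ y₄ = O → y₁ = some a' ∨ y₄ = some b'
        · obtain ⟨a', b', hne, hab'⟩ := hbad'
          -- Bad pairs differ in both coordinates: an optimum avoiding a shared color would have two
          -- different colors at its other end.
          have hbb : b ≠ b' := by
            rintro rfl
            have haa : a ≠ a' := by
              rintro rfl
              rcases hne with h | h <;> exact h rfl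
            obtain ⟨y₁, y₂, y₃, y₄, hv, hopt, hc⟩ := hR b
            have h1 := hab _ _ _ _ hv hopt
            have h2 := hab' _ _ _ _ hv hopt
            simp only [hc, or_false] at h1 h2
            exact haa (Option.some.inj (h1.symm.trans h2))
          have haa : a ≠ a' := by
            rintro rfl
            obtain ⟨y₁, y₂, y₃, y₄, hv, hopt, hc⟩ := hL a
            have h1 := hab _ _ _ _ hv hopt
            have h2 := hab' _ _ _ _ hv hopt
            simp only [hc, false_or] at h1 h2
            exact hbb (Option.some.inj (h1.symm.trans h2))
          have hends : ∀ y₁ y₂ y₃ y₄, Valid4 l₁ l₂ l₃ l₄ y₁ y₂ y₃ y₄ → wt4 y₁ y₂ y₃ y₄ = O →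
              (y₁ = some a ∧ y₄ = some b') ∨ (y₁ = some a' ∧ y₄ = some b) := by
            intro y₁ y₂ y₃ y₄ hv hopt
            rcases hab _ _ _ _ hv hopt with h1 | h1
            · rcases hab' _ _ _ _ hv hopt with h2 | h2
              · exact absurd (Option.some.inj (h1.symm.trans h2)) haa
              · exact Or.inl ⟨h1, h2⟩
            · rcases hab' _ _ _ _ hv hopt with h2 | h2
              · exact Or.inr ⟨h2, h1⟩
              · exact absurd (Option.some.inj (h1.symm.trans h2)) hbb
          -- Avoiding a' on the left selects an optimum with ends a, b', and avoiding a selects one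
          -- with ends a', b. Both kinds occur, as the exchange lemma requires.
          obtain ⟨x₁, x₂, x₃, x₄, hx, hxO, hx1⟩ := hL a'
          obtain ⟨z₁, z₂, z₃, z₄, hz, hzO, hz1⟩ := hL a
          have hx2 := hends _ _ _ _ hx hxO
          have hz2 := hends _ _ _ _ hz hzO
          simp only [hx1, false_and, or_false] at hx2
          simp only [hz1, false_and, false_or] at hz2
          obtain ⟨rfl, rfl⟩ := hx2
          obtain ⟨rfl, rfl⟩ := hz2
          obtain ⟨rfl, rfl⟩ := alternating_of_two_optima hmin hends haa hbb hx hxO hz hzO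
          -- After the identification the bad pairs are (b, b) and (b', b').
          refine key _ 0 _ (by simpa using hasCost_swap b b' haa) ⟨?_, ?_⟩ (by simp)
          · intro i j y₁ y₂ y₃ y₄ hv h1 h2
            try dsimp only
            split_ifs with h
            · apply strict _ _ _ _ hv
              intro hopt
              rcases h with ⟨rfl, rfl⟩ | ⟨rfl, rfl⟩ <;>
                rcases hends _ _ _ _ hv hopt with ⟨rfl, rfl⟩ | ⟨rfl, rfl⟩ <;> simp at h1 h2
            · simpa using hmin _ _ _ _ hv
          · intro i j
            try dsimp only
            split_ifs with h
            · exact upper1 i j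
            · rw [add_zero]
              apply good
              rintro p q rfl rfl
              by_cases hp : p = b
              · subst hp
                refine ⟨_, _, _, _, hz, hzO, by simpa using haa.symm, ?_⟩
                rintro ⟨⟩; simp at h
              · by_cases hq : q = b'
                · subst hq
                  exact ⟨_, _, _, _, hz, hzO, by rintro ⟨⟩; simp at h, by simpa using haa⟩
                · exact ⟨_, _, _, _, hx, hxO, by simpa using Ne.symm hp, by simpa using Ne.symm hq⟩
        · push Not at hbad'
          have hex : HasExcess l₁ l₂ l₃ l₄ O
              (fun i j => if i = some a ∧ j = some b then 1 else 0) := by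
            constructor
            · intro i j y₁ y₂ y₃ y₄ hv h1 h2
              try dsimp only
              split_ifs with h
              · apply strict _ _ _ _ hv
                intro hopt
                obtain ⟨rfl, rfl⟩ := h
                rcases hab _ _ _ _ hv hopt with rfl | rfl <;> simp at h1 h2
              · simpa using hmin _ _ _ _ hv
            · intro i j
              try dsimp only
              split_ifs with h
              · exact upper1 i j
              · rw [add_zero]
                apply good
                rintro p q rfl rfl
                exact hbad' p q (by simp at h; tauto)
          by_cases he : a = b
          · subst he
            exact key _ 1 _ (hasCost_and_self a) hex (by simp)
          · exact key _ 1 _ (hasCost_and_ne a b he) hex (by simp)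
      · push Not at hbad
        refine key _ 2 (fun _ _ => 0) (by simpa using hasCost_free) ⟨?_, ?_⟩ (by simp)
        · intro i j y₁ y₂ y₃ y₄ hv _ _
          simpa using hmin _ _ _ _ hv
        · intro i j
          simpa using good i j (fun a b _ _ => hbad a b)

end

/-! ## List colorings of a conflict relation -/

section
variable {c : ℕ}

/-- The edges of `E` have labels from their lists with at most `k` weak ones such that conflicting
edges are not in the same strong class. -/
def YesCol (E : Finset ℕ) (R : ℕ → ℕ → Prop) (L : ℕ → Finset (Fin c)) (k : ℤ) : Prop :=
  ∃ x : ℕ → Option (Fin c), (∀ e ∈ E, Allowed (L e) (x e)) ∧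
    (∀ e ∈ E, ∀ f ∈ E, R e f → Compat (x e) (x f)) ∧ ∑ e ∈ E, wt (x e) ≤ k

/-- The labels `y` of `B` extend the labels `x` of `A`. -/
def Extends (A B : Finset ℕ) (R : ℕ → ℕ → Prop) (L : ℕ → Finset (Fin c))
    (x y : ℕ → Option (Fin c)) (w : ℤ) : Prop :=
  (∀ f ∈ B, Allowed (L f) (y f)) ∧ (∀ f ∈ B, ∀ e ∈ A, R f e → Compat (y f) (x e)) ∧
    (∀ e ∈ B, ∀ f ∈ B, R e f → Compat (y e) (y f)) ∧ ∑ e ∈ B, wt (y e) ≤ w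

/-- Keep the labels on A and exchange those on the block. What A spends is fixed, so the block has
to be handled for each labeling of A with the rest of the budget. -/
lemma YesCol.of_extends {A B B' : Finset ℕ} (hB : Disjoint A B) (hB' : Disjoint A B')
    {R R' : ℕ → ℕ → Prop} {L L' : ℕ → Finset (Fin c)} (hs : ∀ e f, R' e f → R' f e)
    (hR : ∀ e ∈ A, ∀ f ∈ A, R e f ↔ R' e f) (hL : ∀ e ∈ A, L e = L' e) {d k : ℤ}
    (h : ∀ x w, (∃ y, Extends A B R L x y (w + d)) → ∃ y, Extends A B' R' L' x y w)
    (hy : YesCol (A ∪ B) R L (k + d)) : YesCol (A ∪ B') R' L' k := by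
  classical
  obtain ⟨x, h1, h2, h3⟩ := hy
  rw [Finset.sum_union hB] at h3
  obtain ⟨y, y1, y2, y3, y4⟩ := h x (k - ∑ e ∈ A, wt (x e)) ⟨x,
    fun f hf => h1 f (Finset.mem_union_right _ hf),
    fun f hf e he => h2 f (Finset.mem_union_right _ hf) e (Finset.mem_union_left _ he),
    fun f hf e he => h2 f (Finset.mem_union_right _ hf) e (Finset.mem_union_right _ he),
    by linarith⟩
  have nA : ∀ e ∈ A, e ∉ B' := fun e he he' => Finset.disjoint_left.1 hB' he he'
  refine ⟨fun e => if e ∈ B' then y e else x e, ?_, ?_, ?_⟩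
  · intro e he
    rcases Finset.mem_union.1 he with he | he
    · simpa [nA e he, ← hL e he] using h1 e (Finset.mem_union_left _ he)
    · simpa [he] using y1 e he
  · intro e he f hf hr
    rcases Finset.mem_union.1 he with he | he <;> rcases Finset.mem_union.1 hf with hf | hf
    · simpa [nA e he, nA f hf] using h2 e (Finset.mem_union_left _ he) f
        (Finset.mem_union_left _ hf) ((hR e he f hf).2 hr)
    · simpa [nA e he, hf] using (y2 f hf e he (hs _ _ hr)).symm
    · simpa [nA f hf, he] using y2 e he f hf hr
    · simpa [he, hf] using y3 e he f hf hr
  · rw [Finset.sum_union hB']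
    have s1 : ∑ e ∈ A, wt (if e ∈ B' then y e else x e) = ∑ e ∈ A, wt (x e) :=
      Finset.sum_congr rfl fun e he => by simp [nA e he]
    have s2 : ∑ e ∈ B', wt (if e ∈ B' then y e else x e) = ∑ e ∈ B', wt (y e) :=
      Finset.sum_congr rfl fun e he => by simp [he]
    simp only [s1, s2]
    linarith

/-- Replacing a block of edges by an equivalent one. -/
lemma yesCol_block {A B B' : Finset ℕ} (hB : Disjoint A B) (hB' : Disjoint A B')
    {R R' : ℕ → ℕ → Prop} {L L' : ℕ → Finset (Fin c)} (hs : ∀ e f, R e f → R f e)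
    (hs' : ∀ e f, R' e f → R' f e)
    (hR : ∀ e ∈ A, ∀ f ∈ A, R e f ↔ R' e f) (hL : ∀ e ∈ A, L e = L' e) {d k : ℤ}
    (h : ∀ x w, (∃ y, Extends A B R L x y (w + d)) ↔ ∃ y, Extends A B' R' L' x y w) :
    YesCol (A ∪ B) R L (k + d) ↔ YesCol (A ∪ B') R' L' k := by
  constructor
  · exact YesCol.of_extends hB hB' hs' hR hL fun x w => (h x w).1
  · intro hy
    -- The converse is the same exchange with the blocks swapped and the budget shift negated.
    refine YesCol.of_extends (d := -d) hB' hB hs (fun e he f hf => (hR e he f hf).symm)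
      (fun e he => (hL e he).symm) (fun x w hx => ?_) (by simpa using hy)
    have := (h x (w + -d)).2 hx
    simpa using this

/-- The color that a pendant edge with list `l` claims from the list `l'` of its neighbor. -/
def pendantList (l l' : Finset (Fin c)) : Finset (Fin c) := if l.card = 1 then l' \ l else l'

/-- The cost of a pendant edge. -/
def pendantCost (l : Finset (Fin c)) : ℤ := if l = ∅ then 1 else 0

/-- An empty list makes the pendant edge weak in any case. With two or more colors the edge can
always avoid its neighbor. With a single color α, one may assume that the neighbor does not use α.
The condition `C` stands for the constraints on the neighbor from the rest of the graph; a weak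
label satisfies them. -/
lemma pendant_equiv (l l' : Finset (Fin c)) (C : Option (Fin c) → Prop) (hC : C none) (w : ℤ) :
    (∃ p q, Allowed l p ∧ Allowed l' q ∧ Compat p q ∧ C q ∧ wt p + wt q ≤ w + pendantCost l) ↔
      ∃ q, Allowed (pendantList l l') q ∧ C q ∧ wt q ≤ w := by
  unfold pendantCost
  constructor
  · rintro ⟨p, q, hp, hq, hpq, hCq, hw⟩
    by_cases h0 : l = ∅
    · subst h0
      cases p with
      | some a => simp at hp
      | none => exact ⟨q, by simpa [pendantList] using hq, hCq, by simpa [add_comm] using hw⟩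
    · by_cases h1 : l.card = 1
      · obtain ⟨α, rfl⟩ := Finset.card_eq_one.1 h1
        by_cases hqa : q = some α
        · subst hqa
          -- Here the neighbor has color α and the pendant edge must be weak. Making the neighbor
          -- weak instead costs no more.
          refine ⟨none, by simp, hC, ?_⟩
          cases p with
          | none => simpa using hw
          | some a => simp_all
        · refine ⟨q, ?_, hCq, ?_⟩
          · cases q <;> simp_all [pendantList]
          · have := wt_nonneg p
            simp only [h0, if_false] at hw
            linarith
      · refine ⟨q, by simpa [pendantList, h1] using hq, hCq, ?_⟩
        have := wt_nonneg p
        simp only [h0, if_false] at hw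
        linarith
  · rintro ⟨q, hq, hCq, hw⟩
    have hq' : Allowed l' q := by
      intro a ha
      have := hq a ha
      unfold pendantList at this
      split_ifs at this
      · exact (Finset.mem_sdiff.1 this).1
      · exact this
    by_cases h0 : l = ∅
    · exact ⟨none, q, by simp, hq', by simp, hCq, by simp [h0]; linarith⟩
    · obtain ⟨α, hα, hne⟩ : ∃ α ∈ l, q ≠ some α := by
        by_cases h1 : l.card = 1
        · obtain ⟨α, rfl⟩ := Finset.card_eq_one.1 h1
          refine ⟨α, by simp, ?_⟩
          rintro rfl
          simp [pendantList] at hq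
        · cases q with
          | none =>
            obtain ⟨α, hα⟩ := Finset.nonempty_iff_ne_empty.2 h0
            exact ⟨α, hα, by simp⟩
          | some b =>
            have : 1 < l.card := by
              have := Finset.card_pos.2 (Finset.nonempty_iff_ne_empty.2 h0)
              omega
            obtain ⟨α, hα, hne⟩ := Finset.exists_mem_ne this b
            exact ⟨α, hα, by simpa using hne.symm⟩
      refine ⟨some α, q, by simpa using hα, hq', by rwa [compat_some_left], hCq, ?_⟩
      simp [h0]; linarith

/-- Since e conflicts only with f, the block formed by e and f is visible from outside only through
the label of f, and `pendant_equiv` replaces it by f alone. -/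
lemma yesCol_pendant {E : Finset ℕ} {e f : ℕ} (he : e ∈ E) (hf : f ∈ E) (hne : f ≠ e)
    {R R' : ℕ → ℕ → Prop} {L : ℕ → Finset (Fin c)} (hs : ∀ e f, R e f → R f e)
    (hs' : ∀ e f, R' e f → R' f e) (hirr : ∀ e, ¬ R e e)
    (hR : ∀ a ∈ E.erase e, ∀ b ∈ E.erase e, R a b ↔ R' a b)
    (hef : ∀ a ∈ E, R e a ↔ a = f) {k : ℤ} :
    YesCol E R L k ↔ YesCol (E.erase e) R'
      (Function.update L f (pendantList (L e) (L f))) (k - pendantCost (L e)) := by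
  classical
  have e1 : E = (E.erase e).erase f ∪ {e, f} := by
    ext a; simp only [Finset.mem_union, Finset.mem_erase, Finset.mem_insert, Finset.mem_singleton]
    grind
  have e2 : E.erase e = (E.erase e).erase f ∪ {f} := by
    ext a; simp only [Finset.mem_union, Finset.mem_erase, Finset.mem_singleton]
    grind
  set A := (E.erase e).erase f with hA
  have hAE : ∀ a ∈ A, a ∈ E.erase e := fun a ha => Finset.mem_of_mem_erase ha
  have key := yesCol_block (A := A) (B := {e, f}) (B' := {f}) (R := R) (R' := R') (L := L)
    (L' := Function.update L f (pendantList (L e) (L f))) (d := pendantCost (L e))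
    (k := k - pendantCost (L e))
    (by simp [hA]) (by simp [hA])
    hs hs' (fun a ha b hb => hR a (hAE a ha) b (hAE b hb))
    (fun a ha => by rw [Function.update_of_ne (Finset.ne_of_mem_erase ha)]) ?_
  · rw [← e1, ← e2, sub_add_cancel] at key
    exact key
  · intro x w
    have hp := pendant_equiv (L e) (L f) (fun q => ∀ a ∈ A, R f a → Compat q (x a)) (by simp) w
    have hfE : f ∈ E.erase e := Finset.mem_erase.2 ⟨hne, hf⟩
    constructor
    · rintro ⟨y, y1, y2, y3, y4⟩
      obtain ⟨q, q1, q2, q3⟩ := hp.1 ⟨y e, y f, y1 e (by simp), y1 f (by simp),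
        y3 e (by simp) f (by simp) ((hef f hf).2 rfl), fun a ha => y2 f (by simp) a ha, by
          rwa [Finset.sum_pair hne.symm] at y4⟩
      refine ⟨fun _ => q, by simpa using q1, ?_, ?_, by simpa using q3⟩
      · intro g hg a ha hr
        rw [Finset.mem_singleton] at hg; subst hg
        exact q2 a ha ((hR g hfE a (hAE a ha)).2 hr)
      · intro g hg g' hg' hr
        rw [Finset.mem_singleton] at hg hg'; subst hg hg'
        exact absurd ((hR g' hfE g' hfE).2 hr) (hirr _)
    · rintro ⟨y, y1, y2, y3, y4⟩
      obtain ⟨p, q, q1, q2, q3, q4, q5⟩ := hp.2 ⟨y f, by simpa using y1 f (by simp),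
        fun a ha hr => y2 f (by simp) a ha ((hR f hfE a (hAE a ha)).1 hr), by simpa using y4⟩
      refine ⟨fun g => if g = e then p else q, ?_, ?_, ?_, ?_⟩
      · intro g hg
        simp only [Finset.mem_insert, Finset.mem_singleton] at hg
        rcases hg with rfl | rfl
        · simpa using q1
        · simpa [hne] using q2
      · intro g hg a ha hr
        simp only [Finset.mem_insert, Finset.mem_singleton] at hg
        rcases hg with rfl | rfl
        · have := (hef a (Finset.mem_of_mem_erase (hAE a ha))).1 hr
          exact absurd this (Finset.ne_of_mem_erase ha)
        · simpa [hne] using q4 a ha hr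
      · intro g hg a ha hr
        simp only [Finset.mem_insert, Finset.mem_singleton] at hg ha
        rcases hg with rfl | rfl <;> rcases ha with rfl | rfl
        · exact absurd hr (hirr _)
        · simpa [hne] using q3
        · simpa [hne] using q3.symm
        · exact absurd hr (hirr _)
      · rw [Finset.sum_pair hne.symm]
        simpa [hne] using q5

/-- Deleting a set of edges without conflicts to other edges. -/
lemma yesCol_closed {E C : Finset ℕ} (hC : C ⊆ E) {R R' : ℕ → ℕ → Prop}
    {L : ℕ → Finset (Fin c)} (hs : ∀ e f, R e f → R f e) (hs' : ∀ e f, R' e f → R' f e)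
    (hR : ∀ a ∈ E \ C, ∀ b ∈ E \ C, R a b ↔ R' a b)
    (hcl : ∀ e ∈ C, ∀ a ∈ E \ C, ¬ R e a) {k opt : ℤ}
    (hopt : ∀ w, YesCol C R L w ↔ opt ≤ w) :
    YesCol E R L k ↔ YesCol (E \ C) R' L (k - opt) := by
  classical
  have key := yesCol_block (A := E \ C) (B := C) (B' := ∅) (R := R) (R' := R') (L := L)
    (L' := L) (d := opt) (k := k - opt) Finset.sdiff_disjoint (by simp) hs hs' hR
    (fun _ _ => rfl) ?_
  · rw [Finset.sdiff_union_of_subset hC, Finset.union_empty, sub_add_cancel] at key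
    exact key
  · intro x w
    have h0 : (∃ y, Extends (E \ C) ∅ R' L x y w) ↔ 0 ≤ w := by simp [Extends]
    rw [h0]
    constructor
    · rintro ⟨y, y1, y2, y3, y4⟩
      have := (hopt (w + opt)).1 ⟨y, y1, y3, y4⟩
      linarith
    · intro hw
      obtain ⟨y, y1, y2, y3⟩ := (hopt (w + opt)).2 (by linarith)
      exact ⟨y, y1, fun f hf e he hr => absurd hr (hcl f hf e he), y2, y3⟩

end

/-! ## Graphs as edge lists -/

/-- A graph with vertices and edges named by natural numbers, together with color lists and a
budget. -/
structure St (c : ℕ) where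
  E : Finset ℕ
  U : ℕ → ℕ
  W : ℕ → ℕ
  L : ℕ → Finset (Fin c)
  k : ℤ

namespace St
variable {c : ℕ}

/-- The edge `e` joins `u` and `v`. -/
def Joins (σ : St c) (e u v : ℕ) : Prop := (σ.U e = u ∧ σ.W e = v) ∨ (σ.U e = v ∧ σ.W e = u)

/-- The edges at `v`. -/
def at_ (σ : St c) (v : ℕ) : Finset ℕ := σ.E.filter fun e => σ.U e = v ∨ σ.W e = v

/-- The degree of `v`. -/
def deg (σ : St c) (v : ℕ) : ℕ := (σ.at_ v).card

/-- The edge list describes a simple graph with vertices below `n` and edges below `m`. -/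
structure WF (n m : ℕ) (σ : St c) : Prop where
  lt_m : ∀ e ∈ σ.E, e < m
  U_lt : ∀ e ∈ σ.E, σ.U e < n
  W_lt : ∀ e ∈ σ.E, σ.W e < n
  ne : ∀ e ∈ σ.E, σ.U e ≠ σ.W e
  inj : ∀ e ∈ σ.E, ∀ f ∈ σ.E, ∀ u v, σ.Joins e u v → σ.Joins f u v → e = f

/-- Two edges at a common vertex conflict, except that they do not if `tri` holds and they lie in
a triangle. -/
def Conf (tri : Prop) (σ : St c) (e f : ℕ) : Prop :=
  ∃ u v w, u ≠ w ∧ σ.Joins e u v ∧ σ.Joins f v w ∧ (tri → ∀ g ∈ σ.E, ¬ σ.Joins g u w)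

/-- The question, in terms of edges. -/
def Yes (tri : Prop) (σ : St c) : Prop := YesCol σ.E (σ.Conf tri) σ.L σ.k

/-- There is an edge deletion set to maximum degree two of size at most `x`. -/
def Del2 (σ : St c) (x : ℕ) : Prop :=
  ∃ D ⊆ σ.E, D.card ≤ x ∧ ∀ v, (σ.at_ v \ D).card ≤ 2

/-- The number of vertices that are not isolated. -/
def live (n : ℕ) (σ : St c) : ℕ := ((Finset.range n).filter fun v => σ.deg v ≠ 0).card

variable {σ : St c} {e f u v w : ℕ} {n m : ℕ}

lemma joins_symm (h : σ.Joins e u v) : σ.Joins e v u := by unfold Joins at *; tauto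

lemma mem_at : e ∈ σ.at_ v ↔ e ∈ σ.E ∧ (σ.U e = v ∨ σ.W e = v) := by simp [at_]

lemma mem_at_left (he : e ∈ σ.E) (h : σ.Joins e u v) : e ∈ σ.at_ u := by
  rw [mem_at]; unfold Joins at h; tauto

lemma mem_at_right (he : e ∈ σ.E) (h : σ.Joins e u v) : e ∈ σ.at_ v := by
  rw [mem_at]; unfold Joins at h; tauto

lemma exists_joins (he : e ∈ σ.at_ v) : ∃ w, σ.Joins e v w := by
  rw [mem_at] at he
  unfold Joins
  rcases he.2 with h | h
  · exact ⟨_, Or.inl ⟨h, rfl⟩⟩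
  · exact ⟨_, Or.inr ⟨rfl, h⟩⟩

lemma joins_eq {u' v' : ℕ} (h : σ.Joins e u v) (h' : σ.Joins e u' v') :
    (u = u' ∧ v = v') ∨ (u = v' ∧ v = u') := by unfold Joins at *; omega

lemma joins_other {v' : ℕ} (h : σ.Joins e u v) (h' : σ.Joins e u v') : v = v' := by
  unfold Joins at *; omega

lemma WF.joins_ne (h : σ.WF n m) (he : e ∈ σ.E) (hj : σ.Joins e u v) : u ≠ v := by
  have := h.ne e he; unfold Joins at hj; omega

lemma WF.joins_lt (h : σ.WF n m) (he : e ∈ σ.E) (hj : σ.Joins e u v) : u < n ∧ v < n := by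
  have := h.U_lt e he; have := h.W_lt e he; unfold Joins at hj; omega

lemma conf_symm {tri : Prop} (h : σ.Conf tri e f) : σ.Conf tri f e := by
  obtain ⟨u, v, w, h1, h2, h3, h4⟩ := h
  exact ⟨w, v, u, h1.symm, joins_symm h3, joins_symm h2,
    fun ht g hg hj => h4 ht g hg (joins_symm hj)⟩

lemma conf_irrefl {tri : Prop} : ¬ σ.Conf tri e e := by
  rintro ⟨u, v, w, h1, h2, h3, -⟩
  unfold Joins at *; omega

lemma Conf.mem_at {tri : Prop} (h : σ.Conf tri e f) (hf : f ∈ σ.E) (hj : σ.Joins e u v) :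
    f ∈ σ.at_ u ∨ f ∈ σ.at_ v := by
  obtain ⟨a, b, d, h1, h2, h3, -⟩ := h
  have := mem_at_left hf h3
  rcases joins_eq hj h2 with ⟨rfl, rfl⟩ | ⟨rfl, rfl⟩ <;> tauto

/-- Conflicts among edges that are kept do not change if every other edge has an end that is not
met by a kept edge. -/
lemma conf_congr {tri : Prop} {σ σ' : St c} {A : Finset ℕ} (hA : A ⊆ σ.E) (hA' : A ⊆ σ'.E)
    (hJ : ∀ e ∈ A, ∀ u v, σ.Joins e u v ↔ σ'.Joins e u v)
    (h : ∀ g ∈ σ.E, g ∉ A → ∃ u v, σ.Joins g u v ∧ ∀ e ∈ A, ∀ z, ¬ σ.Joins e u z)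
    (h' : ∀ g ∈ σ'.E, g ∉ A → ∃ u v, σ'.Joins g u v ∧ ∀ e ∈ A, ∀ z, ¬ σ'.Joins e u z) :
    ∀ e ∈ A, ∀ f ∈ A, σ.Conf tri e f ↔ σ'.Conf tri e f := by
  have aux : ∀ {σ σ' : St c} (hA : A ⊆ σ.E) (hA' : A ⊆ σ'.E)
      (hJ : ∀ e ∈ A, ∀ u v, σ.Joins e u v ↔ σ'.Joins e u v)
      (h' : ∀ g ∈ σ'.E, g ∉ A → ∃ u v, σ'.Joins g u v ∧ ∀ e ∈ A, ∀ z, ¬ σ'.Joins e u z),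
      ∀ e ∈ A, ∀ f ∈ A, σ.Conf tri e f → σ'.Conf tri e f := by
    intro σ σ' hA hA' hJ h' e he f hf ⟨u, v, w, h1, h2, h3, h4⟩
    refine ⟨u, v, w, h1, (hJ e he _ _).1 h2, (hJ f hf _ _).1 h3, fun ht g hg hj => ?_⟩
    -- A kept edge g closes the triangle in both graphs. Any other g has an end met by no kept edge,
    -- so it cannot close a triangle with e and f.
    by_cases hgA : g ∈ A
    · exact h4 ht g (hA hgA) ((hJ g hgA _ _).2 hj)
    · obtain ⟨a, b, hab, hno⟩ := h' g hg hgA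
      rcases joins_eq hab hj with ⟨rfl, rfl⟩ | ⟨rfl, rfl⟩
      · exact hno e he _ ((hJ e he _ _).1 h2)
      · exact hno f hf _ (joins_symm ((hJ f hf _ _).1 h3))
  exact fun e he f hf => ⟨aux hA hA' hJ h' e he f hf,
    aux hA' hA (fun e he u v => (hJ e he u v).symm) h e he f hf⟩

/-- The conflicts of an edge between two vertices of degree two. -/
lemma conf_inner {tri : Prop} (hσ : σ.WF n m) {a b u z : ℕ} (he : e ∈ σ.E) (ha : a ∈ σ.E)
    (hb : b ∈ σ.E) (je : σ.Joins e v w) (ja : σ.Joins a u v) (jb : σ.Joins b w z)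
    (hv : σ.at_ v = {a, e}) (hw : σ.at_ w = {e, b}) (hae : a ≠ e) (hbe : b ≠ e) (huz : u ≠ z) :
    ∀ f ∈ σ.E, σ.Conf tri e f ↔ f = a ∨ f = b := by
  have huw : u ≠ w := by
    rintro rfl
    exact hae (hσ.inj a ha e he _ _ ja (joins_symm je))
  have hzv : z ≠ v := by
    rintro rfl
    exact hbe (hσ.inj b hb e he _ _ jb (joins_symm je))
  intro f hf
  constructor
  · intro h
    have hfe : f ≠ e := by rintro rfl; exact conf_irrefl h
    rcases h.mem_at hf je with h | h
    · rw [hv] at h; simp only [Finset.mem_insert, Finset.mem_singleton] at h; tauto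
    · rw [hw] at h; simp only [Finset.mem_insert, Finset.mem_singleton] at h; tauto
  · rintro (rfl | rfl)
    -- A third side would be an edge at w, hence e or b. The first is excluded by simplicity and the
    -- second by u ≠ z. So the Multi-STC exemption does not apply, and the conflict is the same for
    -- both problems.
    · refine ⟨w, v, u, huw.symm, joins_symm je, joins_symm ja, fun _ g hg hj => ?_⟩
      have := mem_at_left hg hj
      rw [hw] at this; simp only [Finset.mem_insert, Finset.mem_singleton] at this
      rcases this with rfl | rfl
      · have := joins_other hj (joins_symm je)
        subst this
        exact hσ.joins_ne ha ja rfl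
      · exact huz (joins_other hj jb)
    · refine ⟨v, w, z, hzv.symm, je, jb, fun _ g hg hj => ?_⟩
      have := mem_at_left hg hj
      rw [hv] at this; simp only [Finset.mem_insert, Finset.mem_singleton] at this
      rcases this with rfl | rfl
      · exact huz (joins_other (joins_symm ja) hj)
      · have := joins_other hj je
        subst this
        exact hσ.joins_ne hb jb rfl

/-! ### Elementary changes -/

/-- Delete an edge. -/
def del (σ : St c) (e : ℕ) : St c := { σ with E := σ.E.erase e }

/-- Insert an edge. -/
def add (σ : St c) (e u w : ℕ) : St c :=
  { σ with E := insert e σ.E, U := Function.update σ.U e u, W := Function.update σ.W e w }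

/-- Change a list. -/
def setL (σ : St c) (e : ℕ) (l : Finset (Fin c)) : St c := { σ with L := Function.update σ.L e l }

/-- Lower the budget. -/
def pay (σ : St c) (d : ℤ) : St c := { σ with k := σ.k - d }

@[simp] lemma del_E : (σ.del e).E = σ.E.erase e := rfl
@[simp] lemma del_L : (σ.del e).L = σ.L := rfl
@[simp] lemma del_k : (σ.del e).k = σ.k := rfl
@[simp] lemma add_E : (σ.add e u w).E = insert e σ.E := rfl
@[simp] lemma add_L : (σ.add e u w).L = σ.L := rfl
@[simp] lemma add_k : (σ.add e u w).k = σ.k := rfl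
@[simp] lemma setL_E {l} : (σ.setL e l).E = σ.E := rfl
@[simp] lemma setL_L {l} : (σ.setL e l).L = Function.update σ.L e l := rfl
@[simp] lemma setL_k {l} : (σ.setL e l).k = σ.k := rfl
@[simp] lemma pay_E {d} : (σ.pay d).E = σ.E := rfl
@[simp] lemma pay_L {d} : (σ.pay d).L = σ.L := rfl
@[simp] lemma pay_k {d} : (σ.pay d).k = σ.k - d := rfl
@[simp] lemma setL_at {l} : (σ.setL e l).at_ v = σ.at_ v := rfl
@[simp] lemma pay_at {d} : (σ.pay d).at_ v = σ.at_ v := rfl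
@[simp] lemma del_joins : (σ.del f).Joins e u v ↔ σ.Joins e u v := Iff.rfl
@[simp] lemma setL_joins {l} : (σ.setL f l).Joins e u v ↔ σ.Joins e u v := Iff.rfl
@[simp] lemma pay_joins {d} : (σ.pay d).Joins e u v ↔ σ.Joins e u v := Iff.rfl
@[simp] lemma pay_conf {d} {tri : Prop} : (σ.pay d).Conf tri e f ↔ σ.Conf tri e f := Iff.rfl
@[simp] lemma setL_conf {g l} {tri : Prop} : (σ.setL g l).Conf tri e f ↔ σ.Conf tri e f := Iff.rfl
@[simp] lemma setL_deg {l} : (σ.setL e l).deg v = σ.deg v := rfl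
@[simp] lemma pay_deg {d} : (σ.pay d).deg v = σ.deg v := rfl

lemma add_joins_self {a b : ℕ} : (σ.add e u w).Joins e a b ↔ (u = a ∧ w = b) ∨ (u = b ∧ w = a) := by
  simp [Joins, add]

lemma add_joins_ne {a b : ℕ} (h : f ≠ e) : (σ.add e u w).Joins f a b ↔ σ.Joins f a b := by
  simp [Joins, add, h]

@[simp] lemma del_at : (σ.del e).at_ v = (σ.at_ v).erase e := by
  ext f; simp only [mem_at, del, Finset.mem_erase]; tauto

lemma add_at (he : e ∉ σ.E) :
    (σ.add e u w).at_ v = if v = u ∨ v = w then insert e (σ.at_ v) else σ.at_ v := by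
  ext f
  by_cases hf : f = e
  · subst hf
    split_ifs with h
    · simp [mem_at, add]; tauto
    · simp [mem_at, add, he]; tauto
  · split_ifs with h <;> simp [mem_at, add, hf]

lemma WF.del (h : σ.WF n m) : (σ.del e).WF n m where
  lt_m f hf := h.lt_m f (Finset.mem_of_mem_erase hf)
  U_lt f hf := h.U_lt f (Finset.mem_of_mem_erase hf)
  W_lt f hf := h.W_lt f (Finset.mem_of_mem_erase hf)
  ne f hf := h.ne f (Finset.mem_of_mem_erase hf)
  inj f hf g hg := h.inj f (Finset.mem_of_mem_erase hf) g (Finset.mem_of_mem_erase hg)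

lemma WF.setL (h : σ.WF n m) {l} : (σ.setL e l).WF n m :=
  ⟨h.lt_m, h.U_lt, h.W_lt, h.ne, h.inj⟩

lemma WF.pay (h : σ.WF n m) {d} : (σ.pay d).WF n m :=
  ⟨h.lt_m, h.U_lt, h.W_lt, h.ne, h.inj⟩

lemma WF.add (h : σ.WF n m) (hem : e < m) (hun : u < n) (hwn : w < n) (huw : u ≠ w)
    (hno : ∀ f ∈ σ.E, ¬ σ.Joins f u w) : (σ.add e u w).WF n m := by
  refine ⟨?_, ?_, ?_, ?_, ?_⟩
  · intro f hf; by_cases hfe : f = e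
    · subst hfe; exact hem
    · exact h.lt_m f (by simpa [hfe] using hf)
  · intro f hf; by_cases hfe : f = e
    · subst hfe; simpa [St.add] using hun
    · simpa [St.add, hfe] using h.U_lt f (by simpa [hfe] using hf)
  · intro f hf; by_cases hfe : f = e
    · subst hfe; simpa [St.add] using hwn
    · simpa [St.add, hfe] using h.W_lt f (by simpa [hfe] using hf)
  · intro f hf; by_cases hfe : f = e
    · subst hfe; simpa [St.add] using huw
    · simpa [St.add, hfe] using h.ne f (by simpa [hfe] using hf)
  · intro f hf g hg a b h1 h2
    by_cases hfe : f = e <;> by_cases hge : g = e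
    · rw [hfe, hge]
    · subst hfe
      rw [add_joins_self] at h1
      rw [add_joins_ne hge] at h2
      refine absurd ?_ (hno g (by simpa [hge] using hg))
      rcases h1 with ⟨rfl, rfl⟩ | ⟨rfl, rfl⟩
      · exact h2
      · exact joins_symm h2
    · subst hge
      rw [add_joins_self] at h2
      rw [add_joins_ne hfe] at h1
      refine absurd ?_ (hno f (by simpa [hfe] using hf))
      rcases h2 with ⟨rfl, rfl⟩ | ⟨rfl, rfl⟩
      · exact h1
      · exact joins_symm h1
    · rw [add_joins_ne hfe] at h1
      rw [add_joins_ne hge] at h2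
      exact h.inj f (by simpa [hfe] using hf) g (by simpa [hge] using hg) a b h1 h2

/-! ### Reduction steps -/

/-- `σ'` is a reduced equivalent of `σ`: at every vertex nothing has changed, or the degree was
and is at most two. -/
structure Step (tri : Prop) (n m : ℕ) (σ σ' : St c) : Prop where
  wf : σ'.WF n m
  yes : σ'.Yes tri ↔ σ.Yes tri
  loc : ∀ v, σ'.at_ v = σ.at_ v ∨ (σ.deg v ≤ 2 ∧ σ'.deg v ≤ 2)
  live_lt : σ'.live n < σ.live n

/-- The deletion set is intersected with the new edge set. This is harmless where incidences did not
change, and elsewhere the degree is at most two anyway. -/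
lemma Step.del2 {tri : Prop} {σ' : St c} (h : Step tri n m σ σ') {x : ℕ} (hx : σ.Del2 x) :
    σ'.Del2 x := by
  obtain ⟨D, hD, hc, hd⟩ := hx
  refine ⟨D ∩ σ'.E, Finset.inter_subset_right,
    (Finset.card_le_card Finset.inter_subset_left).trans hc, fun v => ?_⟩
  rcases h.loc v with h1 | h1
  · refine le_trans (Finset.card_le_card ?_) (hd v)
    intro e he
    rw [Finset.mem_sdiff] at he ⊢
    refine ⟨h1 ▸ he.1, fun hD => he.2 (Finset.mem_inter.2 ⟨hD, (mem_at.1 he.1).1⟩)⟩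
  · exact (Finset.card_le_card Finset.sdiff_subset).trans h1.2

/-- A vertex of degree at least three is never changed, so it would survive. This is used to see
that an edgeless result comes from a graph with ξ₂ = 0. -/
lemma Step.deg_le_two {tri : Prop} {σ' : St c} (h : Step tri n m σ σ')
    (h' : ∀ v, σ'.deg v ≤ 2) (v : ℕ) : σ.deg v ≤ 2 := by
  rcases h.loc v with h1 | h1
  · have := h' v; unfold deg at *; rwa [← h1]
  · exact h1.1

/-- Progress measure: one vertex becomes isolated, and no isolated vertex comes back to life. -/
lemma live_lt_of {σ' : St c} (z : ℕ) (hz : z < n) (h1 : σ.deg z ≠ 0) (h2 : σ'.deg z = 0)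
    (h : ∀ v, σ.deg v = 0 → σ'.deg v = 0) : σ'.live n < σ.live n := by
  apply Finset.card_lt_card
  rw [Finset.ssubset_iff_of_subset]
  · exact ⟨z, by simp [hz, h1], by simp [h2]⟩
  · intro v
    simp only [Finset.mem_filter, Finset.mem_range]
    exact fun hv => ⟨hv.1, fun h' => hv.2 (h v h')⟩

end St

/-! ### Extending labelings over chains -/

section
variable {c : ℕ}

lemma exists_assignment (e₁ e₂ e₃ e₄ e₅ : ℕ) (hd : [e₁, e₂, e₃, e₄, e₅].Nodup)
    (p q r s t : Option (Fin c)) :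
    ∃ y : ℕ → Option (Fin c), y e₁ = p ∧ y e₂ = q ∧ y e₃ = r ∧ y e₄ = s ∧ y e₅ = t := by
  refine ⟨fun e => if e = e₁ then p else if e = e₂ then q else if e = e₃ then r else
    if e = e₄ then s else t, ?_⟩
  simp only [List.nodup_cons, List.mem_cons, List.not_mem_nil, or_false, not_or] at hd
  obtain ⟨⟨h1, h2, h3, h4⟩, ⟨h5, h6, h7⟩, ⟨h8, h9⟩, h10, -⟩ := hd
  simp [Ne.symm h1, Ne.symm h2, Ne.symm h3, Ne.symm h4, Ne.symm h5, Ne.symm h6, Ne.symm h7,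
    Ne.symm h8, Ne.symm h9, Ne.symm h10]

/-- If the conflict relation on the block is that of a path, with outer neighbors a and b, extending
a labeling is exactly the path problem with the labels of a and b imposed outside. This version
describes the chain before the replacement; the versions with three and two edges describe it
afterwards. -/
lemma extends_chain_four {A : Finset ℕ} {R : ℕ → ℕ → Prop} {L : ℕ → Finset (Fin c)}
    {a e₂ e₃ e₄ e₅ b : ℕ} (hd : [e₂, e₃, e₄, e₅].Nodup) (ha : a ∈ A) (hb : b ∈ A)
    (hA : ∀ e ∈ A, e ∉ [e₂, e₃, e₄, e₅])
    (h₂ : ∀ f ∈ A ∪ {e₂, e₃, e₄, e₅}, R e₂ f ↔ f = a ∨ f = e₃)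
    (h₃ : ∀ f ∈ A ∪ {e₂, e₃, e₄, e₅}, R e₃ f ↔ f = e₂ ∨ f = e₄)
    (h₄ : ∀ f ∈ A ∪ {e₂, e₃, e₄, e₅}, R e₄ f ↔ f = e₃ ∨ f = e₅)
    (h₅ : ∀ f ∈ A ∪ {e₂, e₃, e₄, e₅}, R e₅ f ↔ f = e₄ ∨ f = b)
    (x : ℕ → Option (Fin c)) (w : ℤ) :
    (∃ y, Extends A {e₂, e₃, e₄, e₅} R L x y w) ↔
      Feas [L e₂, L e₃, L e₄, L e₅] (x a) (x b) w := by
  have hd' := hd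
  simp only [List.nodup_cons, List.mem_cons, List.not_mem_nil, or_false, not_or] at hd
  obtain ⟨⟨n1, n2, n3⟩, ⟨n4, n5⟩, n6, -⟩ := hd
  simp only [List.mem_cons, List.not_mem_nil, or_false, not_or] at hA
  have hsum : ∀ y : ℕ → Option (Fin c), ∑ e ∈ {e₂, e₃, e₄, e₅}, wt (y e) =
      wt (y e₂) + (wt (y e₃) + (wt (y e₄) + wt (y e₅))) := by
    intro y
    rw [Finset.sum_insert (by simp [n1, n2, n3]), Finset.sum_insert (by simp [n4, n5]),
      Finset.sum_pair n6]
  constructor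
  · rintro ⟨y, y1, y2, y3, y4⟩
    rw [hsum] at y4
    exact ⟨y e₂, y1 _ (by simp), (y2 e₂ (by simp) a ha ((h₂ a (by simp [ha])).2 (Or.inl rfl))).symm,
      y e₃, y1 _ (by simp), y3 _ (by simp) _ (by simp) ((h₂ e₃ (by simp)).2 (Or.inr rfl)),
      y e₄, y1 _ (by simp), y3 _ (by simp) _ (by simp) ((h₃ e₄ (by simp)).2 (Or.inr rfl)),
      y e₅, y1 _ (by simp), y3 _ (by simp) _ (by simp) ((h₄ e₅ (by simp)).2 (Or.inr rfl)),
      y2 e₅ (by simp) b hb ((h₅ b (by simp [hb])).2 (Or.inr rfl)), by linarith⟩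
  · rintro ⟨p, p1, p2, q, q1, q2, r, r1, r2, s, s1, s2, s3, hw⟩
    -- The edge b only serves as a fifth distinct index for `exists_assignment`; the value at it is
    -- discarded.
    have hnb : [e₂, e₃, e₄, e₅, b].Nodup := by
      have := hA b hb; simp [n1, n2, n3, n4, n5, n6]; omega
    obtain ⟨y, rfl, rfl, rfl, rfl, -⟩ := exists_assignment _ _ _ _ _ hnb p q r s none
    refine ⟨y, ?_, ?_, ?_, ?_⟩
    · intro f hf
      simp only [Finset.mem_insert, Finset.mem_singleton] at hf
      rcases hf with rfl | rfl | rfl | rfl <;> assumption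
    · intro f hf e he hr
      have heA : e ∈ A ∪ {e₂, e₃, e₄, e₅} := by simp [he]
      have := hA e he
      simp only [Finset.mem_insert, Finset.mem_singleton] at hf
      rcases hf with rfl | rfl | rfl | rfl
      · rcases (h₂ e heA).1 hr with rfl | rfl
        · exact p2.symm
        · tauto
      · have := (h₃ e heA).1 hr; tauto
      · have := (h₄ e heA).1 hr; tauto
      · rcases (h₅ e heA).1 hr with rfl | rfl
        · tauto
        · exact s3
    · intro f hf e he hr
      have heA : e ∈ A ∪ {e₂, e₃, e₄, e₅} := Finset.mem_union_right _ he
      have na : ¬ a ∈ ({e₂, e₃, e₄, e₅} : Finset ℕ) := by have := hA a ha; simpa using this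
      have nb : ¬ b ∈ ({e₂, e₃, e₄, e₅} : Finset ℕ) := by have := hA b hb; simpa using this
      have hf' := hf
      simp only [Finset.mem_insert, Finset.mem_singleton] at hf'
      rcases hf' with rfl | rfl | rfl | rfl
      · rcases (h₂ e heA).1 hr with rfl | rfl
        · exact absurd he na
        · exact q2
      · rcases (h₃ e heA).1 hr with rfl | rfl
        · exact q2.symm
        · exact r2
      · rcases (h₄ e heA).1 hr with rfl | rfl
        · exact r2.symm
        · exact s2
      · rcases (h₅ e heA).1 hr with rfl | rfl
        · exact s2.symm
        · exact absurd he nb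
    · rw [hsum]; linarith

lemma extends_chain_three {A : Finset ℕ} {R : ℕ → ℕ → Prop} {L : ℕ → Finset (Fin c)}
    {a e₂ e₃ e₄ b : ℕ} (hd : [e₂, e₃, e₄].Nodup) (ha : a ∈ A) (hb : b ∈ A)
    (hA : ∀ e ∈ A, e ∉ [e₂, e₃, e₄])
    (h₂ : ∀ f ∈ A ∪ {e₂, e₃, e₄}, R e₂ f ↔ f = a ∨ f = e₃)
    (h₃ : ∀ f ∈ A ∪ {e₂, e₃, e₄}, R e₃ f ↔ f = e₂ ∨ f = e₄)
    (h₄ : ∀ f ∈ A ∪ {e₂, e₃, e₄}, R e₄ f ↔ f = e₃ ∨ f = b)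
    (x : ℕ → Option (Fin c)) (w : ℤ) :
    (∃ y, Extends A {e₂, e₃, e₄} R L x y w) ↔ Feas [L e₂, L e₃, L e₄] (x a) (x b) w := by
  have hd' := hd
  simp only [List.nodup_cons, List.mem_cons, List.not_mem_nil, or_false, not_or] at hd
  obtain ⟨⟨n1, n2⟩, n4, -⟩ := hd
  simp only [List.mem_cons, List.not_mem_nil, or_false, not_or] at hA
  have hsum : ∀ y : ℕ → Option (Fin c), ∑ e ∈ {e₂, e₃, e₄}, wt (y e) =
      wt (y e₂) + (wt (y e₃) + wt (y e₄)) := by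
    intro y
    rw [Finset.sum_insert (by simp [n1, n2]), Finset.sum_pair n4]
  constructor
  · rintro ⟨y, y1, y2, y3, y4⟩
    rw [hsum] at y4
    exact ⟨y e₂, y1 _ (by simp), (y2 e₂ (by simp) a ha ((h₂ a (by simp [ha])).2 (Or.inl rfl))).symm,
      y e₃, y1 _ (by simp), y3 _ (by simp) _ (by simp) ((h₂ e₃ (by simp)).2 (Or.inr rfl)),
      y e₄, y1 _ (by simp), y3 _ (by simp) _ (by simp) ((h₃ e₄ (by simp)).2 (Or.inr rfl)),
      y2 e₄ (by simp) b hb ((h₄ b (by simp [hb])).2 (Or.inr rfl)), by linarith⟩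
  · rintro ⟨p, p1, p2, q, q1, q2, r, r1, r2, s3, hw⟩
    have na := hA a ha
    have nb := hA b hb
    refine ⟨fun e => if e = e₂ then p else if e = e₃ then q else r, ?_, ?_, ?_, ?_⟩
    · intro f hf
      simp only [Finset.mem_insert, Finset.mem_singleton] at hf
      rcases hf with rfl | rfl | rfl <;> simp [Ne.symm n1, Ne.symm n2, Ne.symm n4, *]
    · intro f hf e he hr
      have heA : e ∈ A ∪ {e₂, e₃, e₄} := by simp [he]
      have := hA e he
      simp only [Finset.mem_insert, Finset.mem_singleton] at hf
      rcases hf with rfl | rfl | rfl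
      · rcases (h₂ e heA).1 hr with rfl | rfl
        · simpa using p2.symm
        · tauto
      · have := (h₃ e heA).1 hr; tauto
      · rcases (h₄ e heA).1 hr with rfl | rfl
        · tauto
        · simpa [Ne.symm n2, Ne.symm n4] using s3
    · intro f hf e he hr
      have heA : e ∈ A ∪ {e₂, e₃, e₄} := Finset.mem_union_right _ he
      have na : ¬ a ∈ ({e₂, e₃, e₄} : Finset ℕ) := by simpa using na
      have nb : ¬ b ∈ ({e₂, e₃, e₄} : Finset ℕ) := by simpa using nb
      have hf' := hf
      simp only [Finset.mem_insert, Finset.mem_singleton] at hf'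
      rcases hf' with rfl | rfl | rfl
      · rcases (h₂ e heA).1 hr with rfl | rfl
        · exact absurd he na
        · simpa [Ne.symm n1] using q2
      · rcases (h₃ e heA).1 hr with rfl | rfl
        · simpa [Ne.symm n1] using q2.symm
        · simpa [Ne.symm n1, Ne.symm n2, Ne.symm n4] using r2
      · rcases (h₄ e heA).1 hr with rfl | rfl
        · simpa [Ne.symm n1, Ne.symm n2, Ne.symm n4] using r2.symm
        · exact absurd he nb
    · rw [hsum]; simp [Ne.symm n1, Ne.symm n2, Ne.symm n4]; linarith

lemma extends_chain_two {A : Finset ℕ} {R : ℕ → ℕ → Prop} {L : ℕ → Finset (Fin c)}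
    {a e₂ e₃ b : ℕ} (hd : e₂ ≠ e₃) (ha : a ∈ A) (hb : b ∈ A)
    (hA : ∀ e ∈ A, e ≠ e₂ ∧ e ≠ e₃) (hirr : ∀ e, ¬ R e e)
    (h₂ : ∀ f ∈ A ∪ {e₂, e₃}, R e₂ f ↔ f = a ∨ f = e₃)
    (h₃ : ∀ f ∈ A ∪ {e₂, e₃}, R e₃ f ↔ f = e₂ ∨ f = b)
    (x : ℕ → Option (Fin c)) (w : ℤ) :
    (∃ y, Extends A {e₂, e₃} R L x y w) ↔ Feas [L e₂, L e₃] (x a) (x b) w := by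
  have hsum : ∀ y : ℕ → Option (Fin c), ∑ e ∈ {e₂, e₃}, wt (y e) =
      wt (y e₂) + wt (y e₃) := fun y => Finset.sum_pair hd
  constructor
  · rintro ⟨y, y1, y2, y3, y4⟩
    rw [hsum] at y4
    exact ⟨y e₂, y1 _ (by simp), (y2 e₂ (by simp) a ha ((h₂ a (by simp [ha])).2 (Or.inl rfl))).symm,
      y e₃, y1 _ (by simp), y3 _ (by simp) _ (by simp) ((h₂ e₃ (by simp)).2 (Or.inr rfl)),
      y2 e₃ (by simp) b hb ((h₃ b (by simp [hb])).2 (Or.inr rfl)), by linarith⟩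
  · rintro ⟨p, p1, p2, q, q1, q2, s3, hw⟩
    refine ⟨fun e => if e = e₂ then p else q, ?_, ?_, ?_, ?_⟩
    · intro f hf
      simp only [Finset.mem_insert, Finset.mem_singleton] at hf
      rcases hf with rfl | rfl <;> simp [hd.symm, *]
    · intro f hf e he hr
      have heA : e ∈ A ∪ {e₂, e₃} := by simp [he]
      have := hA e he
      simp only [Finset.mem_insert, Finset.mem_singleton] at hf
      rcases hf with rfl | rfl
      · rcases (h₂ e heA).1 hr with rfl | rfl
        · simpa using p2.symm
        · tauto
      · rcases (h₃ e heA).1 hr with rfl | rfl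
        · tauto
        · simpa [hd.symm] using s3
    · intro f hf e he hr
      simp only [Finset.mem_insert, Finset.mem_singleton] at hf he
      rcases hf with rfl | rfl <;> rcases he with rfl | rfl
      · exact absurd hr (hirr _)
      · simpa [hd.symm] using q2
      · simpa [hd.symm] using q2.symm
      · exact absurd hr (hirr _)
    · rw [hsum]; simp [hd.symm]; linarith

/-! ### Cycles -/

/-- The edges of a cycle with lists `l :: ls` have a labeling with at most `w` weak edges. -/
def CycleFeas (l : Finset (Fin c)) (ls : List (Finset (Fin c))) (w : ℤ) : Prop :=
  ∃ y, Allowed l y ∧ Feas ls y y (w - wt y)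

lemma Feas.mono {ls : List (Finset (Fin c))} {i j : Option (Fin c)} {w w' : ℤ} (hw : w ≤ w')
    (h : Feas ls i j w) : Feas ls i j w' := by
  induction ls generalizing i w w' with
  | nil => exact ⟨h.1, h.2.trans hw⟩
  | cons l ls ih =>
    obtain ⟨y, h1, h2, h3⟩ := h
    exact ⟨y, h1, h2, ih (by linarith) h3⟩

lemma Feas.nonneg {ls : List (Finset (Fin c))} {i j : Option (Fin c)} {w : ℤ}
    (h : Feas ls i j w) : 0 ≤ w := by
  induction ls generalizing i w with
  | nil => exact h.2
  | cons l ls ih =>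
    obtain ⟨y, h1, h2, h3⟩ := h
    have := ih h3
    have := wt_nonneg y
    linarith

lemma feas_none (ls : List (Finset (Fin c))) (j : Option (Fin c)) :
    Feas ls none j ls.length := by
  induction ls with
  | nil => simp [Feas]
  | cons l ls ih => exact ⟨none, by simp, by simp, by simpa using ih⟩

/-- The cycle is cut at its first edge, whose label then acts as the outer label on both sides of
the remaining path. All edges weak is always possible, so a minimum exists. -/
lemma exists_cycle_cost (l : Finset (Fin c)) (ls : List (Finset (Fin c))) :
    ∃ opt, ∀ w, CycleFeas l ls w ↔ opt ≤ w := by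
  refine exists_threshold _ ?_ ⟨ls.length + 1, none, by simp, by simpa using feas_none ls none⟩ 0 ?_
  · rintro w w' hw ⟨y, h1, h2⟩
    exact ⟨y, h1, h2.mono (by linarith)⟩
  · rintro w ⟨y, h1, h2⟩
    have := h2.nonneg
    have := wt_nonneg y
    linarith

/-- The minimum number of weak edges on a cycle. -/
noncomputable def cycleCost (l : Finset (Fin c)) (ls : List (Finset (Fin c))) : ℤ :=
  (exists_cycle_cost l ls).choose

lemma cycleCost_spec (l : Finset (Fin c)) (ls : List (Finset (Fin c))) (w : ℤ) :
    CycleFeas l ls w ↔ cycleCost l ls ≤ w := (exists_cycle_cost l ls).choose_spec w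

lemma yesCol_cycle_four {R : ℕ → ℕ → Prop} {L : ℕ → Finset (Fin c)} {a b d e : ℕ}
    (hd : [a, b, d, e].Nodup)
    (ha : ∀ f ∈ ({a, b, d, e} : Finset ℕ), R a f ↔ f = e ∨ f = b)
    (hb : ∀ f ∈ ({a, b, d, e} : Finset ℕ), R b f ↔ f = a ∨ f = d)
    (hdd : ∀ f ∈ ({a, b, d, e} : Finset ℕ), R d f ↔ f = b ∨ f = e)
    (he : ∀ f ∈ ({a, b, d, e} : Finset ℕ), R e f ↔ f = d ∨ f = a) (w : ℤ) :
    YesCol {a, b, d, e} R L w ↔ cycleCost (L a) [L b, L d, L e] ≤ w := by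
  rw [← cycleCost_spec]
  simp only [List.nodup_cons, List.mem_cons, List.not_mem_nil, or_false, not_or] at hd
  obtain ⟨⟨n1, n2, n3⟩, ⟨n4, n5⟩, n6, -⟩ := hd
  have hsum : ∀ y : ℕ → Option (Fin c), ∑ e ∈ {a, b, d, e}, wt (y e) =
      wt (y a) + (wt (y b) + (wt (y d) + wt (y e))) := by
    intro y
    rw [Finset.sum_insert (by simp [n1, n2, n3]), Finset.sum_insert (by simp [n4, n5]),
      Finset.sum_pair n6]
  constructor
  · rintro ⟨y, y1, y3, y4⟩
    rw [hsum] at y4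
    exact ⟨y a, y1 _ (by simp), y b, y1 _ (by simp),
      y3 _ (by simp) _ (by simp) ((ha b (by simp)).2 (Or.inr rfl)), y d, y1 _ (by simp),
      y3 _ (by simp) _ (by simp) ((hb d (by simp)).2 (Or.inr rfl)), y e, y1 _ (by simp),
      y3 _ (by simp) _ (by simp) ((hdd e (by simp)).2 (Or.inr rfl)),
      y3 _ (by simp) _ (by simp) ((he a (by simp)).2 (Or.inr rfl)), by linarith⟩
  · rintro ⟨p, p1, q, q1, q2, r, r1, r2, s, s1, s2, s3, hw⟩
    -- The last entry is any number different from the four edges, added only so that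
    -- `exists_assignment` applies.
    have hnb : [a, b, d, e, a + b + d + e + 1].Nodup := by
      simp [n1, n2, n3, n4, n5, n6]; omega
    obtain ⟨y, rfl, rfl, rfl, rfl, -⟩ := exists_assignment _ _ _ _ _ hnb p q r s none
    refine ⟨y, ?_, ?_, ?_⟩
    · intro f hf
      simp only [Finset.mem_insert, Finset.mem_singleton] at hf
      rcases hf with rfl | rfl | rfl | rfl <;> assumption
    · intro f hf g hg hr
      simp only [Finset.mem_insert, Finset.mem_singleton] at hf
      rcases hf with rfl | rfl | rfl | rfl
      · rcases (ha g hg).1 hr with rfl | rfl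
        · exact s3.symm
        · exact q2
      · rcases (hb g hg).1 hr with rfl | rfl
        · exact q2.symm
        · exact r2
      · rcases (hdd g hg).1 hr with rfl | rfl
        · exact r2.symm
        · exact s2
      · rcases (he g hg).1 hr with rfl | rfl
        · exact s2.symm
        · exact s3
    · rw [hsum]; linarith

lemma yesCol_cycle_five {R : ℕ → ℕ → Prop} {L : ℕ → Finset (Fin c)} {a b d e g : ℕ}
    (hd : [a, b, d, e, g].Nodup)
    (ha : ∀ f ∈ ({a, b, d, e, g} : Finset ℕ), R a f ↔ f = g ∨ f = b)
    (hb : ∀ f ∈ ({a, b, d, e, g} : Finset ℕ), R b f ↔ f = a ∨ f = d)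
    (hdd : ∀ f ∈ ({a, b, d, e, g} : Finset ℕ), R d f ↔ f = b ∨ f = e)
    (he : ∀ f ∈ ({a, b, d, e, g} : Finset ℕ), R e f ↔ f = d ∨ f = g)
    (hg : ∀ f ∈ ({a, b, d, e, g} : Finset ℕ), R g f ↔ f = e ∨ f = a) (w : ℤ) :
    YesCol {a, b, d, e, g} R L w ↔ cycleCost (L a) [L b, L d, L e, L g] ≤ w := by
  rw [← cycleCost_spec]
  have hd' := hd
  simp only [List.nodup_cons, List.mem_cons, List.not_mem_nil, or_false, not_or] at hd
  obtain ⟨⟨n1, n2, n3, m1⟩, ⟨n4, n5, m2⟩, ⟨n6, m3⟩, m4, -⟩ := hd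
  have hsum : ∀ y : ℕ → Option (Fin c), ∑ e ∈ {a, b, d, e, g}, wt (y e) =
      wt (y a) + (wt (y b) + (wt (y d) + (wt (y e) + wt (y g)))) := by
    intro y
    rw [Finset.sum_insert (by simp [n1, n2, n3, m1]), Finset.sum_insert (by simp [n4, n5, m2]),
      Finset.sum_insert (by simp [n6, m3]), Finset.sum_pair m4]
  constructor
  · rintro ⟨y, y1, y3, y4⟩
    rw [hsum] at y4
    exact ⟨y a, y1 _ (by simp), y b, y1 _ (by simp),
      y3 _ (by simp) _ (by simp) ((ha b (by simp)).2 (Or.inr rfl)), y d, y1 _ (by simp),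
      y3 _ (by simp) _ (by simp) ((hb d (by simp)).2 (Or.inr rfl)), y e, y1 _ (by simp),
      y3 _ (by simp) _ (by simp) ((hdd e (by simp)).2 (Or.inr rfl)), y g, y1 _ (by simp),
      y3 _ (by simp) _ (by simp) ((he g (by simp)).2 (Or.inr rfl)),
      y3 _ (by simp) _ (by simp) ((hg a (by simp)).2 (Or.inr rfl)), by linarith⟩
  · rintro ⟨p, p1, q, q1, q2, r, r1, r2, s, s1, s2, t, t1, t2, s3, hw⟩
    obtain ⟨y, rfl, rfl, rfl, rfl, rfl⟩ := exists_assignment _ _ _ _ _ hd' p q r s t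
    refine ⟨y, ?_, ?_, ?_⟩
    · intro f hf
      simp only [Finset.mem_insert, Finset.mem_singleton] at hf
      rcases hf with rfl | rfl | rfl | rfl | rfl <;> assumption
    · intro f hf g' hg' hr
      simp only [Finset.mem_insert, Finset.mem_singleton] at hf
      rcases hf with rfl | rfl | rfl | rfl | rfl
      · rcases (ha g' hg').1 hr with rfl | rfl
        · exact s3.symm
        · exact q2
      · rcases (hb g' hg').1 hr with rfl | rfl
        · exact q2.symm
        · exact r2
      · rcases (hdd g' hg').1 hr with rfl | rfl
        · exact r2.symm
        · exact s2
      · rcases (he g' hg').1 hr with rfl | rfl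
        · exact s2.symm
        · exact t2
      · rcases (hg g' hg').1 hr with rfl | rfl
        · exact t2.symm
        · exact s3
    · rw [hsum]; linarith

/-- The edges of a triangle have a labeling with at most `w` weak edges. -/
def TriFeas (tri : Prop) (l₁ l₂ l₃ : Finset (Fin c)) (w : ℤ) : Prop :=
  ∃ x y z, Allowed l₁ x ∧ Allowed l₂ y ∧ Allowed l₃ z ∧
    (¬ tri → Compat x y ∧ Compat x z ∧ Compat y z) ∧ wt x + wt y + wt z ≤ w

lemma exists_triangle_cost (tri : Prop) (l₁ l₂ l₃ : Finset (Fin c)) :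
    ∃ opt, ∀ w, TriFeas tri l₁ l₂ l₃ w ↔ opt ≤ w := by
  refine exists_threshold _ ?_ ⟨3, none, none, none, by simp, by simp, by simp, by simp, by simp⟩
    0 ?_
  · rintro w w' hw ⟨x, y, z, h1, h2, h3, h4, h5⟩
    exact ⟨x, y, z, h1, h2, h3, h4, h5.trans hw⟩
  · rintro w ⟨x, y, z, -, -, -, -, h5⟩
    have := wt_nonneg x; have := wt_nonneg y; have := wt_nonneg z
    linarith

/-- The minimum number of weak edges of a triangle. -/
noncomputable def triangleCost (tri : Prop) (l₁ l₂ l₃ : Finset (Fin c)) : ℤ :=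
  (exists_triangle_cost tri l₁ l₂ l₃).choose

/-- For Multi-STC the sides of a triangle do not conflict at all, whereas for ECS they conflict
pairwise. This is the only kind of component whose cost depends on `tri`. -/
lemma yesCol_triangle {tri : Prop} {R : ℕ → ℕ → Prop} {L : ℕ → Finset (Fin c)} {a b d : ℕ}
    (hab : a ≠ b) (had : a ≠ d) (hbd : b ≠ d)
    (hR : ∀ f ∈ ({a, b, d} : Finset ℕ), ∀ g ∈ ({a, b, d} : Finset ℕ), R f g ↔ f ≠ g ∧ ¬ tri)
    (w : ℤ) : YesCol {a, b, d} R L w ↔ triangleCost tri (L a) (L b) (L d) ≤ w := by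
  have hsum : ∀ y : ℕ → Option (Fin c), ∑ e ∈ {a, b, d}, wt (y e) =
      wt (y a) + wt (y b) + wt (y d) := by
    intro y
    rw [Finset.sum_insert (by simp [hab, had]), Finset.sum_pair hbd]; ring
  rw [triangleCost, ← (exists_triangle_cost tri (L a) (L b) (L d)).choose_spec w]
  constructor
  · rintro ⟨y, y1, y3, y4⟩
    rw [hsum] at y4
    exact ⟨y a, y b, y d, y1 _ (by simp), y1 _ (by simp), y1 _ (by simp), fun ht =>
      ⟨y3 _ (by simp) _ (by simp) ((hR a (by simp) b (by simp)).2 ⟨hab, ht⟩),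
      y3 _ (by simp) _ (by simp) ((hR a (by simp) d (by simp)).2 ⟨had, ht⟩),
      y3 _ (by simp) _ (by simp) ((hR b (by simp) d (by simp)).2 ⟨hbd, ht⟩)⟩, y4⟩
  · rintro ⟨p, q, r, p1, q1, r1, ht, hw⟩
    refine ⟨fun e => if e = a then p else if e = b then q else r, ?_, ?_, ?_⟩
    · intro f hf
      simp only [Finset.mem_insert, Finset.mem_singleton] at hf
      rcases hf with rfl | rfl | rfl <;> simp [hab.symm, had.symm, hbd.symm, *]
    · intro f hf g hg hr
      obtain ⟨hne, ht'⟩ := (hR f hf g hg).1 hr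
      obtain ⟨c1, c2, c3⟩ := ht ht'
      simp only [Finset.mem_insert, Finset.mem_singleton] at hf hg
      rcases hf with rfl | rfl | rfl <;> rcases hg with rfl | rfl | rfl <;>
        simp [hab.symm, had.symm, hbd.symm, c1, c2, c3, c1.symm, c2.symm, c3.symm] at hne ⊢
    · rw [hsum]; simpa [hab.symm, had.symm, hbd.symm] using hw

end

/-! ### Removing small components and pendant edges -/

namespace St
variable {c : ℕ} {σ : St c} {e f u v w : ℕ} {n m : ℕ} {tri : Prop}

lemma ext_of {σ σ' : St c} (hE : σ.E = σ'.E) (hU : σ.U = σ'.U) (hW : σ.W = σ'.W)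
    (hL : σ.L = σ'.L) (hk : σ.k = σ'.k) : σ = σ' := by
  cases σ; cases σ'; simp_all

/-- Delete a set of edges at the cost `d`. -/
def remove (σ : St c) (C : Finset ℕ) (d : ℤ) : St c := { σ with E := σ.E \ C, k := σ.k - d }

lemma remove_at {C : Finset ℕ} {d : ℤ} : (σ.remove C d).at_ v = σ.at_ v \ C := by
  ext f; simp only [mem_at, remove, Finset.mem_sdiff]; tauto

lemma WF.remove (h : σ.WF n m) {C : Finset ℕ} {d : ℤ} : (σ.remove C d).WF n m where
  lt_m f hf := h.lt_m f (Finset.mem_sdiff.1 hf).1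
  U_lt f hf := h.U_lt f (Finset.mem_sdiff.1 hf).1
  W_lt f hf := h.W_lt f (Finset.mem_sdiff.1 hf).1
  ne f hf := h.ne f (Finset.mem_sdiff.1 hf).1
  inj f hf g hg := h.inj f (Finset.mem_sdiff.1 hf).1 g (Finset.mem_sdiff.1 hg).1

/-- Deleting a set of edges that is closed under adjacency. -/
lemma step_remove (h : σ.WF n m) {C : Finset ℕ} (hC : C ⊆ σ.E)
    (hcl : ∀ e ∈ C, ∀ u v, σ.Joins e u v → σ.at_ u ⊆ C ∧ σ.deg u ≤ 2) (hv : v < n)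
    (hev : e ∈ σ.at_ v) (heC : e ∈ C) {opt : ℤ}
    (hopt : ∀ w, YesCol C (σ.Conf tri) σ.L w ↔ opt ≤ w) :
    Step tri n m σ (σ.remove C opt) where
  wf := h.remove
  yes := by
    refine (yesCol_closed hC (fun _ _ => conf_symm) (fun _ _ => conf_symm) ?_ ?_ hopt).symm
    · refine conf_congr Finset.sdiff_subset (Finset.Subset.refl _) (fun _ _ _ _ => Iff.rfl) ?_
        (fun g hg hg' => absurd hg hg')
      intro g hg hgA
      have hgC : g ∈ C := by by_contra h; exact hgA (Finset.mem_sdiff.2 ⟨hg, h⟩)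
      -- Every edge at an end of a deleted edge is itself deleted, so deleted edges close no
      -- triangle over kept ones.
      refine ⟨_, _, Or.inl ⟨rfl, rfl⟩, fun e he z hj => ?_⟩
      rw [Finset.mem_sdiff] at he
      exact he.2 ((hcl g hgC _ _ (Or.inl ⟨rfl, rfl⟩)).1 (mem_at_left he.1 hj))
    · intro e he a ha hc
      rw [Finset.mem_sdiff] at ha
      rcases hc.mem_at ha.1 (Or.inl ⟨rfl, rfl⟩) with h1 | h1
      · exact ha.2 ((hcl e he _ _ (Or.inl ⟨rfl, rfl⟩)).1 h1)
      · exact ha.2 ((hcl e he _ _ (Or.inr ⟨rfl, rfl⟩)).1 h1)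
  loc v := by
    by_cases hd : Disjoint (σ.at_ v) C
    · left; rw [remove_at, Finset.sdiff_eq_self_of_disjoint hd]
    · right
      obtain ⟨g, hg, hgC⟩ := Finset.not_disjoint_iff.1 hd
      obtain ⟨z, hz⟩ := exists_joins hg
      have h2 := (hcl g hgC _ _ hz).2
      refine ⟨h2, le_trans ?_ h2⟩
      unfold deg; rw [remove_at]; exact Finset.card_le_card Finset.sdiff_subset
  live_lt := by
    obtain ⟨z, hz⟩ := exists_joins hev
    refine live_lt_of v hv ?_ ?_ ?_
    · unfold deg; exact (Finset.card_pos.2 ⟨e, hev⟩).ne'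
    · unfold deg
      rw [remove_at, Finset.sdiff_eq_empty_iff_subset.2 (hcl e heC _ _ hz).1, Finset.card_empty]
    · intro v hv
      unfold deg at *
      rw [Finset.card_eq_zero] at hv
      rw [remove_at, hv]; simp

/-- A lone edge is weak only if its list is empty, so its optimum is the cost of a pendant edge. -/
lemma step_isolated (h : σ.WF n m) (he : e ∈ σ.E) (hj : σ.Joins e v w) (hv : σ.at_ v = {e})
    (hw : σ.at_ w = {e}) : Step tri n m σ ((σ.pay (pendantCost (σ.L e))).del e) := by
  have : (σ.pay (pendantCost (σ.L e))).del e = σ.remove {e} (pendantCost (σ.L e)) :=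
    ext_of (by simp [remove, Finset.sdiff_singleton_eq_erase]) rfl rfl rfl rfl
  rw [this]
  refine step_remove h (by simpa using he) ?_ (h.joins_lt he hj).1 (e := e) (by simp [hv]) (by simp) ?_
  · intro f hf a b hab
    rw [Finset.mem_singleton] at hf; subst hf
    rcases joins_eq hj hab with ⟨rfl, rfl⟩ | ⟨rfl, rfl⟩ <;> simp [deg, hv, hw]
  · intro d
    constructor
    · rintro ⟨x, h1, h2, h3⟩
      rw [Finset.sum_singleton] at h3
      refine le_trans ?_ h3
      have := h1 e (by simp)
      unfold pendantCost
      split_ifs with h0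
      · rw [h0] at this
        cases hx : x e <;> simp_all
      · exact wt_nonneg _
    · intro hd
      unfold pendantCost at hd
      split_ifs at hd with h0
      · exact ⟨fun _ => none, by simp, by simp, by simpa using hd⟩
      · obtain ⟨a, ha⟩ := Finset.nonempty_iff_ne_empty.2 h0
        refine ⟨fun _ => some a, by simpa using ha, ?_, by simpa using hd⟩
        intro p hp q hq hr
        rw [Finset.mem_singleton] at hp hq
        subst hp hq
        exact absurd hr conf_irrefl

/-- A leaf edge lies in no triangle, so it conflicts with f under both notions, and `yesCol_pendant`
applies. Only the degree of w changes besides that of the leaf. -/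
lemma step_pendant (h : σ.WF n m) (he : e ∈ σ.E) (hf : f ∈ σ.E) (hfe : f ≠ e)
    (hj : σ.Joins e v w) (hv : σ.at_ v = {e}) (hw : σ.at_ w = {e, f}) :
    Step tri n m σ (((σ.setL f (pendantList (σ.L e) (σ.L f))).pay (pendantCost (σ.L e))).del e) where
  wf := h.setL.pay.del
  yes := by
    symm
    refine yesCol_pendant he hf hfe (fun _ _ => conf_symm) (fun _ _ => conf_symm)
      (fun _ => conf_irrefl) ?_ ?_
    · refine conf_congr (Finset.erase_subset _ _) (Finset.Subset.refl _)
        (fun _ _ _ _ => Iff.rfl) ?_ (fun g hg hg' => absurd hg hg')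
      intro g hg hgA
      have hge : g = e := by by_contra hne; exact hgA (Finset.mem_erase.2 ⟨hne, hg⟩)
      subst hge
      refine ⟨_, _, hj, fun a ha z hz => ?_⟩
      have := mem_at_left (Finset.mem_of_mem_erase ha) hz
      rw [hv, Finset.mem_singleton] at this
      exact Finset.ne_of_mem_erase ha this
    · intro a ha
      constructor
      · intro hc
        have hae : a ≠ e := by rintro rfl; exact conf_irrefl hc
        rcases hc.mem_at ha hj with h1 | h1
        · rw [hv] at h1; simp [hae] at h1
        · rw [hw] at h1; simpa [hae] using h1
      · rintro rfl
        obtain ⟨z, hz⟩ := exists_joins (σ := σ) (e := a) (v := w) (by simp [hw])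
        have hvz : v ≠ z := by
          rintro rfl
          exact hfe (h.inj a hf e he _ _ (joins_symm hz) hj)
        refine ⟨v, w, z, hvz, hj, hz, fun _ g hg hgj => ?_⟩
        have := mem_at_left hg hgj
        rw [hv, Finset.mem_singleton] at this
        subst this
        have := joins_other hj hgj
        subst this
        exact h.joins_ne hf hz rfl
  loc z := by
    have hvw := h.joins_ne he hj
    by_cases hz : e ∈ σ.at_ z
    · right
      obtain ⟨y, hy⟩ := exists_joins hz
      have : σ.deg z ≤ 2 := by
        unfold deg
        rcases joins_eq hj hy with ⟨rfl, rfl⟩ | ⟨rfl, rfl⟩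
        · simp [hv]
        · rw [hw]; exact Finset.card_le_two
      exact ⟨this, le_trans (by unfold deg; simpa using Finset.card_erase_le) this⟩
    · left; simpa using Finset.erase_eq_of_notMem hz
  live_lt := by
    refine live_lt_of v (h.joins_lt he hj).1 (by simp [deg, hv]) (by simp [deg, hv]) ?_
    intro z hz
    unfold deg at *
    rw [Finset.card_eq_zero] at hz
    simp [hz]

lemma at_eq_pair (he : e ∈ σ.at_ v) (hf : f ∈ σ.at_ v) (hne : e ≠ f) (hd : σ.deg v = 2) :
    σ.at_ v = {e, f} := by
  symm
  apply Finset.eq_of_subset_of_card_le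
  · intro a ha; simp at ha; rcases ha with rfl | rfl <;> assumption
  · rw [Finset.card_pair hne]; exact hd.le

/-- A closed walk `a, b, d` around a triangle whose vertices have degree two. -/
lemma step_triangle (h : σ.WF n m) {a b d x y z : ℕ} (ha : a ∈ σ.E) (hb : b ∈ σ.E) (hd : d ∈ σ.E)
    (ja : σ.Joins a x y) (jb : σ.Joins b y z) (jd : σ.Joins d z x)
    (hx : σ.at_ x = {d, a}) (hy : σ.at_ y = {a, b}) (hz : σ.at_ z = {b, d})
    (hab : a ≠ b) (had : a ≠ d) (hbd : b ≠ d) :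
    Step tri n m σ ((((σ.pay (triangleCost tri (σ.L a) (σ.L b) (σ.L d))).del a).del b).del d) := by
  set o := triangleCost tri (σ.L a) (σ.L b) (σ.L d)
  have heq : (((σ.pay o).del a).del b).del d = σ.remove {a, b, d} o := by
    refine ext_of ?_ rfl rfl rfl rfl
    ext g; simp [remove]; tauto
  rw [heq]
  refine step_remove h ?_ ?_ (h.joins_lt ha ja).1 (e := a) (by simp [hx]) (by simp) ?_
  · intro g hg; simp at hg; rcases hg with rfl | rfl | rfl <;> assumption
  · have cx : σ.at_ x ⊆ {a, b, d} ∧ σ.deg x ≤ 2 :=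
      ⟨by rw [hx]; grind, by rw [deg, hx]; exact Finset.card_le_two⟩
    have cy : σ.at_ y ⊆ {a, b, d} ∧ σ.deg y ≤ 2 :=
      ⟨by rw [hy]; grind, by rw [deg, hy]; exact Finset.card_le_two⟩
    have cz : σ.at_ z ⊆ {a, b, d} ∧ σ.deg z ≤ 2 :=
      ⟨by rw [hz]; grind, by rw [deg, hz]; exact Finset.card_le_two⟩
    intro g hg p q hpq
    simp at hg
    rcases hg with rfl | rfl | rfl
    · rcases joins_eq hpq ja with ⟨rfl, rfl⟩ | ⟨rfl, rfl⟩ <;> assumption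
    · rcases joins_eq hpq jb with ⟨rfl, rfl⟩ | ⟨rfl, rfl⟩ <;> assumption
    · rcases joins_eq hpq jd with ⟨rfl, rfl⟩ | ⟨rfl, rfl⟩ <;> assumption
  · have hxy := h.joins_ne ha ja
    have hyz := h.joins_ne hb jb
    have hzx := h.joins_ne hd jd
    -- The edges p and q meet in t, and r joins their other ends. They conflict unless triangles are
    -- exempt.
    have key : ∀ {p q r s t o : ℕ}, σ.Joins p s t → σ.Joins q t o → σ.Joins r s o → s ≠ o →
        q ∈ σ.E → p ∈ σ.E → r ∈ σ.E → t ≠ o → s ≠ t → p ≠ q → (σ.Conf tri p q ↔ ¬ tri) := by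
      intro p q r s t o h1 h2 h3 hso hq hp hr hto hst hpq
      constructor
      · rintro ⟨u, v, w, k1, k2, k3, k4⟩ ht
        refine k4 ht r hr ?_
        unfold Joins at *; omega
      · exact fun ht => ⟨s, t, o, hso, h1, h2, fun ht' => absurd ht' ht⟩
    have kab := key ja jb (joins_symm jd) hzx.symm hb ha hd hyz hxy hab
    have kbd := key jb jd (joins_symm ja) hxy.symm hd hb ha hzx hyz hbd
    have kda := key jd ja (joins_symm jb) hyz.symm ha hd hb hxy hzx had.symm
    have kba : σ.Conf tri b a ↔ ¬ tri := ⟨fun h => kab.1 (conf_symm h), fun h => conf_symm (kab.2 h)⟩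
    have kdb : σ.Conf tri d b ↔ ¬ tri := ⟨fun h => kbd.1 (conf_symm h), fun h => conf_symm (kbd.2 h)⟩
    have kad : σ.Conf tri a d ↔ ¬ tri := ⟨fun h => kda.1 (conf_symm h), fun h => conf_symm (kda.2 h)⟩
    refine yesCol_triangle hab had hbd ?_
    intro f hf g hg
    simp only [Finset.mem_insert, Finset.mem_singleton] at hf hg
    rcases hf with rfl | rfl | rfl <;> rcases hg with rfl | rfl | rfl <;>
      simp [conf_irrefl, *, Ne.symm hab, Ne.symm had, Ne.symm hbd]

/-- There are no other edges at the cycle, and opposite vertices are joined by no edge of it. So the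
conflicts are those of consecutive edges for both problems, and the optimum is a cycle cost. The
outer ends that `conf_inner` wants distinct are joined by the opposite edge. -/
lemma step_cycle_four (h : σ.WF n m) {a b d e x y z t : ℕ} (ha : a ∈ σ.E) (hb : b ∈ σ.E)
    (hd : d ∈ σ.E) (he : e ∈ σ.E)
    (ja : σ.Joins a x y) (jb : σ.Joins b y z) (jd : σ.Joins d z t) (je : σ.Joins e t x)
    (hx : σ.at_ x = {e, a}) (hy : σ.at_ y = {a, b}) (hz : σ.at_ z = {b, d}) (ht : σ.at_ t = {d, e})
    (hn : [a, b, d, e].Nodup) :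
    Step tri n m σ (((((σ.pay (cycleCost (σ.L a) [σ.L b, σ.L d, σ.L e])).del a).del b).del d).del e) := by
  set o := cycleCost (σ.L a) [σ.L b, σ.L d, σ.L e]
  have heq : ((((σ.pay o).del a).del b).del d).del e = σ.remove {a, b, d, e} o := by
    refine ext_of ?_ rfl rfl rfl rfl
    ext g; simp [remove]; tauto
  rw [heq]
  have hC : ({a, b, d, e} : Finset ℕ) ⊆ σ.E := by
    intro g hg; simp at hg; rcases hg with rfl | rfl | rfl | rfl <;> assumption
  have hn' := hn
  simp only [List.nodup_cons, List.mem_cons, List.not_mem_nil, or_false, not_or] at hn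
  obtain ⟨⟨n1, n2, n3⟩, ⟨n4, n5⟩, n6, -⟩ := hn
  refine step_remove h hC ?_ (h.joins_lt ha ja).1 (e := a) (by simp [hx]) (by simp) ?_
  · have cx : σ.at_ x ⊆ {a, b, d, e} ∧ σ.deg x ≤ 2 :=
      ⟨by rw [hx]; grind, by rw [deg, hx]; exact Finset.card_le_two⟩
    have cy : σ.at_ y ⊆ {a, b, d, e} ∧ σ.deg y ≤ 2 :=
      ⟨by rw [hy]; grind, by rw [deg, hy]; exact Finset.card_le_two⟩
    have cz : σ.at_ z ⊆ {a, b, d, e} ∧ σ.deg z ≤ 2 :=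
      ⟨by rw [hz]; grind, by rw [deg, hz]; exact Finset.card_le_two⟩
    have ct : σ.at_ t ⊆ {a, b, d, e} ∧ σ.deg t ≤ 2 :=
      ⟨by rw [ht]; grind, by rw [deg, ht]; exact Finset.card_le_two⟩
    intro g hg p q hpq
    simp at hg
    rcases hg with rfl | rfl | rfl | rfl
    · rcases joins_eq hpq ja with ⟨rfl, rfl⟩ | ⟨rfl, rfl⟩ <;> assumption
    · rcases joins_eq hpq jb with ⟨rfl, rfl⟩ | ⟨rfl, rfl⟩ <;> assumption
    · rcases joins_eq hpq jd with ⟨rfl, rfl⟩ | ⟨rfl, rfl⟩ <;> assumption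
    · rcases joins_eq hpq je with ⟨rfl, rfl⟩ | ⟨rfl, rfl⟩ <;> assumption
  · refine yesCol_cycle_four hn' ?_ ?_ ?_ ?_
    · exact fun f hf => conf_inner h ha he hb ja je jb hx hy (Ne.symm n3) (Ne.symm n1)
        (h.joins_ne hd jd).symm f (hC hf)
    · exact fun f hf => conf_inner h hb ha hd jb ja jd hy hz n1 (Ne.symm n4)
        (h.joins_ne he je).symm f (hC hf)
    · exact fun f hf => conf_inner h hd hb he jd jb je hz ht n4 (Ne.symm n6)
        (h.joins_ne ha ja).symm f (hC hf)
    · exact fun f hf => conf_inner h he hd ha je jd ja ht hx n6 n3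
        (h.joins_ne hb jb).symm f (hC hf)

/-- As for length four, but the outer ends of three consecutive edges are now two steps apart along
the rest of the cycle, so their distinctness has to be supplied. -/
lemma step_cycle_five (h : σ.WF n m) {a b d e g x y z t s : ℕ} (ha : a ∈ σ.E) (hb : b ∈ σ.E)
    (hd : d ∈ σ.E) (he : e ∈ σ.E) (hg : g ∈ σ.E)
    (ja : σ.Joins a x y) (jb : σ.Joins b y z) (jd : σ.Joins d z t) (je : σ.Joins e t s)
    (jg : σ.Joins g s x) (hx : σ.at_ x = {g, a}) (hy : σ.at_ y = {a, b}) (hz : σ.at_ z = {b, d})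
    (ht : σ.at_ t = {d, e}) (hs : σ.at_ s = {e, g})
    (hn : [a, b, d, e, g].Nodup) (hxz : x ≠ z) (hyt : y ≠ t) (hzs : z ≠ s) (htx : t ≠ x)
    (hsy : s ≠ y) :
    Step tri n m σ ((((((σ.pay (cycleCost (σ.L a) [σ.L b, σ.L d, σ.L e, σ.L g])).del a).del b).del
      d).del e).del g) := by
  set o := cycleCost (σ.L a) [σ.L b, σ.L d, σ.L e, σ.L g]
  have heq : (((((σ.pay o).del a).del b).del d).del e).del g = σ.remove {a, b, d, e, g} o := by
    refine ext_of ?_ rfl rfl rfl rfl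
    ext g; simp [remove]; tauto
  rw [heq]
  have hC : ({a, b, d, e, g} : Finset ℕ) ⊆ σ.E := by
    intro g hg; simp at hg; rcases hg with rfl | rfl | rfl | rfl | rfl <;> assumption
  have hn' := hn
  simp only [List.nodup_cons, List.mem_cons, List.not_mem_nil, or_false, not_or] at hn
  obtain ⟨⟨n1, n2, n3, m1⟩, ⟨n4, n5, m2⟩, ⟨n6, m3⟩, m4, -⟩ := hn
  refine step_remove h hC ?_ (h.joins_lt ha ja).1 (e := a) (by simp [hx]) (by simp) ?_
  · have cx : σ.at_ x ⊆ {a, b, d, e, g} ∧ σ.deg x ≤ 2 :=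
      ⟨by rw [hx]; grind, by rw [deg, hx]; exact Finset.card_le_two⟩
    have cy : σ.at_ y ⊆ {a, b, d, e, g} ∧ σ.deg y ≤ 2 :=
      ⟨by rw [hy]; grind, by rw [deg, hy]; exact Finset.card_le_two⟩
    have cz : σ.at_ z ⊆ {a, b, d, e, g} ∧ σ.deg z ≤ 2 :=
      ⟨by rw [hz]; grind, by rw [deg, hz]; exact Finset.card_le_two⟩
    have ct : σ.at_ t ⊆ {a, b, d, e, g} ∧ σ.deg t ≤ 2 :=
      ⟨by rw [ht]; grind, by rw [deg, ht]; exact Finset.card_le_two⟩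
    have cs : σ.at_ s ⊆ {a, b, d, e, g} ∧ σ.deg s ≤ 2 :=
      ⟨by rw [hs]; grind, by rw [deg, hs]; exact Finset.card_le_two⟩
    intro g hg p q hpq
    simp at hg
    rcases hg with rfl | rfl | rfl | rfl | rfl
    · rcases joins_eq hpq ja with ⟨rfl, rfl⟩ | ⟨rfl, rfl⟩ <;> assumption
    · rcases joins_eq hpq jb with ⟨rfl, rfl⟩ | ⟨rfl, rfl⟩ <;> assumption
    · rcases joins_eq hpq jd with ⟨rfl, rfl⟩ | ⟨rfl, rfl⟩ <;> assumption
    · rcases joins_eq hpq je with ⟨rfl, rfl⟩ | ⟨rfl, rfl⟩ <;> assumption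
    · rcases joins_eq hpq jg with ⟨rfl, rfl⟩ | ⟨rfl, rfl⟩ <;> assumption
  · refine yesCol_cycle_five hn' ?_ ?_ ?_ ?_ ?_
    · exact fun f hf => conf_inner h ha hg hb ja jg jb hx hy (Ne.symm m1) (Ne.symm n1) hzs.symm
        f (hC hf)
    · exact fun f hf => conf_inner h hb ha hd jb ja jd hy hz n1 (Ne.symm n4) htx.symm f (hC hf)
    · exact fun f hf => conf_inner h hd hb he jd jb je hz ht n4 (Ne.symm n6) hsy.symm f (hC hf)
    · exact fun f hf => conf_inner h he hd hg je jd jg ht hs n6 (Ne.symm m4) hxz.symm f (hC hf)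
    · exact fun f hf => conf_inner h hg he ha jg je ja hs hx m4 m1 hyt.symm f (hC hf)

end St

/-! ### Contracting a chain of six edges -/

namespace St
variable {c : ℕ}

/-- A path of six edges whose five inner vertices have degree two; its outer ends may coincide. -/
structure Chain (σ : St c) (e₁ e₂ e₃ e₄ e₅ e₆ v₀ v₁ v₂ v₃ v₄ v₅ v₆ : ℕ) : Prop where
  m₁ : e₁ ∈ σ.E
  m₂ : e₂ ∈ σ.E
  m₃ : e₃ ∈ σ.E
  m₄ : e₄ ∈ σ.E
  m₅ : e₅ ∈ σ.E
  m₆ : e₆ ∈ σ.E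
  j₁ : σ.Joins e₁ v₀ v₁
  j₂ : σ.Joins e₂ v₁ v₂
  j₃ : σ.Joins e₃ v₂ v₃
  j₄ : σ.Joins e₄ v₃ v₄
  j₅ : σ.Joins e₅ v₄ v₅
  j₆ : σ.Joins e₆ v₅ v₆
  a₁ : σ.at_ v₁ = {e₁, e₂}
  a₂ : σ.at_ v₂ = {e₂, e₃}
  a₃ : σ.at_ v₃ = {e₃, e₄}
  a₄ : σ.at_ v₄ = {e₄, e₅}
  a₅ : σ.at_ v₅ = {e₅, e₆}
  nd_e : [e₁, e₂, e₃, e₄, e₅, e₆].Nodup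
  nd_v : [v₁, v₂, v₃, v₄, v₅].Nodup
  n₀ : v₀ ∉ [v₁, v₂, v₃, v₄, v₅]
  n₆ : v₆ ∉ [v₁, v₂, v₃, v₄, v₅]

variable {σ : St c} {e₁ e₂ e₃ e₄ e₅ e₆ v₀ v₁ v₂ v₃ v₄ v₅ v₆ : ℕ} {n m : ℕ} {tri : Prop}

/-- The chain with three new inner edges. -/
def contract₁ (σ : St c) (e₂ e₃ e₄ e₅ v₂ v₄ : ℕ) (l₂ l₃ l₅ : Finset (Fin c)) (d : ℤ) : St c :=
  (((((((σ.pay d).del e₃).del e₄).add e₃ v₂ v₄).setL e₂ l₂).setL e₃ l₃).setL e₅ l₅)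

/-- The chain with two new inner edges. -/
def contract₂ (σ : St c) (e₂ e₃ e₄ e₅ v₂ v₅ : ℕ) (l₂ l₃ : Finset (Fin c)) (d : ℤ) : St c :=
  (((((((σ.pay d).del e₃).del e₄).del e₅).add e₃ v₂ v₅).setL e₂ l₂).setL e₃ l₃)

/-- The vertex v₂ has only the neighbors v₁ and v₃, so the edge inserted at v₂ is not parallel to an
existing one. -/
lemma Chain.noJoin {u w : ℕ} (hC : Chain σ e₁ e₂ e₃ e₄ e₅ e₆ v₀ v₁ v₂ v₃ v₄ v₅ v₆)
    (h1 : u ≠ v₁) (h3 : u ≠ v₃) (hw : w = v₂) {g : ℕ} (hg : g ∈ σ.E) : ¬ σ.Joins g u w := by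
  subst hw
  intro hj
  have := mem_at_right hg hj
  rw [hC.a₂] at this
  simp only [Finset.mem_insert, Finset.mem_singleton] at this
  rcases this with rfl | rfl
  · exact h1 (joins_other (joins_symm hj) (joins_symm hC.j₂))
  · exact h3 (joins_other (joins_symm hj) hC.j₃)

lemma Chain.yes_inner (h : σ.WF n m) (hC : Chain σ e₁ e₂ e₃ e₄ e₅ e₆ v₀ v₁ v₂ v₃ v₄ v₅ v₆)
    {A : Finset ℕ} (hA : A = σ.E \ {e₂, e₃, e₄, e₅}) (x : ℕ → Option (Fin c)) (w : ℤ) :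
    (∃ y, Extends A {e₂, e₃, e₄, e₅} (σ.Conf tri) σ.L x y w) ↔
      Feas [σ.L e₂, σ.L e₃, σ.L e₄, σ.L e₅] (x e₁) (x e₆) w := by
  obtain ⟨m₁, m₂, m₃, m₄, m₅, m₆, j₁, j₂, j₃, j₄, j₅, j₆, a₁, a₂, a₃, a₄, a₅, de, dv, n₀, n₆⟩ := hC
  simp only [List.nodup_cons, List.mem_cons, List.not_mem_nil, or_false, not_or] at de dv n₀ n₆
  obtain ⟨⟨d12, d13, d14, d15, d16⟩, ⟨d23, d24, d25, d26⟩, ⟨d34, d35, d36⟩, ⟨d45, d46⟩, d56, -⟩ := de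
  obtain ⟨⟨w12, w13, w14, w15⟩, ⟨w23, w24, w25⟩, ⟨w34, w35⟩, w45, -⟩ := dv
  obtain ⟨w01, w02, w03, w04, w05⟩ := n₀
  obtain ⟨w61, w62, w63, w64, w65⟩ := n₆
  have hE : ∀ f ∈ A ∪ {e₂, e₃, e₄, e₅}, f ∈ σ.E := by
    intro f hf
    simp only [hA, Finset.mem_union, Finset.mem_sdiff, Finset.mem_insert,
      Finset.mem_singleton] at hf
    rcases hf with hf | rfl | rfl | rfl | rfl
    · exact hf.1
    all_goals assumption
  refine extends_chain_four ?_ ?_ ?_ ?_ ?_ ?_ ?_ ?_ x w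
  · simp [d23, d24, d25, d34, d35, d45]
  · simp [hA, m₁, d12, d13, d14, d15]
  · simp [hA, m₆, Ne.symm d26, Ne.symm d36, Ne.symm d46, Ne.symm d56]
  · intro e he
    rw [hA, Finset.mem_sdiff] at he
    simpa using he.2
  · exact fun f hf => conf_inner h m₂ m₁ m₃ j₂ j₁ j₃ a₁ a₂ d12 (Ne.symm d23) w03 f (hE f hf)
  · exact fun f hf => conf_inner h m₃ m₂ m₄ j₃ j₂ j₄ a₂ a₃ d23 (Ne.symm d34) w14 f (hE f hf)
  · exact fun f hf => conf_inner h m₄ m₃ m₅ j₄ j₃ j₅ a₃ a₄ d34 (Ne.symm d45) w25 f (hE f hf)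
  · exact fun f hf => conf_inner h m₅ m₄ m₆ j₅ j₄ j₆ a₄ a₅ d45 (Ne.symm d56) (Ne.symm w63) f (hE f hf)

/-- A vertex whose edges all belong to the block is not met by kept edges; this feeds `conf_congr`.
-/
lemma no_joins_of_at {A B : Finset ℕ} (hA : A ⊆ σ.E) (hAB : Disjoint A B) {v : ℕ}
    (hv : σ.at_ v ⊆ B) : ∀ e ∈ A, ∀ z, ¬ σ.Joins e v z := fun _ he _ hj =>
  Finset.disjoint_left.1 hAB he (hv (mem_at_left (hA he) hj))

lemma Chain.wf₁ (h : σ.WF n m) (hC : Chain σ e₁ e₂ e₃ e₄ e₅ e₆ v₀ v₁ v₂ v₃ v₄ v₅ v₆)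
    (l₂ l₃ l₅ : Finset (Fin c)) (d : ℤ) :
    (σ.contract₁ e₂ e₃ e₄ e₅ v₂ v₄ l₂ l₃ l₅ d).WF n m := by
  have dv := hC.nd_v
  simp only [List.nodup_cons, List.mem_cons, List.not_mem_nil, or_false, not_or] at dv
  refine ((((h.pay.del).del).add (h.lt_m _ hC.m₃) (h.joins_lt hC.m₃ hC.j₃).1
    (h.joins_lt hC.m₄ hC.j₄).2 (by omega) ?_).setL).setL.setL
  intro f hf hj
  refine hC.noJoin (u := v₄) (by omega) (by omega) rfl (g := f) ?_ (joins_symm hj)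
  simp at hf; tauto

lemma Chain.wf₂ (h : σ.WF n m) (hC : Chain σ e₁ e₂ e₃ e₄ e₅ e₆ v₀ v₁ v₂ v₃ v₄ v₅ v₆)
    (l₂ l₃ : Finset (Fin c)) (d : ℤ) :
    (σ.contract₂ e₂ e₃ e₄ e₅ v₂ v₅ l₂ l₃ d).WF n m := by
  have dv := hC.nd_v
  simp only [List.nodup_cons, List.mem_cons, List.not_mem_nil, or_false, not_or] at dv
  refine (((((h.pay.del).del).del).add (h.lt_m _ hC.m₃) (h.joins_lt hC.m₃ hC.j₃).1
    (h.joins_lt hC.m₅ hC.j₅).2 (by omega) ?_).setL).setL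
  intro f hf hj
  refine hC.noJoin (u := v₅) (by omega) (by omega) rfl (g := f) ?_ (joins_symm hj)
  simp at hf; tauto

lemma at_contract₁ (l₂ l₃ l₅ : Finset (Fin c)) (d : ℤ) (v : ℕ) :
    (σ.contract₁ e₂ e₃ e₄ e₅ v₂ v₄ l₂ l₃ l₅ d).at_ v =
      if v = v₂ ∨ v = v₄ then insert e₃ (((σ.at_ v).erase e₃).erase e₄)
      else ((σ.at_ v).erase e₃).erase e₄ := by
  simp only [contract₁, setL_at]
  rw [add_at (by simp)]
  simp

lemma at_contract₂ (l₂ l₃ : Finset (Fin c)) (d : ℤ) (v : ℕ) :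
    (σ.contract₂ e₂ e₃ e₄ e₅ v₂ v₅ l₂ l₃ d).at_ v =
      if v = v₂ ∨ v = v₅ then insert e₃ ((((σ.at_ v).erase e₃).erase e₄).erase e₅)
      else (((σ.at_ v).erase e₃).erase e₄).erase e₅ := by
  simp only [contract₂, setL_at]
  rw [add_at (by simp)]
  simp

/-- The block of four middle edges is exchanged for e₂, the redirected e₃, and e₅. In both graphs
the block is a chain of conflicts between e₁ and e₆, so the equivalence of the list problems carries
over. The kept end edges rule out triangles: the outer vertices around each middle edge remain
distinct. -/
lemma Chain.yes₁ (h : σ.WF n m) (hC : Chain σ e₁ e₂ e₃ e₄ e₅ e₆ v₀ v₁ v₂ v₃ v₄ v₅ v₆)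
    {l₂ l₃ l₅ : Finset (Fin c)} {d : ℤ}
    (hf : ∀ i j w, Feas [σ.L e₂, σ.L e₃, σ.L e₄, σ.L e₅] i j (w + d) ↔ Feas [l₂, l₃, l₅] i j w) :
    (σ.contract₁ e₂ e₃ e₄ e₅ v₂ v₄ l₂ l₃ l₅ d).Yes tri ↔ σ.Yes tri := by
  have h' := hC.wf₁ h l₂ l₃ l₅ d
  have hat := fun v => at_contract₁ (σ := σ) (e₂ := e₂) (e₃ := e₃) (e₄ := e₄) (e₅ := e₅) (v₂ := v₂)
    (v₄ := v₄) l₂ l₃ l₅ d v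
  have hC' := hC
  set σ' := σ.contract₁ e₂ e₃ e₄ e₅ v₂ v₄ l₂ l₃ l₅ d with hσ'
  obtain ⟨m₁, m₂, m₃, m₄, m₅, m₆, j₁, j₂, j₃, j₄, j₅, j₆, a₁, a₂, a₃, a₄, a₅, de, dv, n₀, n₆⟩ := hC
  simp only [List.nodup_cons, List.mem_cons, List.not_mem_nil, or_false, not_or] at de dv n₀ n₆
  obtain ⟨⟨d12, d13, d14, d15, d16⟩, ⟨d23, d24, d25, d26⟩, ⟨d34, d35, d36⟩, ⟨d45, d46⟩, d56, -⟩ := de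
  obtain ⟨⟨w12, w13, w14, w15⟩, ⟨w23, w24, w25⟩, ⟨w34, w35⟩, w45, -⟩ := dv
  obtain ⟨w01, w02, w03, w04, w05⟩ := n₀
  obtain ⟨w61, w62, w63, w64, w65⟩ := n₆
  set A := σ.E \ {e₂, e₃, e₄, e₅} with hA
  have hE : σ.E = A ∪ {e₂, e₃, e₄, e₅} := by
    rw [hA, Finset.sdiff_union_of_subset]
    intro g hg; simp at hg; rcases hg with rfl | rfl | rfl | rfl <;> assumption
  have hE' : σ'.E = A ∪ {e₂, e₃, e₅} := by
    ext g
    have : σ'.E = insert e₃ ((σ.E.erase e₃).erase e₄) := rfl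
    rw [this]
    simp only [hA, Finset.mem_insert, Finset.mem_erase, Finset.mem_union, Finset.mem_sdiff,
      Finset.mem_singleton]
    by_cases h1 : g = e₂
    · subst h1; simp [m₂, d23, d24, d25]
    by_cases h2 : g = e₃
    · subst h2; simp
    by_cases h3 : g = e₄
    · subst h3; simp [Ne.symm d24, Ne.symm d34, d45]
    by_cases h4 : g = e₅
    · subst h4; simp [m₅, Ne.symm d35, Ne.symm d45]
    simp [h1, h2, h3, h4]
  have hJ : ∀ e, e ≠ e₃ → ∀ u v, σ'.Joins e u v ↔ σ.Joins e u v := by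
    intro e he u v
    simp only [hσ', contract₁, setL_joins]
    rw [add_joins_ne he]; simp
  have j3' : σ'.Joins e₃ v₂ v₄ := by
    simp only [hσ', contract₁, setL_joins]
    rw [add_joins_self]; simp
  have hL : ∀ e, e ≠ e₂ → e ≠ e₃ → e ≠ e₅ → σ'.L e = σ.L e := by
    intro e h1 h2 h3
    simp [hσ', contract₁, h1, h2, h3]
  have hL2 : σ'.L e₂ = l₂ := by
    simp only [hσ', contract₁, setL_L]
    rw [Function.update_of_ne d25, Function.update_of_ne d23, Function.update_self]
  have hL3 : σ'.L e₃ = l₃ := by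
    simp only [hσ', contract₁, setL_L]
    rw [Function.update_of_ne d35, Function.update_self]
  have hL5 : σ'.L e₅ = l₅ := by
    simp only [hσ', contract₁, setL_L]
    rw [Function.update_self]
  have hnA : ∀ e ∈ A, e ∈ σ.E ∧ ¬ e = e₂ ∧ ¬ e = e₃ ∧ ¬ e = e₄ ∧ ¬ e = e₅ := by
    intro e he; simpa [hA] using he
  have b₁ : σ'.at_ v₁ = {e₁, e₂} := by
    rw [hat, if_neg (by simp [w12, w14]), a₁]; grind
  have b₂ : σ'.at_ v₂ = {e₂, e₃} := by
    rw [hat, if_pos (by simp), a₂]; grind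
  have b₄ : σ'.at_ v₄ = {e₃, e₅} := by
    rw [hat, if_pos (by simp), a₄]; grind
  have b₅ : σ'.at_ v₅ = {e₅, e₆} := by
    rw [hat, if_neg (by simp [Ne.symm w25, Ne.symm w45]), a₅]; grind
  have m1A : e₁ ∈ A := by
    simp [hA, m₁, d12, d13, d14, d15]
  have m6A : e₆ ∈ A := by
    simp [hA, m₆, Ne.symm d26, Ne.symm d36, Ne.symm d46, Ne.symm d56]
  have mE : ∀ e ∈ A ∪ {e₂, e₃, e₅}, e ∈ σ'.E := fun e he => hE' ▸ he
  have hAB : Disjoint A {e₂, e₃, e₄, e₅} := Finset.sdiff_disjoint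
  have hAE : A ⊆ σ.E := Finset.sdiff_subset
  have hAE' : A ⊆ σ'.E := fun e he => hE' ▸ Finset.mem_union_left _ he
  have key := yesCol_block (A := A) (B := {e₂, e₃, e₄, e₅}) (B' := {e₂, e₃, e₅})
    (R := σ.Conf tri) (R' := σ'.Conf tri) (L := σ.L) (L' := σ'.L) (d := d) (k := σ.k - d)
    Finset.sdiff_disjoint (by
      rw [Finset.disjoint_left]; intro e he; obtain ⟨-, h2, h3, h4, h5⟩ := hnA e he; simp [h2, h3, h5])
    (fun _ _ => conf_symm) (fun _ _ => conf_symm) ?_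
    (fun e he => by obtain ⟨-, h2, h3, h4, h5⟩ := hnA e he; rw [hL e h2 h3 h5]) ?_
  · rw [← hE, ← hE', sub_add_cancel] at key
    exact key.symm
  · refine conf_congr (fun e he => (hnA e he).1) (fun e he => mE e (Finset.mem_union_left _ he))
      (fun e he u v => (hJ e (hnA e he).2.2.1 u v).symm) ?_ ?_
    -- Each middle edge has the end v₂ or v₄, and no kept edge meets these vertices.
    · intro g hg hgA
      rw [hE] at hg
      simp only [Finset.mem_union, hgA, false_or, Finset.mem_insert, Finset.mem_singleton] at hg
      rcases hg with rfl | rfl | rfl | rfl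
      · exact ⟨_, _, joins_symm j₂, no_joins_of_at hAE hAB (by rw [a₂]; grind)⟩
      · exact ⟨_, _, j₃, no_joins_of_at hAE hAB (by rw [a₂]; grind)⟩
      · exact ⟨_, _, joins_symm j₄, no_joins_of_at hAE hAB (by rw [a₄]; grind)⟩
      · exact ⟨_, _, j₅, no_joins_of_at hAE hAB (by rw [a₄]; grind)⟩
    · intro g hg hgA
      rw [hE'] at hg
      simp only [Finset.mem_union, hgA, false_or, Finset.mem_insert, Finset.mem_singleton] at hg
      rcases hg with rfl | rfl | rfl
      · exact ⟨_, _, (hJ _ d23 _ _).2 (joins_symm j₂), no_joins_of_at hAE' hAB (by rw [b₂]; grind)⟩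
      · exact ⟨_, _, j3', no_joins_of_at hAE' hAB (by rw [b₂]; grind)⟩
      · exact ⟨_, _, (hJ _ (Ne.symm d35) _ _).2 j₅, no_joins_of_at hAE' hAB (by rw [b₄]; grind)⟩
  · intro x w
    rw [hC'.yes_inner h hA, hf]
    have := extends_chain_three (A := A) (R := σ'.Conf tri) (L := σ'.L) (a := e₁) (e₂ := e₂)
      (e₃ := e₃) (e₄ := e₅) (b := e₆) (by simp [d23, d25, d35]) m1A m6A
      (fun e he => by obtain ⟨-, h2, h3, h4, h5⟩ := hnA e he; simp [h2, h3, h5]) ?_ ?_ ?_ x w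
    · rw [this, hL2, hL3, hL5]
    · exact fun f hf => conf_inner h' (mE _ (by simp)) (mE _ (by simp [m1A])) (mE _ (by simp))
        ((hJ _ d23 _ _).2 j₂) ((hJ _ d13 _ _).2 j₁) j3' b₁ b₂
        d12 (Ne.symm d23) w04 f (mE f hf)
    · exact fun f hf => conf_inner h' (mE _ (by simp)) (mE _ (by simp)) (mE _ (by simp))
        j3' ((hJ _ d23 _ _).2 j₂) ((hJ _ (Ne.symm d35) _ _).2 j₅) b₂ b₄
        d23 (Ne.symm d35) w15 f (mE f hf)
    · exact fun f hf => conf_inner h' (mE _ (by simp)) (mE _ (by simp)) (mE _ (by simp [m6A]))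
        ((hJ _ (Ne.symm d35) _ _).2 j₅) j3' ((hJ _ (Ne.symm d36) _ _).2 j₆) b₄ b₅
        d35 (Ne.symm d56) (Ne.symm w62) f (mE f hf)

/-- Same exchange with e₃ redirected from v₂ to v₅. If the outer ends coincide, the shortened cycle
still has four edges, so no triangle appears. -/
lemma Chain.yes₂ (h : σ.WF n m) (hC : Chain σ e₁ e₂ e₃ e₄ e₅ e₆ v₀ v₁ v₂ v₃ v₄ v₅ v₆)
    {l₂ l₃ : Finset (Fin c)} {d : ℤ}
    (hf : ∀ i j w, Feas [σ.L e₂, σ.L e₃, σ.L e₄, σ.L e₅] i j (w + d) ↔ Feas [l₂, l₃] i j w) :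
    (σ.contract₂ e₂ e₃ e₄ e₅ v₂ v₅ l₂ l₃ d).Yes tri ↔ σ.Yes tri := by
  have h' := hC.wf₂ h l₂ l₃ d
  have hat := fun v => at_contract₂ (σ := σ) (e₂ := e₂) (e₃ := e₃) (e₄ := e₄) (e₅ := e₅) (v₂ := v₂)
    (v₅ := v₅) l₂ l₃ d v
  have hC' := hC
  set σ' := σ.contract₂ e₂ e₃ e₄ e₅ v₂ v₅ l₂ l₃ d with hσ'
  obtain ⟨m₁, m₂, m₃, m₄, m₅, m₆, j₁, j₂, j₃, j₄, j₅, j₆, a₁, a₂, a₃, a₄, a₅, de, dv, n₀, n₆⟩ := hC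
  simp only [List.nodup_cons, List.mem_cons, List.not_mem_nil, or_false, not_or] at de dv n₀ n₆
  obtain ⟨⟨d12, d13, d14, d15, d16⟩, ⟨d23, d24, d25, d26⟩, ⟨d34, d35, d36⟩, ⟨d45, d46⟩, d56, -⟩ := de
  obtain ⟨⟨w12, w13, w14, w15⟩, ⟨w23, w24, w25⟩, ⟨w34, w35⟩, w45, -⟩ := dv
  obtain ⟨w01, w02, w03, w04, w05⟩ := n₀
  obtain ⟨w61, w62, w63, w64, w65⟩ := n₆
  set A := σ.E \ {e₂, e₃, e₄, e₅} with hA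
  have hE : σ.E = A ∪ {e₂, e₃, e₄, e₅} := by
    rw [hA, Finset.sdiff_union_of_subset]
    intro g hg; simp at hg; rcases hg with rfl | rfl | rfl | rfl <;> assumption
  have hE' : σ'.E = A ∪ {e₂, e₃} := by
    ext g
    have : σ'.E = insert e₃ (((σ.E.erase e₃).erase e₄).erase e₅) := rfl
    rw [this]
    simp only [hA, Finset.mem_insert, Finset.mem_erase, Finset.mem_union, Finset.mem_sdiff,
      Finset.mem_singleton]
    by_cases h1 : g = e₂
    · subst h1; simp [m₂, d23, d24, d25]
    by_cases h2 : g = e₃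
    · subst h2; simp
    by_cases h3 : g = e₄
    · subst h3; simp [Ne.symm d24, Ne.symm d34, d45]
    by_cases h4 : g = e₅
    · subst h4; simp [Ne.symm d25, Ne.symm d35]
    simp [h1, h2, h3, h4]
  have hJ : ∀ e, e ≠ e₃ → ∀ u v, σ'.Joins e u v ↔ σ.Joins e u v := by
    intro e he u v
    simp only [hσ', contract₂, setL_joins]
    rw [add_joins_ne he]; simp
  have j3' : σ'.Joins e₃ v₂ v₅ := by
    simp only [hσ', contract₂, setL_joins]
    rw [add_joins_self]; simp
  have hL : ∀ e, e ≠ e₂ → e ≠ e₃ → σ'.L e = σ.L e := by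
    intro e h1 h2
    simp [hσ', contract₂, h1, h2]
  have hL2 : σ'.L e₂ = l₂ := by
    simp only [hσ', contract₂, setL_L]
    rw [Function.update_of_ne d23, Function.update_self]
  have hL3 : σ'.L e₃ = l₃ := by
    simp only [hσ', contract₂, setL_L]
    rw [Function.update_self]
  have hnA : ∀ e ∈ A, e ∈ σ.E ∧ ¬ e = e₂ ∧ ¬ e = e₃ ∧ ¬ e = e₄ ∧ ¬ e = e₅ := by
    intro e he; simpa [hA] using he
  have b₁ : σ'.at_ v₁ = {e₁, e₂} := by
    rw [hat, if_neg (by simp [w12, w15]), a₁]; grind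
  have b₂ : σ'.at_ v₂ = {e₂, e₃} := by
    rw [hat, if_pos (by simp), a₂]; grind
  have b₅ : σ'.at_ v₅ = {e₃, e₆} := by
    rw [hat, if_pos (by simp), a₅]; grind
  have m1A : e₁ ∈ A := by
    simp [hA, m₁, d12, d13, d14, d15]
  have m6A : e₆ ∈ A := by
    simp [hA, m₆, Ne.symm d26, Ne.symm d36, Ne.symm d46, Ne.symm d56]
  have mE : ∀ e ∈ A ∪ {e₂, e₃}, e ∈ σ'.E := fun e he => hE' ▸ he
  have hAB : Disjoint A {e₂, e₃, e₄, e₅} := Finset.sdiff_disjoint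
  have hAE : A ⊆ σ.E := Finset.sdiff_subset
  have hAE' : A ⊆ σ'.E := fun e he => hE' ▸ Finset.mem_union_left _ he
  have key := yesCol_block (A := A) (B := {e₂, e₃, e₄, e₅}) (B' := {e₂, e₃})
    (R := σ.Conf tri) (R' := σ'.Conf tri) (L := σ.L) (L' := σ'.L) (d := d) (k := σ.k - d)
    Finset.sdiff_disjoint (by
      rw [Finset.disjoint_left]; intro e he; obtain ⟨-, h2, h3, h4, h5⟩ := hnA e he; simp [h2, h3])
    (fun _ _ => conf_symm) (fun _ _ => conf_symm) ?_
    (fun e he => by obtain ⟨-, h2, h3, h4, h5⟩ := hnA e he; rw [hL e h2 h3]) ?_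
  · rw [← hE, ← hE', sub_add_cancel] at key
    exact key.symm
  · refine conf_congr (fun e he => (hnA e he).1) (fun e he => mE e (Finset.mem_union_left _ he))
      (fun e he u v => (hJ e (hnA e he).2.2.1 u v).symm) ?_ ?_
    · intro g hg hgA
      rw [hE] at hg
      simp only [Finset.mem_union, hgA, false_or, Finset.mem_insert, Finset.mem_singleton] at hg
      rcases hg with rfl | rfl | rfl | rfl
      · exact ⟨_, _, joins_symm j₂, no_joins_of_at hAE hAB (by rw [a₂]; grind)⟩
      · exact ⟨_, _, j₃, no_joins_of_at hAE hAB (by rw [a₂]; grind)⟩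
      · exact ⟨_, _, joins_symm j₄, no_joins_of_at hAE hAB (by rw [a₄]; grind)⟩
      · exact ⟨_, _, j₅, no_joins_of_at hAE hAB (by rw [a₄]; grind)⟩
    · intro g hg hgA
      rw [hE'] at hg
      simp only [Finset.mem_union, hgA, false_or, Finset.mem_insert, Finset.mem_singleton] at hg
      rcases hg with rfl | rfl
      · exact ⟨_, _, (hJ _ d23 _ _).2 (joins_symm j₂), no_joins_of_at hAE' hAB (by rw [b₂]; grind)⟩
      · exact ⟨_, _, j3', no_joins_of_at hAE' hAB (by rw [b₂]; grind)⟩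
  · intro x w
    rw [hC'.yes_inner h hA, hf]
    have := extends_chain_two (A := A) (R := σ'.Conf tri) (L := σ'.L) (a := e₁) (e₂ := e₂)
      (e₃ := e₃) (b := e₆) d23 m1A m6A
      (fun e he => by obtain ⟨-, h2, h3, h4, h5⟩ := hnA e he; exact ⟨h2, h3⟩) (fun _ => conf_irrefl) ?_ ?_ x w
    · rw [this, hL2, hL3]
    · exact fun f hf => conf_inner h' (mE _ (by simp)) (mE _ (by simp [m1A])) (mE _ (by simp))
        ((hJ _ d23 _ _).2 j₂) ((hJ _ d13 _ _).2 j₁) j3' b₁ b₂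
        d12 (Ne.symm d23) w05 f (mE f hf)
    · exact fun f hf => conf_inner h' (mE _ (by simp)) (mE _ (by simp)) (mE _ (by simp [m6A]))
        j3' ((hJ _ d23 _ _).2 j₂) ((hJ _ (Ne.symm d36) _ _).2 j₆) b₂ b₅
        d23 (Ne.symm d36) (Ne.symm w61) f (mE f hf)

/-- The vertex v₃ becomes isolated, v₂ and v₄ keep degree two, and no other incidences change. -/
lemma Chain.step₁ (h : σ.WF n m) (hC : Chain σ e₁ e₂ e₃ e₄ e₅ e₆ v₀ v₁ v₂ v₃ v₄ v₅ v₆)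
    {l₂ l₃ l₅ : Finset (Fin c)} {d : ℤ}
    (hf : ∀ i j w, Feas [σ.L e₂, σ.L e₃, σ.L e₄, σ.L e₅] i j (w + d) ↔ Feas [l₂, l₃, l₅] i j w) :
    Step tri n m σ (σ.contract₁ e₂ e₃ e₄ e₅ v₂ v₄ l₂ l₃ l₅ d) := by
  have hat := fun v => at_contract₁ (σ := σ) (e₂ := e₂) (e₃ := e₃) (e₄ := e₄) (e₅ := e₅) (v₂ := v₂)
    (v₄ := v₄) l₂ l₃ l₅ d v
  have dv := hC.nd_v
  have de := hC.nd_e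
  simp only [List.nodup_cons, List.mem_cons, List.not_mem_nil, or_false, not_or] at dv de
  obtain ⟨⟨d12, d13, d14, d15, d16⟩, ⟨d23, d24, d25, d26⟩, ⟨d34, d35, d36⟩, ⟨d45, d46⟩, d56, -⟩ := de
  obtain ⟨⟨w12, w13, w14, w15⟩, ⟨w23, w24, w25⟩, ⟨w34, w35⟩, w45, -⟩ := dv
  have hsub : ∀ v, v ≠ v₂ → v ≠ v₄ → σ.deg v ≤ 2 →
      (σ.contract₁ e₂ e₃ e₄ e₅ v₂ v₄ l₂ l₃ l₅ d).deg v ≤ 2 := by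
    intro v h1 h2 h3
    unfold deg; rw [hat, if_neg (by tauto)]
    exact (Finset.card_le_card ((Finset.erase_subset _ _).trans (Finset.erase_subset _ _))).trans h3
  refine ⟨hC.wf₁ h _ _ _ _, hC.yes₁ h hf, ?_, ?_⟩
  · intro v
    by_cases h2 : v = v₂
    · subst h2
      right
      unfold deg
      rw [hat, if_pos (by simp), hC.a₂]
      refine ⟨Finset.card_le_two, ?_⟩
      have : insert e₃ ((({e₂, e₃} : Finset ℕ).erase e₃).erase e₄) = {e₂, e₃} := by
        grind
      rw [this]; exact Finset.card_le_two
    by_cases h4 : v = v₄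
    · subst h4
      right
      unfold deg
      rw [hat, if_pos (by simp), hC.a₄]
      refine ⟨Finset.card_le_two, ?_⟩
      have : insert e₃ ((({e₄, e₅} : Finset ℕ).erase e₃).erase e₄) = {e₃, e₅} := by
        grind
      rw [this]; exact Finset.card_le_two
    by_cases h3 : v = v₃
    · subst h3
      have : σ.deg v ≤ 2 := by unfold deg; rw [hC.a₃]; exact Finset.card_le_two
      exact Or.inr ⟨this, hsub v h2 h4 this⟩
    · left
      rw [hat, if_neg (by tauto)]
      rw [Finset.erase_eq_of_notMem, Finset.erase_eq_of_notMem]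
      · intro hm
        obtain ⟨z, hz⟩ := exists_joins hm
        rcases joins_eq hz hC.j₃ with ⟨rfl, rfl⟩ | ⟨rfl, rfl⟩ <;> contradiction
      · intro hm
        obtain ⟨z, hz⟩ := exists_joins (Finset.mem_of_mem_erase hm)
        rcases joins_eq hz hC.j₄ with ⟨rfl, rfl⟩ | ⟨rfl, rfl⟩ <;> contradiction
  · refine live_lt_of v₃ (h.joins_lt hC.m₃ hC.j₃).2 ?_ ?_ ?_
    · unfold deg; rw [hC.a₃]; simp
    · unfold deg; rw [hat, if_neg (by simp [Ne.symm w23, w34]), hC.a₃, Finset.card_eq_zero]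
      grind
    · intro v hv
      have h2 : v ≠ v₂ := by rintro rfl; unfold deg at hv; rw [hC.a₂] at hv; simp at hv
      have h4 : v ≠ v₄ := by rintro rfl; unfold deg at hv; rw [hC.a₄] at hv; simp at hv
      unfold deg at *
      rw [Finset.card_eq_zero] at hv
      rw [hat, if_neg (by tauto), hv]; simp

/-- Now v₃ and v₄ become isolated, while v₂ and v₅ keep degree two. -/
lemma Chain.step₂ (h : σ.WF n m) (hC : Chain σ e₁ e₂ e₃ e₄ e₅ e₆ v₀ v₁ v₂ v₃ v₄ v₅ v₆)
    {l₂ l₃ : Finset (Fin c)} {d : ℤ}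
    (hf : ∀ i j w, Feas [σ.L e₂, σ.L e₃, σ.L e₄, σ.L e₅] i j (w + d) ↔ Feas [l₂, l₃] i j w) :
    Step tri n m σ (σ.contract₂ e₂ e₃ e₄ e₅ v₂ v₅ l₂ l₃ d) := by
  have hat := fun v => at_contract₂ (σ := σ) (e₂ := e₂) (e₃ := e₃) (e₄ := e₄) (e₅ := e₅) (v₂ := v₂)
    (v₅ := v₅) l₂ l₃ d v
  have dv := hC.nd_v
  have de := hC.nd_e
  simp only [List.nodup_cons, List.mem_cons, List.not_mem_nil, or_false, not_or] at dv de
  obtain ⟨⟨d12, d13, d14, d15, d16⟩, ⟨d23, d24, d25, d26⟩, ⟨d34, d35, d36⟩, ⟨d45, d46⟩, d56, -⟩ := de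
  obtain ⟨⟨w12, w13, w14, w15⟩, ⟨w23, w24, w25⟩, ⟨w34, w35⟩, w45, -⟩ := dv
  have hsub : ∀ v, v ≠ v₂ → v ≠ v₅ → σ.deg v ≤ 2 →
      (σ.contract₂ e₂ e₃ e₄ e₅ v₂ v₅ l₂ l₃ d).deg v ≤ 2 := by
    intro v h1 h2 h3
    unfold deg; rw [hat, if_neg (by tauto)]
    exact (Finset.card_le_card (((Finset.erase_subset _ _).trans (Finset.erase_subset _ _)).trans
      (Finset.erase_subset _ _))).trans h3
  refine ⟨hC.wf₂ h _ _ _, hC.yes₂ h hf, ?_, ?_⟩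
  · intro v
    by_cases h2 : v = v₂
    · subst h2
      right
      unfold deg
      rw [hat, if_pos (by simp), hC.a₂]
      refine ⟨Finset.card_le_two, ?_⟩
      have : insert e₃ (((({e₂, e₃} : Finset ℕ).erase e₃).erase e₄).erase e₅) = {e₂, e₃} := by
        grind
      rw [this]; exact Finset.card_le_two
    by_cases h5 : v = v₅
    · subst h5
      right
      unfold deg
      rw [hat, if_pos (by simp), hC.a₅]
      refine ⟨Finset.card_le_two, ?_⟩
      have : insert e₃ (((({e₅, e₆} : Finset ℕ).erase e₃).erase e₄).erase e₅) = {e₃, e₆} := by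
        grind
      rw [this]; exact Finset.card_le_two
    by_cases h3 : v = v₃
    · subst h3
      have : σ.deg v ≤ 2 := by unfold deg; rw [hC.a₃]; exact Finset.card_le_two
      exact Or.inr ⟨this, hsub v h2 h5 this⟩
    by_cases h4 : v = v₄
    · subst h4
      have : σ.deg v ≤ 2 := by unfold deg; rw [hC.a₄]; exact Finset.card_le_two
      exact Or.inr ⟨this, hsub v h2 h5 this⟩
    · left
      rw [hat, if_neg (by tauto)]
      rw [Finset.erase_eq_of_notMem, Finset.erase_eq_of_notMem, Finset.erase_eq_of_notMem]
      · intro hm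
        obtain ⟨z, hz⟩ := exists_joins hm
        rcases joins_eq hz hC.j₃ with ⟨rfl, rfl⟩ | ⟨rfl, rfl⟩ <;> contradiction
      · intro hm
        obtain ⟨z, hz⟩ := exists_joins (Finset.mem_of_mem_erase hm)
        rcases joins_eq hz hC.j₄ with ⟨rfl, rfl⟩ | ⟨rfl, rfl⟩ <;> contradiction
      · intro hm
        obtain ⟨z, hz⟩ := exists_joins (Finset.mem_of_mem_erase (Finset.mem_of_mem_erase hm))
        rcases joins_eq hz hC.j₅ with ⟨rfl, rfl⟩ | ⟨rfl, rfl⟩ <;> contradiction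
  · refine live_lt_of v₃ (h.joins_lt hC.m₃ hC.j₃).2 ?_ ?_ ?_
    · unfold deg; rw [hC.a₃]; simp
    · unfold deg; rw [hat, if_neg (by simp [Ne.symm w23, w35]), hC.a₃, Finset.card_eq_zero]
      grind
    · intro v hv
      have h2 : v ≠ v₂ := by rintro rfl; unfold deg at hv; rw [hC.a₂] at hv; simp at hv
      have h5 : v ≠ v₅ := by rintro rfl; unfold deg at hv; rw [hC.a₅] at hv; simp at hv
      unfold deg at *
      rw [Finset.card_eq_zero] at hv
      rw [hat, if_neg (by tauto), hv]; simp

end St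

/-! ### The configurations around a center of degree two -/

namespace St
variable {c : ℕ}

/-- A path of four edges around a vertex `v₃` of degree two with neighbors of degree two. -/
structure Center (σ : St c) (e₂ e₃ e₄ e₅ v₁ v₂ v₃ v₄ v₅ : ℕ) : Prop where
  j₂ : σ.Joins e₂ v₁ v₂
  j₃ : σ.Joins e₃ v₂ v₃
  j₄ : σ.Joins e₄ v₃ v₄
  j₅ : σ.Joins e₅ v₄ v₅
  a₂ : σ.at_ v₂ = {e₂, e₃}
  a₃ : σ.at_ v₃ = {e₃, e₄}
  a₄ : σ.at_ v₄ = {e₄, e₅}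
  n₂₃ : e₂ ≠ e₃
  n₃₄ : e₃ ≠ e₄
  n₄₅ : e₄ ≠ e₅

variable {σ : St c} {e₁ e₂ e₃ e₄ e₅ e₆ v₀ v₁ v₂ v₃ v₄ v₅ v₆ : ℕ} {n m : ℕ} {tri : Prop}

lemma mem_E_of_at {e v : ℕ} (h : e ∈ σ.at_ v) : e ∈ σ.E := (mem_at.1 h).1

lemma Center.mem (hC : Center σ e₂ e₃ e₄ e₅ v₁ v₂ v₃ v₄ v₅) :
    e₂ ∈ σ.E ∧ e₃ ∈ σ.E ∧ e₄ ∈ σ.E ∧ e₅ ∈ σ.E :=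
  ⟨mem_E_of_at (v := v₂) (by simp [hC.a₂]), mem_E_of_at (v := v₂) (by simp [hC.a₂]),
    mem_E_of_at (v := v₄) (by simp [hC.a₄]), mem_E_of_at (v := v₄) (by simp [hC.a₄])⟩

/-- Consecutive vertices differ because there are no loops, and vertices two steps apart because
there are no parallel edges. Coincidences three or more steps apart are left open; they distinguish
the configurations. -/
lemma Center.distinct (h : σ.WF n m) (hC : Center σ e₂ e₃ e₄ e₅ v₁ v₂ v₃ v₄ v₅) :
    v₁ ≠ v₂ ∧ v₂ ≠ v₃ ∧ v₃ ≠ v₄ ∧ v₄ ≠ v₅ ∧ v₂ ≠ v₄ ∧ v₁ ≠ v₃ ∧ v₃ ≠ v₅ ∧ e₂ ≠ e₄ ∧ e₃ ≠ e₅ := by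
  obtain ⟨m₂, m₃, m₄, m₅⟩ := hC.mem
  obtain ⟨j₂, j₃, j₄, j₅, a₂, a₃, a₄, n₂₃, n₃₄, n₄₅⟩ := hC
  have h12 := h.joins_ne m₂ j₂
  have h23 := h.joins_ne m₃ j₃
  have h34 := h.joins_ne m₄ j₄
  have h45 := h.joins_ne m₅ j₅
  have h24 : v₂ ≠ v₄ := by rintro rfl; exact n₃₄ (h.inj _ m₃ _ m₄ _ _ j₃ (joins_symm j₄))
  have h13 : v₁ ≠ v₃ := by rintro rfl; exact n₂₃ (h.inj _ m₂ _ m₃ _ _ j₂ (joins_symm j₃))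
  have h35 : v₃ ≠ v₅ := by rintro rfl; exact n₄₅ (h.inj _ m₄ _ m₅ _ _ j₄ (joins_symm j₅))
  refine ⟨h12, h23, h34, h45, h24, h13, h35, ?_, ?_⟩
  · rintro rfl
    rcases joins_eq j₂ j₄ with ⟨h1, h2⟩ | ⟨h1, h2⟩
    · exact h13 h1
    · exact h23 h2
  · rintro rfl
    rcases joins_eq j₃ j₅ with ⟨h1, h2⟩ | ⟨h1, h2⟩
    · exact h24 h1
    · exact h34 h2

/-- If the two outer edges coincide, the path closes up after three edges. -/
lemma Center.triangle (h : σ.WF n m) (hC : Center σ e₂ e₃ e₄ e₂ v₁ v₂ v₃ v₄ v₅) :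
    Step tri n m σ
      ((((σ.pay (triangleCost tri (σ.L e₃) (σ.L e₄) (σ.L e₂))).del e₃).del e₄).del e₂) := by
  obtain ⟨m₂, m₃, m₄, -⟩ := hC.mem
  obtain ⟨h12, h23, h34, h45, h24, h13, h35, n₂₄, -⟩ := hC.distinct h
  obtain ⟨j₂, j₃, j₄, j₅, a₂, a₃, a₄, n₂₃, n₃₄, n₄₅⟩ := hC
  have : v₁ = v₄ := by
    rcases joins_eq j₂ j₅ with ⟨h1, -⟩ | ⟨-, h2⟩
    · exact h1
    · exact absurd h2 h24
  subst this
  exact step_triangle h m₃ m₄ m₂ j₃ j₄ j₂ a₂ a₃ a₄ n₃₄ n₂₃.symm n₂₄.symm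

/-- If the outer edges differ but their outer ends coincide, the path closes up after four edges.
The common end must have degree two for the cycle to be a component. -/
lemma Center.cycle_four (h : σ.WF n m) (hC : Center σ e₂ e₃ e₄ e₅ v₁ v₂ v₃ v₄ v₁) (h25 : e₂ ≠ e₅)
    (hd : σ.deg v₁ = 2) :
    Step tri n m σ (((((σ.pay (cycleCost (σ.L e₃) [σ.L e₄, σ.L e₅, σ.L e₂])).del e₃).del e₄).del
      e₅).del e₂) := by
  obtain ⟨m₂, m₃, m₄, m₅⟩ := hC.mem
  obtain ⟨h12, h23, h34, h45, h24, h13, h35, n₂₄, n₃₅⟩ := hC.distinct h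
  obtain ⟨j₂, j₃, j₄, j₅, a₂, a₃, a₄, n₂₃, n₃₄, n₄₅⟩ := hC
  refine step_cycle_four h m₃ m₄ m₅ m₂ j₃ j₄ j₅ j₂ a₂ a₃ a₄
    (at_eq_pair (mem_at_right m₅ j₅) (mem_at_left m₂ j₂) h25.symm hd) ?_
  simp [n₃₄, n₃₅, n₂₃.symm, n₄₅, n₂₄.symm, h25.symm]

/-- The vertices and edges around a center are distinct if the path does not close up. -/
lemma Center.chain_aux (h : σ.WF n m) (hC : Center σ e₂ e₃ e₄ e₅ v₁ v₂ v₃ v₄ v₅) (h25 : e₂ ≠ e₅)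
    (h15 : v₁ ≠ v₅) : v₁ ≠ v₄ ∧ v₂ ≠ v₅ := by
  obtain ⟨m₂, m₃, m₄, m₅⟩ := hC.mem
  obtain ⟨h12, h23, h34, h45, h24, h13, h35, n₂₄, n₃₅⟩ := hC.distinct h
  obtain ⟨j₂, j₃, j₄, j₅, a₂, a₃, a₄, n₂₃, n₃₄, n₄₅⟩ := hC
  constructor
  · rintro rfl
    have := mem_at_left m₂ j₂
    rw [a₄] at this; simp only [Finset.mem_insert, Finset.mem_singleton] at this
    exact this.elim n₂₄ h25
  · rintro rfl
    have := mem_at_right m₅ j₅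
    rw [a₂] at this; simp only [Finset.mem_insert, Finset.mem_singleton] at this
    exact this.elim h25.symm n₃₅.symm

/-- If the same edge continues the path on both sides, it joins the outer ends and closes a cycle of
length five. -/
lemma Center.cycle_five (h : σ.WF n m) (hC : Center σ e₂ e₃ e₄ e₅ v₁ v₂ v₃ v₄ v₅) (h25 : e₂ ≠ e₅)
    (h15 : v₁ ≠ v₅) (a₁ : σ.at_ v₁ = {e₁, e₂}) (n₁₂ : e₁ ≠ e₂) (a₅ : σ.at_ v₅ = {e₅, e₁})
    (n₅₁ : e₅ ≠ e₁) :
    Step tri n m σ ((((((σ.pay (cycleCost (σ.L e₃) [σ.L e₄, σ.L e₅, σ.L e₁, σ.L e₂])).del e₃).del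
      e₄).del e₅).del e₁).del e₂) := by
  obtain ⟨h14, h2v5⟩ := hC.chain_aux h h25 h15
  obtain ⟨m₂, m₃, m₄, m₅⟩ := hC.mem
  obtain ⟨h12, h23, h34, h45, h24, h13, h35, n₂₄, n₃₅⟩ := hC.distinct h
  obtain ⟨j₂, j₃, j₄, j₅, a₂, a₃, a₄, n₂₃, n₃₄, n₄₅⟩ := hC
  have m₁ : e₁ ∈ σ.E := mem_E_of_at (v := v₁) (by simp [a₁])
  obtain ⟨z, hz⟩ := exists_joins (σ := σ) (e := e₁) (v := v₅) (by simp [a₅])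
  obtain ⟨y, hy⟩ := exists_joins (σ := σ) (e := e₁) (v := v₁) (by simp [a₁])
  have j₁ : σ.Joins e₁ v₅ v₁ := by
    rcases joins_eq hz hy with ⟨h1, -⟩ | ⟨-, h2⟩
    · exact absurd h1.symm h15
    · rwa [h2] at hz
  have n₁₃ : e₁ ≠ e₃ := by
    rintro rfl
    rcases joins_eq j₁ j₃ with ⟨p, q⟩ | ⟨p, q⟩
    · exact h13 q
    · exact h12 q
  have n₁₄ : e₁ ≠ e₄ := by
    rintro rfl
    rcases joins_eq j₁ j₄ with ⟨p, q⟩ | ⟨p, q⟩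
    · exact h14 q
    · exact h13 q
  refine step_cycle_five h m₃ m₄ m₅ m₁ m₂ j₃ j₄ j₅ j₁ j₂ a₂ a₃ a₄ a₅ a₁ ?_ h24 h35 h14.symm
    h2v5.symm h13
  simp [n₃₄, n₃₅, n₂₃.symm, n₄₅, n₂₄.symm, h25.symm, n₁₃.symm, n₁₄.symm, n₅₁, n₁₂]

/-- If different edges continue the path, no coincidence is left except possibly of the two extreme
vertices. Each of the five inner vertices has its two edges listed, so a further identification
would put a third edge there. -/
lemma Center.chain (h : σ.WF n m) (hC : Center σ e₂ e₃ e₄ e₅ v₁ v₂ v₃ v₄ v₅) (h25 : e₂ ≠ e₅)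
    (h15 : v₁ ≠ v₅) (a₁ : σ.at_ v₁ = {e₁, e₂}) (n₁₂ : e₁ ≠ e₂) (a₅ : σ.at_ v₅ = {e₅, e₆})
    (n₅₆ : e₅ ≠ e₆) (j₁ : σ.Joins e₁ v₀ v₁) (j₆ : σ.Joins e₆ v₅ v₆) (h16 : e₁ ≠ e₆) :
    Chain σ e₁ e₂ e₃ e₄ e₅ e₆ v₀ v₁ v₂ v₃ v₄ v₅ v₆ := by
  obtain ⟨h14, h2v5⟩ := hC.chain_aux h h25 h15
  obtain ⟨m₂, m₃, m₄, m₅⟩ := hC.mem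
  obtain ⟨h12, h23, h34, h45, h24, h13, h35, n₂₄, n₃₅⟩ := hC.distinct h
  obtain ⟨j₂, j₃, j₄, j₅, a₂, a₃, a₄, n₂₃, n₃₄, n₄₅⟩ := hC
  have m₁ : e₁ ∈ σ.E := mem_E_of_at (v := v₁) (by simp [a₁])
  have m₆ : e₆ ∈ σ.E := mem_E_of_at (v := v₅) (by simp [a₅])
  have hn : ∀ {e u v a b : ℕ}, σ.Joins e u v → σ.Joins e a b → v ≠ a → v ≠ b → False := by
    intro e u v a b h1 h2 h3 h4
    rcases joins_eq h1 h2 with ⟨p, q⟩ | ⟨p, q⟩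
    · exact h4 q
    · exact h3 q
  have k₁₃ : e₁ ≠ e₃ := by rintro rfl; exact hn j₁ j₃ h12 h13
  have k₁₄ : e₁ ≠ e₄ := by rintro rfl; exact hn j₁ j₄ h13 h14
  have k₁₅ : e₁ ≠ e₅ := by rintro rfl; exact hn j₁ j₅ h14 h15
  have k₆₂ : e₂ ≠ e₆ := by rintro rfl; exact hn (joins_symm j₆) j₂ h15.symm h2v5.symm
  have k₆₃ : e₃ ≠ e₆ := by rintro rfl; exact hn (joins_symm j₆) j₃ h2v5.symm h35.symm
  have k₆₄ : e₄ ≠ e₆ := by rintro rfl; exact hn (joins_symm j₆) j₄ h35.symm h45.symm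
  have b₀ : ∀ {v a b}, σ.at_ v = {a, b} → e₁ ≠ a → e₁ ≠ b → v₀ ≠ v := by
    rintro v a b hv h1 h2 rfl
    have := mem_at_left m₁ j₁
    rw [hv] at this; simp only [Finset.mem_insert, Finset.mem_singleton] at this
    exact this.elim h1 h2
  have b₆ : ∀ {v a b}, σ.at_ v = {a, b} → a ≠ e₆ → b ≠ e₆ → v₆ ≠ v := by
    rintro v a b hv h1 h2 rfl
    have := mem_at_right m₆ j₆
    rw [hv] at this; simp only [Finset.mem_insert, Finset.mem_singleton] at this
    exact this.elim h1.symm h2.symm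
  refine ⟨m₁, m₂, m₃, m₄, m₅, m₆, j₁, j₂, j₃, j₄, j₅, j₆, a₁, a₂, a₃, a₄, a₅, ?_, ?_, ?_, ?_⟩
  · simp [n₁₂, k₁₃, k₁₄, k₁₅, h16, n₂₃, n₂₄, h25, k₆₂, n₃₄, n₃₅, k₆₃, n₄₅, k₆₄, n₅₆]
  · simp [h12, h13, h14, h15, h23, h24, h2v5, h34, h35, h45]
  · simp [h.joins_ne m₁ j₁, b₀ a₂ n₁₂ k₁₃, b₀ a₃ k₁₃ k₁₄, b₀ a₄ k₁₄ k₁₅, b₀ a₅ k₁₅ h16]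
  · simp [(h.joins_ne m₆ j₆).symm, b₆ a₁ h16 k₆₂, b₆ a₂ k₆₂ k₆₃, b₆ a₃ k₆₃ k₆₄, b₆ a₄ k₆₄ n₅₆]

/-! ### Irreducible graphs -/

/-- No reduction applies at `v`. -/
def Stuck (σ : St c) (v : ℕ) : Prop :=
  (σ.deg v = 1 → ∃ e ∈ σ.E, ∃ w, σ.Joins e v w ∧ 3 ≤ σ.deg w) ∧
  (σ.deg v = 2 → ∃ e ∈ σ.E, ∃ w, σ.Joins e v w ∧
    (σ.deg w ≠ 2 ∨ ∃ f ∈ σ.E, ∃ x, σ.Joins f w x ∧ σ.deg x ≠ 2))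

end St

/-! ### The size of irreducible graphs -/

namespace St
variable {c : ℕ} {σ : St c} {n m : ℕ}

/-- Handshake count restricted to a vertex set S and an edge set F: an edge counts once for every
end in S. -/
lemma sum_card_at (h : σ.WF n m) (S F : Finset ℕ) (hF : F ⊆ σ.E) :
    ∑ v ∈ S, (σ.at_ v ∩ F).card =
      ∑ e ∈ F, ((if σ.U e ∈ S then 1 else 0) + if σ.W e ∈ S then 1 else 0) := by
  have h1 : ∀ v, (σ.at_ v ∩ F).card =
      ∑ e ∈ F, ((if σ.U e = v then 1 else 0) + if σ.W e = v then 1 else 0) := by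
    intro v
    have : σ.at_ v ∩ F = F.filter fun e => σ.U e = v ∨ σ.W e = v := by
      ext e; simp only [Finset.mem_inter, mem_at, Finset.mem_filter]
      exact ⟨fun h => ⟨h.2, h.1.2⟩, fun h => ⟨⟨hF h.1, h.2⟩, h.1⟩⟩
    rw [this, Finset.card_filter]
    refine Finset.sum_congr rfl fun e he => ?_
    have := h.ne e (hF he)
    by_cases h1 : σ.U e = v <;> by_cases h2 : σ.W e = v <;> simp [h1, h2]
    exact this (h1.trans h2.symm)
  simp only [h1]
  rw [Finset.sum_comm]
  refine Finset.sum_congr rfl fun e _ => ?_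
  rw [Finset.sum_add_distrib]
  simp

/-- The size of an irreducible graph in terms of the distance to maximum degree two. -/
theorem bounds_of_stuck (h : σ.WF n m) (hs : ∀ v < n, σ.Stuck v) {x : ℕ} (hx : σ.Del2 x) :
    σ.E.card ≤ 11 * x ∧ σ.live n ≤ 10 * x := by
  classical
  obtain ⟨D, hDE, hDx, hD⟩ := hx
  -- T and Lo are the high vertices and the low vertices that are not isolated. ET, EH and EL are
  -- the edges inside T, between T and Lo, and inside Lo.
  set T := (Finset.range n).filter fun v => 3 ≤ σ.deg v with hT
  set Lo := (Finset.range n).filter fun v => σ.deg v ≠ 0 ∧ σ.deg v ≤ 2 with hLo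
  have memT : ∀ {v}, v ∈ T ↔ v < n ∧ 3 ≤ σ.deg v := by simp [hT]
  have memLo : ∀ {v}, v ∈ Lo ↔ v < n ∧ σ.deg v ≠ 0 ∧ σ.deg v ≤ 2 := by simp [hLo]
  have dpos : ∀ {e v}, e ∈ σ.at_ v → σ.deg v ≠ 0 := fun he =>
    (Finset.card_pos.2 ⟨_, he⟩).ne'
  have hlive : σ.live n = T.card + Lo.card := by
    unfold live
    rw [← Finset.card_union_of_disjoint]
    · congr 1; ext v; simp only [Finset.mem_filter, Finset.mem_range, Finset.mem_union, hT, hLo]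
      omega
    · rw [Finset.disjoint_left]; intro v h1 h2; rw [memT] at h1; rw [memLo] at h2; omega
  have endsLo : ∀ e ∈ σ.E, (σ.U e ∈ Lo ↔ σ.U e ∉ T) ∧ (σ.W e ∈ Lo ↔ σ.W e ∉ T) := by
    intro e he
    have h1 := dpos (mem_at_left he (Or.inl ⟨rfl, rfl⟩))
    have h2 := dpos (mem_at_right he (Or.inl ⟨rfl, rfl⟩))
    have h3 := h.U_lt e he
    have h4 := h.W_lt e he
    rw [memLo, memT, memLo, memT]; omega
  set ET := σ.E.filter fun e => σ.U e ∈ T ∧ σ.W e ∈ T with hET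
  set EH := σ.E.filter fun e => ¬ (σ.U e ∈ T ↔ σ.W e ∈ T) with hEH
  set EL := σ.E.filter fun e => σ.U e ∉ T ∧ σ.W e ∉ T with hEL
  have cE : σ.E.card = ET.card + EH.card + EL.card := by
    simp only [hET, hEH, hEL, Finset.card_filter, ← Finset.sum_add_distrib]
    rw [Finset.card_eq_sum_ones]
    refine Finset.sum_congr rfl fun e _ => ?_
    by_cases h1 : σ.U e ∈ T <;> by_cases h2 : σ.W e ∈ T <;> simp [h1, h2]
  have sT : ∑ v ∈ T, σ.deg v = 2 * ET.card + EH.card := by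
    have := sum_card_at h T σ.E (Finset.Subset.refl _)
    have h0 : ∀ v, (σ.at_ v ∩ σ.E).card = σ.deg v := fun v => by
      rw [Finset.inter_eq_left.2 (show σ.at_ v ⊆ σ.E from Finset.filter_subset _ _)]; rfl
    simp only [h0] at this
    rw [this]
    simp only [hET, hEH, Finset.card_filter, Finset.mul_sum, ← Finset.sum_add_distrib]
    refine Finset.sum_congr rfl fun e _ => ?_
    by_cases h1 : σ.U e ∈ T <;> by_cases h2 : σ.W e ∈ T <;> simp [h1, h2]
  have sLo : ∑ v ∈ Lo, σ.deg v = 2 * EL.card + EH.card := by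
    have := sum_card_at h Lo σ.E (Finset.Subset.refl _)
    have h0 : ∀ v, (σ.at_ v ∩ σ.E).card = σ.deg v := fun v => by
      rw [Finset.inter_eq_left.2 (show σ.at_ v ⊆ σ.E from Finset.filter_subset _ _)]; rfl
    simp only [h0] at this
    rw [this]
    simp only [hEL, hEH, Finset.card_filter, Finset.mul_sum, ← Finset.sum_add_distrib]
    refine Finset.sum_congr rfl fun e he => ?_
    rw [if_congr (endsLo e he).1 rfl rfl, if_congr (endsLo e he).2 rfl rfl]
    by_cases h1 : σ.U e ∈ T <;> by_cases h2 : σ.W e ∈ T <;> simp [h1, h2]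
  set DT := D.filter fun e => σ.U e ∈ T ∧ σ.W e ∈ T with hDT
  set DH := D.filter fun e => ¬ (σ.U e ∈ T ↔ σ.W e ∈ T) with hDH
  have sD : ∑ v ∈ T, (σ.at_ v ∩ D).card = 2 * DT.card + DH.card := by
    rw [sum_card_at h T D hDE]
    simp only [hDT, hDH, Finset.card_filter, Finset.mul_sum, ← Finset.sum_add_distrib]
    refine Finset.sum_congr rfl fun e _ => ?_
    by_cases h1 : σ.U e ∈ T <;> by_cases h2 : σ.W e ∈ T <;> simp [h1, h2]
  have cD : DT.card + DH.card ≤ x := by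
    refine le_trans ?_ hDx
    rw [← Finset.card_union_of_disjoint]
    · exact Finset.card_le_card (Finset.union_subset (Finset.filter_subset _ _)
        (Finset.filter_subset _ _))
    · rw [Finset.disjoint_left]; intro e h1 h2; simp only [hDT, hDH, Finset.mem_filter] at h1 h2
      tauto
  -- Deleted edges inside T are themselves edges inside T. Without this the final count would only
  -- give 15 and 14 instead of 11 and 10.
  have cDT : DT.card ≤ ET.card :=
    Finset.card_le_card (Finset.filter_subset_filter _ hDE)
  -- Each high vertex keeps at most two edges after the deletion.
  have b1 : ∑ v ∈ T, σ.deg v ≤ 2 * T.card + (2 * DT.card + DH.card) := by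
    rw [← sD, mul_comm, ← smul_eq_mul, ← Finset.sum_const, ← Finset.sum_add_distrib]
    refine Finset.sum_le_sum fun v _ => ?_
    have := hD v
    have := Finset.card_inter_add_card_sdiff (σ.at_ v) D
    unfold deg; omega
  have b2 : 3 * T.card ≤ ∑ v ∈ T, σ.deg v := by
    rw [mul_comm, ← smul_eq_mul, ← Finset.sum_const]
    exact Finset.sum_le_sum fun v hv => (memT.1 hv).2
  have b3 : ∑ v ∈ Lo, σ.deg v ≤ 2 * Lo.card := by
    rw [mul_comm, ← smul_eq_mul, ← Finset.sum_const]
    exact Finset.sum_le_sum fun v hv => (memLo.1 hv).2.2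
  have memEH : ∀ {e u v}, e ∈ σ.E → σ.Joins e u v → u ∉ T → v ∈ T → e ∈ EH := by
    intro e u v he hj hu hv
    simp only [hEH, Finset.mem_filter]
    refine ⟨he, ?_⟩
    rcases hj with ⟨rfl, rfl⟩ | ⟨rfl, rfl⟩ <;> tauto
  have uniqEH : ∀ {e u u' v v'}, e ∈ EH → σ.Joins e u v → σ.Joins e u' v' → u ∉ T → u' ∉ T →
      u = u' := by
    intro e u u' v v' he hj hj' hu hu'
    simp only [hEH, Finset.mem_filter] at he
    rcases hj with ⟨rfl, rfl⟩ | ⟨rfl, rfl⟩ <;> rcases hj' with ⟨rfl, rfl⟩ | ⟨rfl, rfl⟩ <;> tauto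
  -- A neighbor of degree one would be a leaf at a vertex of degree two, which irreducibility
  -- forbids. So a neighbor of degree other than two is high.
  have leaf : ∀ {e v w}, e ∈ σ.E → σ.Joins e v w → σ.deg v = 2 → σ.deg w ≠ 2 → w ∈ T := by
    intro e v w he hj hv hw
    have hwn := (h.joins_lt he hj).2
    rw [memT]
    refine ⟨hwn, ?_⟩
    have h0 := dpos (mem_at_right he hj)
    by_contra hlt
    have h1 : σ.deg w = 1 := by omega
    obtain ⟨f, hf, z, hz, h3⟩ := (hs w hwn).1 h1
    obtain ⟨g, hg⟩ := Finset.card_eq_one.1 h1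
    have e1 := mem_at_right he hj
    have e2 := mem_at_left hf hz
    rw [hg, Finset.mem_singleton] at e1 e2
    subst e1 e2
    have := joins_other hz (joins_symm hj)
    subst this
    omega
  set Lo1 := Lo.filter fun v => ∃ e ∈ EH, e ∈ σ.at_ v with hLo1
  set Lo2 := Lo.filter fun v => ¬ ∃ e ∈ EH, e ∈ σ.at_ v with hLo2
  have cLo : Lo1.card + Lo2.card = Lo.card := Finset.card_filter_add_card_filter_not _
  -- Low vertices next to T are charged to such an edge, which has only one low end.
  have c1 : Lo1.card ≤ EH.card := by
    have hex : ∀ v, ∃ e, v ∈ Lo1 → e ∈ EH ∧ e ∈ σ.at_ v := by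
      intro v
      by_cases hv : v ∈ Lo1
      · obtain ⟨e, h1, h2⟩ := (Finset.mem_filter.1 hv).2
        exact ⟨e, fun _ => ⟨h1, h2⟩⟩
      · exact ⟨0, fun h => absurd h hv⟩
    choose f hf using hex
    refine Finset.card_le_card_of_injOn f (fun v hv => (hf v hv).1) ?_
    intro v hv v' hv' heq
    obtain ⟨h1, h2⟩ := hf v hv
    obtain ⟨h3, h4⟩ := hf v' hv'
    rw [← heq] at h3 h4
    obtain ⟨w, hw⟩ := exists_joins h2
    obtain ⟨w', hw'⟩ := exists_joins h4
    have hv := memLo.1 (Finset.mem_filter.1 hv).1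
    have hv' := memLo.1 (Finset.mem_filter.1 hv').1
    exact uniqEH h1 hw hw' (by rw [memT]; omega) (by rw [memT]; omega)
  -- The other low vertices have a neighbor w of degree two that is next to T, and are charged to
  -- the edge from w to T. This edge determines w, and w has only one further edge, so the charge is
  -- injective.
  have c2 : Lo2.card ≤ EH.card := by
    have hex : ∀ v, ∃ f e w x, v ∈ Lo2 → f ∈ EH ∧ e ∈ σ.E ∧ σ.Joins e v w ∧ σ.Joins f w x ∧
        e ≠ f ∧ σ.deg w = 2 := by
      intro v
      by_cases hv : v ∈ Lo2
      swap
      · exact ⟨0, 0, 0, 0, fun h => absurd h hv⟩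
      obtain ⟨hv1, hv2⟩ := Finset.mem_filter.1 hv
      have hvL := memLo.1 hv1
      have hvT : v ∉ T := by rw [memT]; omega
      -- A leaf hangs on T by irreducibility, so it would belong to the first kind.
      have hdeg : σ.deg v = 2 := by
        by_contra h2
        obtain ⟨e, he, w, hj, h3⟩ := (hs v hvL.1).1 (by omega)
        exact hv2 ⟨e, memEH he hj hvT (memT.2 ⟨(h.joins_lt he hj).2, h3⟩), mem_at_left he hj⟩
      obtain ⟨e, he, w, hj, h3⟩ := (hs v hvL.1).2 hdeg
      have hw : σ.deg w = 2 := by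
        by_contra hw
        exact hv2 ⟨e, memEH he hj hvT (leaf he hj hdeg hw), mem_at_left he hj⟩
      obtain ⟨f, hf, x, hfx, hx⟩ := h3.resolve_left (fun h => h hw)
      refine ⟨f, e, w, x, fun _ => ⟨memEH hf hfx (by rw [memT]; omega) (leaf hf hfx hw hx), he, hj,
        hfx, ?_, hw⟩⟩
      rintro rfl
      have := joins_other (joins_symm hj) hfx
      subst this
      exact hx hdeg
    choose f e w x hf using hex
    refine Finset.card_le_card_of_injOn f (fun v hv => (hf v hv).1) ?_
    intro v hv v' hv' heq
    obtain ⟨h1, h2, h3, h4, h5, h6⟩ := hf v hv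
    obtain ⟨k1, k2, k3, k4, k5, k6⟩ := hf v' hv'
    rw [← heq] at k1 k4 k5
    have hww : w v = w v' := uniqEH h1 h4 k4 (by rw [memT]; omega) (by rw [memT]; omega)
    rw [← hww] at k3 k4
    have hat := at_eq_pair (mem_at_right h2 h3)
      (mem_at_left (Finset.mem_filter.1 h1).1 h4) h5 h6
    have := mem_at_right k2 k3
    rw [hat] at this; simp only [Finset.mem_insert, Finset.mem_singleton] at this
    rcases this with h7 | h7
    · rw [h7] at k3
      exact joins_other (joins_symm h3) (joins_symm k3)
    · exact absurd h7 k5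
  -- Write t = ET, h = EH, p = DT, q = DH. Then |T| ≤ 2p + q, hence 2t + h ≤ 6p + 3q; further |Lo| ≤
  -- 2h and EL ≤ |Lo| - h/2. So |E| ≤ t + 5h/2 ≤ 15p + 15q/2 - 4t and |T| + |Lo| ≤ 14p + 7q - 4t.
  -- With t ≥ p and p + q ≤ x these are at most 11x and 10x.
  omega

end St

/-! ### Edge lists and instances -/

namespace St
variable {c : ℕ}

/-- The edge list `σ` is the instance `I`, with vertices named by `ι`. -/
structure Represents (σ : St c) (I : ELInstance c) (ι : Fin I.n → ℕ) : Prop where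
  inj : Function.Injective ι
  ends : ∀ e ∈ σ.E, ∃ u v, I.G.Adj u v ∧ σ.Joins e (ι u) (ι v) ∧ σ.L e = I.Ψ s(u, v)
  surj : ∀ u v, I.G.Adj u v → ∃ e ∈ σ.E, σ.Joins e (ι u) (ι v)
  uniq : ∀ e ∈ σ.E, ∀ f ∈ σ.E, ∀ u v, σ.Joins e u v → σ.Joins f u v → e = f
  k_eq : σ.k = I.k

/-- The names of the edges. -/
structure EdgeName (σ : St c) (I : ELInstance c) (ι : Fin I.n → ℕ) (ψ : Sym2 (Fin I.n) → ℕ) :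
    Prop where
  mem : ∀ u v, I.G.Adj u v → ψ s(u, v) ∈ σ.E
  joins : ∀ u v, I.G.Adj u v → σ.Joins (ψ s(u, v)) (ι u) (ι v)
  of_joins : ∀ e ∈ σ.E, ∀ u v, σ.Joins e u v →
    ∃ u' v', u = ι u' ∧ v = ι v' ∧ I.G.Adj u' v' ∧ ψ s(u', v') = e
  injOn : Set.InjOn ψ I.G.edgeSet
  list : ∀ q ∈ I.G.edgeSet, σ.L (ψ q) = I.Ψ q

variable {σ : St c} {I : ELInstance c} {ι : Fin I.n → ℕ} {ψ : Sym2 (Fin I.n) → ℕ}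

/-- Absence of parallel edges makes the number of an edge a function of its pair of ends, so
labelings can be transported between pairs and numbers. -/
lemma Represents.exists_name (h : Represents σ I ι) : ∃ ψ, EdgeName σ I ι ψ := by
  classical
  have hex : ∀ q : Sym2 (Fin I.n), ∃ e, q ∈ I.G.edgeSet → e ∈ σ.E ∧
      ∀ u v, q = s(u, v) → σ.Joins e (ι u) (ι v) := by
    intro q
    induction q using Sym2.ind with | _ u v =>
    by_cases hq : I.G.Adj u v
    · obtain ⟨e, he, hj⟩ := h.surj u v hq
      refine ⟨e, fun _ => ⟨he, fun a b hab => ?_⟩⟩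
      rcases Sym2.eq_iff.1 hab with ⟨rfl, rfl⟩ | ⟨rfl, rfl⟩
      · exact hj
      · exact joins_symm hj
    · exact ⟨0, fun h => absurd h hq⟩
  choose ψ hψ using hex
  have mem : ∀ u v, I.G.Adj u v → ψ s(u, v) ∈ σ.E := fun u v hq => (hψ s(u, v) hq).1
  have joins : ∀ u v, I.G.Adj u v → σ.Joins (ψ s(u, v)) (ι u) (ι v) :=
    fun u v hq => (hψ s(u, v) hq).2 u v rfl
  have hname : ∀ e ∈ σ.E, ∀ u v, σ.Joins e (ι u) (ι v) → I.G.Adj u v → ψ s(u, v) = e :=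
    fun e he u v hj ha => h.uniq _ (mem u v ha) e he _ _ (joins u v ha) hj
  refine ⟨ψ, mem, joins, ?_, ?_, ?_⟩
  · intro e he u v hj
    obtain ⟨a, b, hab, hj', -⟩ := h.ends e he
    rcases joins_eq hj hj' with ⟨p, q⟩ | ⟨p, q⟩
    · exact ⟨a, b, p, q, hab, hname e he a b hj' hab⟩
    · exact ⟨b, a, p, q, hab.symm, hname e he b a (joins_symm hj') hab.symm⟩
  · intro q hq r hr hqr
    induction q using Sym2.ind with | _ u v =>
    induction r using Sym2.ind with | _ a b =>
    have h1 := joins u v hq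
    rw [hqr] at h1
    rw [Sym2.eq_iff]
    rcases joins_eq h1 (joins a b hr) with ⟨p, q⟩ | ⟨p, q⟩
    · exact Or.inl ⟨h.inj p, h.inj q⟩
    · exact Or.inr ⟨h.inj p, h.inj q⟩
  · intro q hq
    induction q using Sym2.ind with | _ u v =>
    obtain ⟨a, b, hab, hj, hL⟩ := h.ends _ (mem u v hq)
    rw [hL]
    congr 1
    rw [Sym2.eq_iff]
    rcases joins_eq hj (joins u v hq) with ⟨p, q⟩ | ⟨p, q⟩
    · exact Or.inl ⟨h.inj p, h.inj q⟩
    · exact Or.inr ⟨h.inj p, h.inj q⟩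

lemma EdgeName.image (hψ : EdgeName σ I ι ψ) : ψ '' I.G.edgeSet = σ.E := by
  ext e
  constructor
  · rintro ⟨q, hq, rfl⟩
    induction q using Sym2.ind with | _ u v =>
    exact hψ.mem u v hq
  · intro he
    obtain ⟨a, b, -, -, hab, h⟩ := hψ.of_joins e he _ _ (Or.inl ⟨rfl, rfl⟩)
    exact ⟨s(a, b), hab, h⟩

lemma EdgeName.numEdges (hψ : EdgeName σ I ι ψ) : I.numEdges = σ.E.card := by
  unfold ELInstance.numEdges
  rw [← hψ.injOn.ncard_image, hψ.image, Set.ncard_coe_finset]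

lemma EdgeName.satisfying (hψ : EdgeName σ I ι ψ) {L : Labeling (Fin I.n) c}
    {x : ℕ → Option (Fin c)} (hx : ∀ q ∈ I.G.edgeSet, x (ψ q) = L q) :
    IsListSatisfying I.G I.Ψ L ↔ ∀ e ∈ σ.E, Allowed (σ.L e) (x e) := by
  constructor
  · intro hL e he
    have : e ∈ ψ '' I.G.edgeSet := by rw [hψ.image]; exact he
    obtain ⟨q, hq, rfl⟩ := this
    rw [hψ.list q hq, hx q hq]
    exact hL q hq
  · intro hL q hq
    have := hL (ψ q) (by
      have : ψ q ∈ (σ.E : Set ℕ) := by rw [← hψ.image]; exact ⟨q, hq, rfl⟩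
      exact this)
    rw [hψ.list q hq, hx q hq] at this
    exact this

lemma EdgeName.weak (hψ : EdgeName σ I ι ψ) {L : Labeling (Fin I.n) c}
    {x : ℕ → Option (Fin c)} (hx : ∀ q ∈ I.G.edgeSet, x (ψ q) = L q) :
    ((weakEdges I.G L).ncard : ℤ) = ∑ e ∈ σ.E, wt (x e) := by
  have h1 : ψ '' weakEdges I.G L = ↑(σ.E.filter fun e => x e = none) := by
    ext e
    simp only [Set.mem_image, weakEdges, Set.mem_ofPred_eq, Finset.coe_filter]
    constructor
    · rintro ⟨q, ⟨hq, hw⟩, rfl⟩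
      refine ⟨?_, by rw [hx q hq, hw]⟩
      have : ψ q ∈ (σ.E : Set ℕ) := by rw [← hψ.image]; exact ⟨q, hq, rfl⟩
      exact this
    · rintro ⟨he, hw⟩
      have : e ∈ ψ '' I.G.edgeSet := by rw [hψ.image]; exact he
      obtain ⟨q, hq, rfl⟩ := this
      exact ⟨q, ⟨hq, by rw [← hx q hq, hw]⟩, rfl⟩
  rw [← Set.InjOn.ncard_image (hψ.injOn.mono fun q hq => hq.1), h1, Set.ncard_coe_finset,
    Finset.card_filter]
  push_cast
  rfl

/-- With `tri` false the triangle clause is vacuous, and two edges conflict exactly if they are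
distinct and share an end. -/
lemma EdgeName.proper (hψ : EdgeName σ I ι ψ) {L : Labeling (Fin I.n) c}
    {x : ℕ → Option (Fin c)} (hx : ∀ q ∈ I.G.edgeSet, x (ψ q) = L q)
    (hι : Function.Injective ι) : IsProperLabeling I.G L ↔
    ∀ e ∈ σ.E, ∀ f ∈ σ.E, σ.Conf False e f → Compat (x e) (x f) := by
  constructor
  · rintro hL e he f hf ⟨u, v, w, huw, h1, h2, -⟩ i
    obtain ⟨u, v, rfl, rfl, hab, rfl⟩ := hψ.of_joins e he _ _ h1
    obtain ⟨v', w, hv, rfl, hab', rfl⟩ := hψ.of_joins f hf _ _ h2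
    obtain rfl := hι hv
    rw [hx _ hab, hx _ hab']
    refine hL _ hab _ hab' ?_ ⟨v, by simp, by simp⟩ i
    intro heq
    rcases Sym2.eq_iff.1 heq with ⟨p, q⟩ | ⟨p, q⟩
    · exact huw (congrArg ι (p.trans q))
    · exact huw (congrArg ι p)
  · rintro hL q hq r hr hne ⟨v, hv, hv'⟩ i
    obtain ⟨u, rfl⟩ := Sym2.mem_iff_exists.1 hv
    obtain ⟨w, rfl⟩ := Sym2.mem_iff_exists.1 hv'
    rw [← hx _ hq, ← hx _ hr]
    refine hL _ (hψ.mem _ _ hq) _ (hψ.mem _ _ hr) ⟨ι u, ι v, ι w, ?_, joins_symm (hψ.joins _ _ hq),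
      hψ.joins _ _ hr, False.elim⟩ i
    intro h
    exact hne (by rw [hι h])

/-- With `tri` true, two edges conflict exactly if they form an induced path on three vertices. -/
lemma EdgeName.stc (hψ : EdgeName σ I ι ψ) {L : Labeling (Fin I.n) c}
    {x : ℕ → Option (Fin c)} (hx : ∀ q ∈ I.G.edgeSet, x (ψ q) = L q)
    (hι : Function.Injective ι) : IsSTCLabeling I.G L ↔
    ∀ e ∈ σ.E, ∀ f ∈ σ.E, σ.Conf True e f → Compat (x e) (x f) := by
  constructor
  · rintro hL e he f hf ⟨u, v, w, huw, h1, h2, h3⟩ i ⟨hi, hi'⟩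
    obtain ⟨u, v, rfl, rfl, hab, rfl⟩ := hψ.of_joins e he _ _ h1
    obtain ⟨v', w, hv, rfl, hab', rfl⟩ := hψ.of_joins f hf _ _ h2
    obtain rfl := hι hv
    rw [hx _ hab] at hi
    rw [hx _ hab'] at hi'
    have := hL u v w (fun h => huw (congrArg ι h)) hab hab' i hi hi'
    exact h3 trivial _ (hψ.mem _ _ this) (hψ.joins _ _ this)
  · intro hL u v w huw huv hvw i hi hi'
    by_contra hn
    rw [← hx _ huv] at hi
    rw [← hx _ hvw] at hi'
    refine hL _ (hψ.mem _ _ huv) _ (hψ.mem _ _ hvw) ⟨ι u, ι v, ι w, fun h => huw (hι h),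
      hψ.joins _ _ huv, hψ.joins _ _ hvw, fun _ g hg hj => ?_⟩ i ⟨hi, hi'⟩
    obtain ⟨a, b, ha, hb, hab, -⟩ := hψ.of_joins g hg _ _ hj
    rw [← hι ha, ← hι hb] at hab
    exact hn hab

/-- Distinct edges have distinct numbers; numbers that name no edge get the weak label, which has no
effect. -/
lemma EdgeName.exists_lift (hψ : EdgeName σ I ι ψ) (L : Labeling (Fin I.n) c) :
    ∃ x : ℕ → Option (Fin c), ∀ q ∈ I.G.edgeSet, x (ψ q) = L q := by
  classical
  refine ⟨fun e => if h : ∃ q ∈ I.G.edgeSet, ψ q = e then L h.choose else none, fun q hq => ?_⟩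
  have h : ∃ r ∈ I.G.edgeSet, ψ r = ψ q := ⟨q, hq, rfl⟩
  simp only [h, dif_pos]
  rw [hψ.injOn h.choose_spec.1 hq h.choose_spec.2]

lemma Represents.yesECS (h : Represents σ I ι) : I.IsYesECS ↔ σ.Yes False := by
  obtain ⟨ψ, hψ⟩ := h.exists_name
  constructor
  · rintro ⟨L, h1, h2, h3⟩
    obtain ⟨x, hx⟩ := hψ.exists_lift L
    exact ⟨x, (hψ.satisfying hx).1 h2, (hψ.proper hx h.inj).1 h1, by
      rw [← hψ.weak hx, h.k_eq]; exact h3⟩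
  · rintro ⟨x, h1, h2, h3⟩
    have hx : ∀ q ∈ I.G.edgeSet, x (ψ q) = (fun q => x (ψ q)) q := fun _ _ => rfl
    exact ⟨_, (hψ.proper hx h.inj).2 h2, (hψ.satisfying hx).2 h1, by
      rw [hψ.weak hx, ← h.k_eq]; exact h3⟩

lemma Represents.yesMultiSTC (h : Represents σ I ι) : I.IsYesMultiSTC ↔ σ.Yes True := by
  obtain ⟨ψ, hψ⟩ := h.exists_name
  constructor
  · rintro ⟨L, h1, h2, h3⟩
    obtain ⟨x, hx⟩ := hψ.exists_lift L
    exact ⟨x, (hψ.satisfying hx).1 h2, (hψ.stc hx h.inj).1 h1, by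
      rw [← hψ.weak hx, h.k_eq]; exact h3⟩
  · rintro ⟨x, h1, h2, h3⟩
    have hx : ∀ q ∈ I.G.edgeSet, x (ψ q) = (fun q => x (ψ q)) q := fun _ _ => rfl
    exact ⟨_, (hψ.stc hx h.inj).2 h2, (hψ.satisfying hx).2 h1, by
      rw [hψ.weak hx, ← h.k_eq]; exact h3⟩

/-! ### The deletion distance -/

lemma exists_deletionSet {V : Type*} [Finite V] (G : SimpleGraph V) (t : ℕ) :
    ∃ D : Set (Sym2 V), IsEdgeDeletionSet G t D ∧ D.ncard = xi G t := by
  refine Nat.sInf_mem (s := {d | ∃ D : Set (Sym2 V), IsEdgeDeletionSet G t D ∧ D.ncard = d})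
    ⟨_, G.edgeSet, ⟨subset_rfl, fun v => ?_⟩, rfl⟩
  have : (G.deleteEdges G.edgeSet).neighborSet v = ∅ := by
    ext w; simp
  simp

/-- An optimal deletion set is carried over by the edge names. Numbers that name no vertex carry no
edges. -/
lemma Represents.del2 (h : Represents σ I ι) : σ.Del2 (xi I.G 2) := by
  classical
  obtain ⟨ψ, hψ⟩ := h.exists_name
  obtain ⟨D, ⟨hDE, hD⟩, hc⟩ := exists_deletionSet I.G 2
  have hDf : D.Finite := Set.toFinite D
  refine ⟨hDf.toFinset.image ψ, ?_, ?_, ?_⟩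
  · intro e he
    simp only [Finset.mem_image, Set.Finite.mem_toFinset] at he
    obtain ⟨q, hq, rfl⟩ := he
    have : ψ q ∈ (σ.E : Set ℕ) := by rw [← hψ.image]; exact ⟨q, hDE hq, rfl⟩
    exact this
  · refine Finset.card_image_le.trans ?_
    rw [← hc, Set.ncard_eq_toFinset_card D hDf]
  · intro v
    by_cases hv : ∃ v', ι v' = v
    · obtain ⟨v, rfl⟩ := hv
      refine le_trans ?_ (hD v)
      have hsub : ((σ.at_ (ι v) \ hDf.toFinset.image ψ : Finset ℕ) : Set ℕ) ⊆
          (fun w => ψ s(v, w)) '' ((I.G.deleteEdges D).neighborSet v) := by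
        intro e he
        have he := Finset.mem_sdiff.1 (Finset.mem_coe.1 he)
        obtain ⟨w, hw⟩ := exists_joins he.1
        obtain ⟨a, b, ha, rfl, hab, rfl⟩ := hψ.of_joins e (mem_E_of_at he.1) _ _ hw
        obtain rfl := h.inj ha
        refine ⟨b, ?_, rfl⟩
        rw [SimpleGraph.mem_neighborSet, SimpleGraph.deleteEdges_adj]
        refine ⟨hab, fun hin => he.2 ?_⟩
        rw [Finset.mem_image]
        exact ⟨_, hDf.mem_toFinset.2 hin, rfl⟩
      rw [← Set.ncard_coe_finset]
      exact (Set.ncard_le_ncard hsub (Set.toFinite _)).trans (Set.ncard_image_le (Set.toFinite _))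
    · have : σ.at_ v = ∅ := by
        rw [Finset.eq_empty_iff_forall_notMem]
        intro e he
        obtain ⟨w, hw⟩ := exists_joins he
        obtain ⟨a, b, ha, -⟩ := hψ.of_joins e (mem_E_of_at he) _ _ hw
        exact hv ⟨a, ha.symm⟩
      simp [this]

lemma Represents.xi_eq_zero (h : Represents σ I ι) (hd : ∀ v, σ.deg v ≤ 2) : xi I.G 2 = 0 := by
  obtain ⟨ψ, hψ⟩ := h.exists_name
  have : xi I.G 2 ≤ 0 := by
    refine Nat.sInf_le ⟨∅, ⟨by simp, fun v => le_trans ?_ (hd (ι v))⟩, by simp⟩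
    unfold deg
    rw [← Set.ncard_coe_finset, SimpleGraph.deleteEdges_empty]
    refine Set.ncard_le_ncard_of_injOn (fun w => ψ s(v, w)) ?_ ?_ (Set.toFinite _)
    · intro w hw
      exact mem_at_left (hψ.mem v w hw) (hψ.joins v w hw)
    · intro w hw w' hw' heq
      have := hψ.injOn (I.G.mem_edgeSet.2 hw) (I.G.mem_edgeSet.2 hw') heq
      rcases Sym2.eq_iff.1 this with ⟨-, p⟩ | ⟨p, q⟩
      · exact p
      · exact q.trans p
  omega

open Classical in
/-- The list of the edge with ends `q`. -/
noncomputable def listOf (σ : St c) {n : ℕ} (q : Sym2 (Fin n)) : Finset (Fin c) :=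
  if h : ∃ e ∈ σ.E, ∃ u v : Fin n, q = s(u, v) ∧ σ.Joins e u v then σ.L h.choose else ∅

/-- The instance given by an edge list. -/
noncomputable def toInstance (σ : St c) (n : ℕ) : ELInstance c where
  n := n
  G := SimpleGraph.fromRel fun u v => ∃ e ∈ σ.E, σ.Joins e u v
  Ψ := σ.listOf
  k := σ.k

lemma toInstance_adj {n m : ℕ} (h : σ.WF n m) (u v : Fin n) :
    (σ.toInstance n).G.Adj u v ↔ ∃ e ∈ σ.E, σ.Joins e u v := by
  change (SimpleGraph.fromRel _).Adj u v ↔ _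
  rw [SimpleGraph.fromRel_adj]
  constructor
  · rintro ⟨-, h | ⟨e, he, hj⟩⟩
    · exact h
    · exact ⟨e, he, joins_symm hj⟩
  · rintro ⟨e, he, hj⟩
    refine ⟨fun huv => h.joins_ne he hj (by rw [huv]), Or.inl ⟨e, he, hj⟩⟩

/-- `listOf` chooses some edge with the given ends; by uniqueness it is this one. -/
lemma toInstance_list {n m : ℕ} (h : σ.WF n m) {u v : Fin n} {e : ℕ} (he : e ∈ σ.E)
    (hj : σ.Joins e u v) : (σ.toInstance n).Ψ s(u, v) = σ.L e := by
  have hex : ∃ e ∈ σ.E, ∃ a b : Fin n, s(u, v) = s(a, b) ∧ σ.Joins e a b := ⟨e, he, u, v, rfl, hj⟩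
  change σ.listOf s(u, v) = _
  unfold listOf
  rw [dif_pos hex]
  obtain ⟨h1, a, b, h2, h3⟩ := hex.choose_spec
  rw [h.inj _ h1 e he a b h3]
  rcases Sym2.eq_iff.1 h2 with ⟨rfl, rfl⟩ | ⟨rfl, rfl⟩
  · exact hj
  · exact joins_symm hj

lemma represents_toInstance {n m : ℕ} (h : σ.WF n m) :
    Represents σ (σ.toInstance n) (fun v => (v : ℕ)) where
  inj := Fin.val_injective
  ends e he := by
    have hj : σ.Joins e (⟨σ.U e, h.U_lt e he⟩ : Fin n) (⟨σ.W e, h.W_lt e he⟩ : Fin n) :=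
      Or.inl ⟨rfl, rfl⟩
    exact ⟨_, _, (toInstance_adj h _ _).2 ⟨e, he, hj⟩, hj, (toInstance_list h he hj).symm⟩
  surj u v huv := (toInstance_adj h u v).1 huv
  uniq := h.inj
  k_eq := rfl

/-- A store holds the edge list `σ` with edges `0, …, m - 1`. -/
lemma encodes_toInstance {n m : ℕ} (h : σ.WF n m) (hE : σ.E = Finset.range m) (s : RAM.Store)
    (h0 : s.reg 0 = n) (h1 : s.reg 1 = m) (h2 : s.reg 2 = σ.k)
    (hU : ∀ e < m, s.arr 0 e = σ.U e) (hW : ∀ e < m, s.arr 1 e = σ.W e)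
    (hL : ∀ e < m, ∀ a : Fin c, s.arr (2 + a) e = if a ∈ σ.L e then 1 else 0) :
    Encodes s (σ.toInstance n) := by
  obtain ⟨ψ, hψ⟩ := (represents_toInstance h).exists_name
  have hnum : (σ.toInstance n).numEdges = m := by rw [hψ.numEdges, hE, Finset.card_range]
  refine ⟨h0, by rw [h1, hnum], h2, ?_⟩
  have hmem : ∀ i : Fin (σ.toInstance n).numEdges, (i : ℕ) ∈ σ.E := fun i => by
    rw [hE, Finset.mem_range]; have := i.2; omega
  have hj : ∀ i : Fin (σ.toInstance n).numEdges, σ.Joins i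
      (⟨σ.U i, h.U_lt i (hmem i)⟩ : Fin n) (⟨σ.W i, h.W_lt i (hmem i)⟩ : Fin n) :=
    fun _ => Or.inl ⟨rfl, rfl⟩
  let f : Fin (σ.toInstance n).numEdges → (σ.toInstance n).G.edgeSet := fun i =>
    ⟨s((⟨σ.U i, h.U_lt i (hmem i)⟩ : Fin n), (⟨σ.W i, h.W_lt i (hmem i)⟩ : Fin n)),
      (toInstance_adj h _ _).2 ⟨i, hmem i, hj i⟩⟩
  have hf : Function.Bijective f := by
    constructor
    · intro i j hij
      have hij : s((⟨σ.U i, h.U_lt i (hmem i)⟩ : Fin n), (⟨σ.W i, h.W_lt i (hmem i)⟩ : Fin n)) =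
        s((⟨σ.U j, h.U_lt j (hmem j)⟩ : Fin n), (⟨σ.W j, h.W_lt j (hmem j)⟩ : Fin n)) :=
        congrArg Subtype.val hij
      apply Fin.ext
      refine h.inj _ (hmem i) _ (hmem j) _ _ (hj i) ?_
      rcases Sym2.eq_iff.1 hij with ⟨p, q⟩ | ⟨p, q⟩
      · rw [p, q]; exact hj j
      · rw [p, q]; exact joins_symm (hj j)
    · rintro ⟨q, hq⟩
      induction q using Sym2.ind with | _ u v =>
      obtain ⟨e, he, hjuv⟩ := (toInstance_adj h u v).1 hq
      have he' := he
      rw [hE, Finset.mem_range, ← hnum] at he'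
      refine ⟨⟨e, he'⟩, Subtype.ext ?_⟩
      refine Sym2.eq_iff.2 ?_
      rcases joins_eq (hj ⟨e, he'⟩) hjuv with ⟨p, q⟩ | ⟨p, q⟩
      · exact Or.inl ⟨Fin.ext p, Fin.ext q⟩
      · exact Or.inr ⟨Fin.ext p, Fin.ext q⟩
  refine ⟨Equiv.ofBijective f hf, fun i => ⟨⟨_, _, rfl, ?_, ?_⟩, ?_⟩⟩
  · exact hU i (by have := i.2; omega)
  · exact hW i (by have := i.2; omega)
  · intro a
    rw [hL i (by have := i.2; omega) a]
    have : (σ.toInstance n).Ψ (Equiv.ofBijective f hf i) = σ.L i := toInstance_list h (hmem i) (hj i)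
    rw [this]

end St

/-! ## Program logic -/

namespace RAM

/-- The effect of a program without loops. -/
def Prog.eval : Prog → Store → Store
  | .skip, s => s
  | .assign x e, s => s.setReg x (e.eval s)
  | .write a i e, s => s.setArr a (i.eval s) (e.eval s)
  | .seq p q, s => q.eval (p.eval s)
  | .ite e₁ e₂ p q, s => if e₁.eval s ≤ e₂.eval s then p.eval s else q.eval s
  | .loop _ _ _, s => s

/-- A bound for the running time of a program without loops. -/
def Prog.bound : Prog → ℕ
  | .skip => 1
  | .assign _ e => e.cost + 1
  | .write _ i e => i.cost + e.cost + 1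
  | .seq p q => p.bound + q.bound
  | .ite e₁ e₂ p q => e₁.cost + e₂.cost + 1 + (p.bound + q.bound)
  | .loop _ _ _ => 0

/-- The program has no loops. -/
def Prog.Straight : Prog → Prop
  | .skip => True
  | .assign _ _ => True
  | .write _ _ _ => True
  | .seq p q => p.Straight ∧ q.Straight
  | .ite _ _ p q => p.Straight ∧ q.Straight
  | .loop _ _ _ => False

/-- Started on `s`, the program halts within `B` steps on a store with the property `Q`. -/
def Run (p : Prog) (s : Store) (B : ℕ) (Q : Store → Prop) : Prop :=
  ∃ t s', Exec p s t s' ∧ t ≤ B ∧ Q s'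

lemma Run.mono {p : Prog} {s : Store} {B B' : ℕ} {Q Q' : Store → Prop} (h : Run p s B Q)
    (hB : B ≤ B') (hQ : ∀ s', Q s' → Q' s') : Run p s B' Q' := by
  obtain ⟨t, s', h1, h2, h3⟩ := h
  exact ⟨t, s', h1, h2.trans hB, hQ _ h3⟩

/-- Reduces programs without loops to a function on stores and a constant time bound, so that only
the few loops need the operational semantics. -/
lemma run_straight {p : Prog} (hp : p.Straight) (s : Store) :
    Run p s p.bound (fun s' => s' = p.eval s) := by
  induction p generalizing s with
  | skip => exact ⟨_, _, .skip s, le_rfl, rfl⟩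
  | assign x e => exact ⟨_, _, .assign s x e, le_rfl, rfl⟩
  | write a i e => exact ⟨_, _, .write s a i e, le_rfl, rfl⟩
  | seq p q ihp ihq =>
    obtain ⟨t, s', h1, h2, rfl⟩ := ihp hp.1 s
    obtain ⟨t', s'', h1', h2', rfl⟩ := ihq hp.2 (p.eval s)
    exact ⟨_, _, .seq h1 h1', add_le_add h2 h2', rfl⟩
  | ite e₁ e₂ p q ihp ihq =>
    by_cases h : e₁.eval s ≤ e₂.eval s
    · obtain ⟨t, s', h1, h2, rfl⟩ := ihp hp.1 s
      exact ⟨_, _, .iteTrue h h1, by simp only [Prog.bound]; omega, by simp [Prog.eval, h]⟩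
    · obtain ⟨t, s', h1, h2, rfl⟩ := ihq hp.2 s
      exact ⟨_, _, .iteFalse h h1, by simp only [Prog.bound]; omega, by simp [Prog.eval, h]⟩
  | loop => exact hp.elim

lemma Run.seq {p q : Prog} {s : Store} {B B' : ℕ} {Q Q' : Store → Prop} (h : Run p s B Q)
    (h' : ∀ s', Q s' → Run q s' B' Q') : Run (.seq p q) s (B + B') Q' := by
  obtain ⟨t, s', h1, h2, h3⟩ := h
  obtain ⟨t', s'', h1', h2', h3'⟩ := h' s' h3
  exact ⟨_, _, .seq h1 h1', add_le_add h2 h2', h3'⟩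

/-- `for x < y do p`, with the bound `y` in a register. -/
def forLoop (x y : ℕ) (p : Prog) : Prog :=
  .loop (.add (.reg x) (.const 1)) (.reg y) (.seq p (.assign x (.add (.reg x) (.const 1))))

/-- The test x + 1 ≤ y takes five steps and the increment four, whence 9 per round and 5 for the
last test. The invariant must preserve the counter and the bound. -/
lemma run_forLoop {x y N : ℕ} {p : Prog} (hp : p.Straight) (Inv : ℕ → Store → Prop)
    (hI : ∀ i s, Inv i s → s.reg x = i ∧ s.reg y = N)
    (hstep : ∀ i s, i < N → Inv i s →
      Inv (i + 1) ((p.eval s).setReg x ((p.eval s).reg x + 1)))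
    {s : Store} (h0 : Inv 0 s) :
    Run (forLoop x y p) s ((p.bound + 9) * N + 5) (Inv N) := by
  suffices ∀ k i s, i + k = N → Inv i s →
      Run (forLoop x y p) s ((p.bound + 9) * k + 5) (Inv N) from this N 0 s (by omega) h0
  intro k
  induction k with
  | zero =>
    intro i s hi h
    obtain ⟨h1, h2⟩ := hI i s h
    have hiN : i = N := by omega
    subst hiN
    exact ⟨_, _, .loopStop (by simp [Expr.eval, h1, h2]), by simp [Expr.cost], h⟩
  | succ k ih =>
    intro i s hi h
    obtain ⟨h1, h2⟩ := hI i s h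
    obtain ⟨t, s', e1, e2, rfl⟩ := run_straight hp s
    obtain ⟨t', s'', e1', e2', e3'⟩ := ih (i + 1) _ (by omega) (hstep i s (by omega) h)
    have hc : (Expr.add (.reg x) (.const 1)).eval s ≤ (Expr.reg y).eval s := by
      simp only [Expr.eval, h1, h2]; omega
    refine ⟨_, _, .loopStep hc (.seq e1 (.assign _ _ _)) e1', ?_, e3'⟩
    simp only [Expr.cost, mul_add, add_mul] at *
    omega

/-- The invariant carries a natural number that drops in every round except the last, so there are
at most k + 1 rounds, each with a test of three steps. -/
lemma run_while {x : ℕ} {p : Prog} {B : ℕ} (Inv : ℕ → Store → Prop) (Q : Store → Prop)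
    (hI : ∀ k s, Inv k s → s.reg x = 1)
    (hstep : ∀ k s, Inv k s →
      Run p s B fun s' => (s'.reg x = 0 ∧ Q s') ∨ ∃ k' < k, Inv k' s')
    {k : ℕ} {s : Store} (h0 : Inv k s) :
    Run (.loop (.const 1) (.reg x) p) s ((B + 3) * (k + 1) + 3) Q := by
  induction k using Nat.strong_induction_on generalizing s with
  | _ k ih =>
    have h1 := hI k s h0
    have hc : (Expr.const 1).eval s ≤ (Expr.reg x).eval s := by simp [Expr.eval, h1]
    obtain ⟨t, s', e1, e2, ⟨h2, h3⟩ | ⟨k', hk, h3⟩⟩ := hstep k s h0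
    · refine ⟨_, _, .loopStep hc e1 (.loopStop (by simp [Expr.eval, h2])), ?_, h3⟩
      simp only [Expr.cost]
      nlinarith
    · obtain ⟨t', s'', e1', e2', e3'⟩ := ih k' hk h3
      refine ⟨_, _, .loopStep hc e1 e1', ?_, e3'⟩
      simp only [Expr.cost]
      have : (B + 3) * (k' + 1) + (B + 3) ≤ (B + 3) * (k + 1) := by nlinarith
      omega

@[simp] lemma setReg_reg (s : Store) (x y : ℕ) (z : ℤ) :
    (s.setReg x z).reg y = if y = x then z else s.reg y := by
  simp [Store.setReg, Function.update_apply]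

@[simp] lemma setReg_arr (s : Store) (x : ℕ) (z : ℤ) : (s.setReg x z).arr = s.arr := rfl

@[simp] lemma setArr_reg (s : Store) (a : ℕ) (i z : ℤ) : (s.setArr a i z).reg = s.reg := rfl

lemma setArr_arr (s : Store) (a b : ℕ) (i j z : ℤ) :
    (s.setArr a i z).arr b j = if b = a ∧ j = i then z else s.arr b j := by
  by_cases h : b = a
  · subst h; simp [Store.setArr, Function.update_apply]
  · simp [Store.setArr, h]

/-! ### Elementary changes of an edge list -/

/-- Delete the edge in register `x`. -/
def delP (c x : ℕ) : Prog :=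
  .seq (.write (c + 2) (.read 0 (.reg x)) (.sub (.read (c + 2) (.read 0 (.reg x))) (.const 1)))
  (.seq (.write (c + 2) (.read 1 (.reg x)) (.sub (.read (c + 2) (.read 1 (.reg x))) (.const 1)))
  (.seq (.write (c + 3) (.read 0 (.reg x)) (.sub (.read (c + 3) (.read 0 (.reg x))) (.reg x)))
  (.seq (.write (c + 3) (.read 1 (.reg x)) (.sub (.read (c + 3) (.read 1 (.reg x))) (.reg x)))
  (.write (c + 5) (.reg x) (.const 0)))))

/-- Insert the edge in register `x` between the vertices in registers `u` and `w`. -/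
def addP (c x u w : ℕ) : Prog :=
  .seq (.write 0 (.reg x) (.reg u))
  (.seq (.write 1 (.reg x) (.reg w))
  (.seq (.write (c + 2) (.reg u) (.add (.read (c + 2) (.reg u)) (.const 1)))
  (.seq (.write (c + 2) (.reg w) (.add (.read (c + 2) (.reg w)) (.const 1)))
  (.seq (.write (c + 3) (.reg u) (.add (.read (c + 3) (.reg u)) (.reg x)))
  (.seq (.write (c + 3) (.reg w) (.add (.read (c + 3) (.reg w)) (.reg x)))
  (.seq (.write (c + 4) (.reg u) (.reg x))
  (.seq (.write (c + 4) (.reg w) (.reg x))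
  (.write (c + 5) (.reg x) (.const 1)))))))))

/-- Write the list `l` restricted to the colors `as` for the edge in register `x`. -/
def setListP {c : ℕ} (x : ℕ) (l : Finset (Fin c)) : List (Fin c) → Prog
  | [] => .skip
  | a :: as => .seq (.write (2 + a) (.reg x) (.const (if a ∈ l then 1 else 0))) (setListP x l as)

/-- Write the list `l` for the edge in register `x`. -/
def setLP {c : ℕ} (x : ℕ) (l : Finset (Fin c)) : Prog := setListP x l (List.finRange c)

/-- Lower the budget. -/
def payP (d : ℤ) : Prog := .assign 2 (.sub (.reg 2) (.const d))

/-- Continue with the program for the list of the edge in register `x`. -/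
def dispatchP {c : ℕ} (x : ℕ) : List (Fin c) → Finset (Fin c) → (Finset (Fin c) → Prog) → Prog
  | [], l, K => K l
  | a :: as, l, K => .ite (.const 1) (.read (2 + a) (.reg x)) (dispatchP x as (insert a l) K)
      (dispatchP x as l K)

/-- Continue with the program for the list of the edge in register `x`. -/
def dispatch {c : ℕ} (x : ℕ) (K : Finset (Fin c) → Prog) : Prog :=
  dispatchP x (List.finRange c) ∅ K

section
variable {c : ℕ}

lemma delP_straight (x : ℕ) : (delP c x).Straight := by simp [delP, Prog.Straight]
lemma addP_straight (x u w : ℕ) : (addP c x u w).Straight := by simp [addP, Prog.Straight]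
lemma setLP_straight (x : ℕ) (l : Finset (Fin c)) : (setLP x l).Straight := by
  unfold setLP
  induction List.finRange c with
  | nil => simp [setListP, Prog.Straight]
  | cons a as ih => exact ⟨trivial, ih⟩

lemma dispatchP_straight (x : ℕ) (as : List (Fin c)) (l : Finset (Fin c))
    (K : Finset (Fin c) → Prog) (hK : ∀ l, (K l).Straight) : (dispatchP x as l K).Straight := by
  induction as generalizing l with
  | nil => exact hK l
  | cons a as ih => exact ⟨ih _, ih _⟩

lemma dispatch_straight (x : ℕ) (K : Finset (Fin c) → Prog) (hK : ∀ l, (K l).Straight) :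
    (dispatch x K).Straight := dispatchP_straight _ _ _ _ hK

/-- Each color is tested on one bit of the stored list, so the tree reaches the leaf built for the
actual list. All leaves are part of the program text, so nonconstructive constants are admissible
there. -/
lemma dispatchP_eval (x : ℕ) (as : List (Fin c)) (l : Finset (Fin c))
    (K : Finset (Fin c) → Prog) (s : Store) : (dispatchP x as l K).eval s =
      (K (l ∪ as.toFinset.filter fun a => 1 ≤ s.arr (2 + a) (s.reg x))).eval s := by
  induction as generalizing l with
  | nil => simp [dispatchP]
  | cons a as ih =>
    by_cases h : 1 ≤ s.arr (2 + a) (s.reg x)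
    · have h0 : (dispatchP x (a :: as) l K).eval s = (dispatchP x as (insert a l) K).eval s :=
        if_pos h
      rw [h0, ih]
      refine congrArg (fun l => (K l).eval s) ?_
      ext b
      simp only [Finset.mem_union, Finset.mem_insert, Finset.mem_filter, List.mem_toFinset,
        List.mem_cons]
      grind
    · have h0 : (dispatchP x (a :: as) l K).eval s = (dispatchP x as l K).eval s := if_neg h
      rw [h0, ih]
      refine congrArg (fun l => (K l).eval s) ?_
      ext b
      simp only [Finset.mem_union, Finset.mem_filter, List.mem_toFinset, List.mem_cons]
      grind

@[simp] lemma delP_reg (x : ℕ) (s : Store) : ((delP c x).eval s).reg = s.reg := by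
  simp [delP, Prog.eval]
@[simp] lemma addP_reg (x u w : ℕ) (s : Store) : ((addP c x u w).eval s).reg = s.reg := by
  simp [addP, Prog.eval]

lemma setListP_reg (x : ℕ) (l : Finset (Fin c)) (as : List (Fin c)) (s : Store) :
    ((setListP x l as).eval s).reg = s.reg := by
  induction as generalizing s with
  | nil => rfl
  | cons a as ih => simp [setListP, Prog.eval, ih]

@[simp] lemma setLP_reg (x : ℕ) (l : Finset (Fin c)) (s : Store) :
    ((setLP x l).eval s).reg = s.reg := setListP_reg _ _ _ _

lemma setListP_arr (x : ℕ) (l : Finset (Fin c)) (as : List (Fin c)) (s : Store) (b : ℕ) (j : ℤ) :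
    ((setListP x l as).eval s).arr b j =
      if j = s.reg x ∧ ∃ a ∈ as, b = 2 + a then (if ∃ a ∈ l, b = 2 + (a : ℕ) then 1 else 0)
      else s.arr b j := by
  induction as generalizing s with
  | nil => simp [setListP, Prog.eval]
  | cons a as ih =>
    simp only [setListP, Prog.eval, ih, setArr_reg, setArr_arr, Expr.eval]
    by_cases hj : j = s.reg x
    · by_cases h1 : ∃ a ∈ as, b = 2 + (a : ℕ)
      · have h2 : ∃ a' ∈ a :: as, b = 2 + (a' : ℕ) := by
          obtain ⟨a', h, h'⟩ := h1; exact ⟨a', by simp [h], h'⟩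
        simp only [hj, h1, h2, and_self, if_true]
      · by_cases h2 : b = 2 + (a : ℕ)
        · have h3 : ∃ a' ∈ a :: as, b = 2 + (a' : ℕ) := ⟨a, by simp, h2⟩
          have h4 : (∃ a ∈ l, b = 2 + (a : ℕ)) ↔ a ∈ l := by
            constructor
            · rintro ⟨a', h, h'⟩
              have : a' = a := Fin.ext (by omega)
              rwa [← this]
            · exact fun h => ⟨a, h, h2⟩
          rw [if_neg (fun h => h1 h.2), if_pos (And.intro h2 hj), if_pos (And.intro hj h3)]
          simp only [h4]
        · have h3 : ¬ ∃ a' ∈ a :: as, b = 2 + (a' : ℕ) := by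
            rintro ⟨a', h, h'⟩
            rcases List.mem_cons.1 h with rfl | h
            · exact h2 h'
            · exact h1 ⟨a', h, h'⟩
          simp only [h1, h2, h3, and_false, false_and, if_false]
    · simp [hj]

lemma setLP_arr_list (x : ℕ) (l : Finset (Fin c)) (s : Store) (a : Fin c) (j : ℤ) :
    ((setLP x l).eval s).arr (2 + a) j =
      if j = s.reg x then (if a ∈ l then 1 else 0) else s.arr (2 + a) j := by
  unfold setLP
  rw [setListP_arr]
  have h1 : ∃ a' ∈ List.finRange c, 2 + (a : ℕ) = 2 + (a' : ℕ) := ⟨a, by simp, rfl⟩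
  have h2 : (∃ a' ∈ l, 2 + (a : ℕ) = 2 + (a' : ℕ)) ↔ a ∈ l := by
    constructor
    · rintro ⟨a', h, h'⟩
      have : a' = a := Fin.ext (by omega)
      rwa [← this]
    · exact fun h => ⟨a, h, rfl⟩
  simp only [h1, h2, and_true]

lemma setLP_arr_other (x : ℕ) (l : Finset (Fin c)) (s : Store) (b : ℕ) (hb : b < 2 ∨ c + 2 ≤ b)
    (j : ℤ) : ((setLP x l).eval s).arr b j = s.arr b j := by
  unfold setLP
  rw [setListP_arr, if_neg]
  rintro ⟨-, a, -, h⟩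
  have := a.2
  omega

@[simp] lemma payP_reg (d : ℤ) (s : Store) (y : ℕ) :
    ((payP d).eval s).reg y = if y = 2 then s.reg 2 - d else s.reg y := by
  simp [payP, Prog.eval, Expr.eval]

@[simp] lemma payP_arr (d : ℤ) (s : Store) : ((payP d).eval s).arr = s.arr := rfl

end

/-! ### The invariant between stores and edge lists -/

/-- The store `s` holds the edge list `σ` and its vertex degrees, for every vertex the sum of the
incident edges, and for every vertex of degree two an incident edge. -/
structure Rep {c : ℕ} (n m : ℕ) (s : Store) (σ : St c) : Prop where
  r0 : s.reg 0 = n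
  r1 : s.reg 1 = m
  r2 : s.reg 2 = σ.k
  U : ∀ e ∈ σ.E, s.arr 0 e = σ.U e
  W : ∀ e ∈ σ.E, s.arr 1 e = σ.W e
  L : ∀ e < m, ∀ a : Fin c, s.arr (2 + a) e = if a ∈ σ.L e then 1 else 0
  alive : ∀ e < m, s.arr (c + 5) e = if e ∈ σ.E then 1 else 0
  deg : ∀ v < n, s.arr (c + 2) v = σ.deg v
  sum : ∀ v < n, s.arr (c + 3) v = ∑ e ∈ σ.at_ v, (e : ℤ)
  inc : ∀ v < n, σ.deg v = 2 → ∃ e ∈ σ.at_ v, s.arr (c + 4) v = e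

section
variable {c n m : ℕ} {s : Store} {σ : St c} {e x : ℕ}

lemma Rep.setReg (h : Rep n m s σ) {x : ℕ} (hx : 3 ≤ x) (z : ℤ) : Rep n m (s.setReg x z) σ where
  r0 := by simpa [show (0 : ℕ) ≠ x by omega] using h.r0
  r1 := by simpa [show (1 : ℕ) ≠ x by omega] using h.r1
  r2 := by simpa [show (2 : ℕ) ≠ x by omega] using h.r2
  U := h.U
  W := h.W
  L := h.L
  alive := h.alive
  deg := h.deg
  sum := h.sum
  inc := h.inc

lemma Rep.dispatch_eval (h : Rep n m s σ) (hx : s.reg x = e) (he : e < m)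
    (K : Finset (Fin c) → Prog) : (dispatch x K).eval s = (K (σ.L e)).eval s := by
  unfold dispatch
  rw [dispatchP_eval]
  congr 2
  ext a
  simp only [Finset.empty_union, Finset.mem_filter, List.mem_toFinset, List.mem_finRange, true_and,
    hx, h.L e he]
  split_ifs <;> simp [*]

lemma Rep.pay (h : Rep n m s σ) (d : ℤ) : Rep n m ((payP d).eval s) (σ.pay d) where
  r0 := by simpa using h.r0
  r1 := by simpa using h.r1
  r2 := by simpa using h.r2
  U := h.U
  W := h.W
  L := h.L
  alive := h.alive
  deg := h.deg
  sum := h.sum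
  inc := h.inc

lemma Rep.setL (h : Rep n m s σ) (hx : s.reg x = e) (l : Finset (Fin c)) :
    Rep n m ((setLP x l).eval s) (σ.setL e l) where
  r0 := by simpa using h.r0
  r1 := by simpa using h.r1
  r2 := by simpa using h.r2
  U f hf := by rw [setLP_arr_other _ _ _ _ (by omega)]; exact h.U f hf
  W f hf := by rw [setLP_arr_other _ _ _ _ (by omega)]; exact h.W f hf
  L f hf a := by
    rw [setLP_arr_list, hx, h.L f hf]
    by_cases hfe : f = e
    · subst hfe; simp
    · simp [hfe]
  alive f hf := by rw [setLP_arr_other _ _ _ _ (by omega)]; exact h.alive f hf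
  deg v hv := by rw [setLP_arr_other _ _ _ _ (by omega)]; exact h.deg v hv
  sum v hv := by rw [setLP_arr_other _ _ _ _ (by omega)]; exact h.sum v hv
  inc v hv hd := by rw [setLP_arr_other _ _ _ _ (by omega)]; exact h.inc v hv hd

/-- The array of sample edges is not updated. This is sound because the ends have degree at most two
before the deletion, hence at most one afterwards, and samples are promised only at degree exactly
two. -/
lemma Rep.del (h : Rep n m s σ) (hw : σ.WF n m) (hx : s.reg x = e) (he : e ∈ σ.E)
    (hd : ∀ v, e ∈ σ.at_ v → σ.deg v ≤ 2) : Rep n m ((delP c x).eval s) (σ.del e) := by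
  have hU := h.U e he
  have hW := h.W e he
  have hUW := hw.ne e he
  have hmem : ∀ v, e ∈ σ.at_ v ↔ v = σ.U e ∨ v = σ.W e := fun v => by
    rw [St.mem_at]; constructor
    · rintro ⟨-, h | h⟩ <;> simp [h]
    · rintro (rfl | rfl) <;> simp [he]
  have hcast : ∀ {a b : ℕ}, ((a : ℤ) = b) ↔ a = b := Nat.cast_inj
  refine ⟨by simpa using h.r0, by simpa using h.r1, by simpa using h.r2, ?_, ?_, ?_, ?_, ?_, ?_, ?_⟩
  · intro f hf
    change _ = ((σ.U f : ℕ) : ℤ)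
    simpa [delP, Prog.eval, setArr_arr] using h.U f (Finset.mem_of_mem_erase hf)
  · intro f hf
    change _ = ((σ.W f : ℕ) : ℤ)
    simpa [delP, Prog.eval, setArr_arr] using h.W f (Finset.mem_of_mem_erase hf)
  · intro f hf a
    have := a.2
    have h1 : 2 + (a : ℕ) ≠ c + 2 := by omega
    have h2 : 2 + (a : ℕ) ≠ c + 3 := by omega
    have h3 : 2 + (a : ℕ) ≠ c + 5 := by omega
    change _ = if a ∈ σ.L f then (1 : ℤ) else 0
    simpa [delP, Prog.eval, setArr_arr, h1, h2, h3] using h.L f hf a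
  · intro f hf
    by_cases hfe : f = e
    · subst hfe; simp [delP, Prog.eval, setArr_arr, Expr.eval, hx]
    · simpa [delP, Prog.eval, setArr_arr, Expr.eval, hx, hfe] using h.alive f hf
  · intro v hv
    have key : ((delP c x).eval s).arr (c + 2) v =
        s.arr (c + 2) v - if v = σ.U e ∨ v = σ.W e then 1 else 0 := by
      by_cases h1 : v = σ.U e
      · subst h1
        simp [delP, Prog.eval, setArr_arr, Expr.eval, hx, hU, hW, hUW]
      · by_cases h2 : v = σ.W e
        · subst h2
          simp [delP, Prog.eval, setArr_arr, Expr.eval, hx, hU, hW, h1]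
        · simp [delP, Prog.eval, setArr_arr, Expr.eval, hx, hU, hW, h1, h2]
    rw [key, h.deg v hv]
    unfold St.deg
    rw [St.del_at]
    split_ifs with h1
    · have h2 := (hmem v).2 h1
      rw [Finset.card_erase_of_mem h2]
      have := Finset.card_pos.2 ⟨e, h2⟩
      push_cast [this]
      omega
    · rw [Finset.erase_eq_of_notMem (fun h2 => h1 ((hmem v).1 h2))]; simp
  · intro v hv
    have key : ((delP c x).eval s).arr (c + 3) v =
        s.arr (c + 3) v - if v = σ.U e ∨ v = σ.W e then (e : ℤ) else 0 := by
      by_cases h1 : v = σ.U e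
      · subst h1
        simp [delP, Prog.eval, setArr_arr, Expr.eval, hx, hU, hW, hUW]
      · by_cases h2 : v = σ.W e
        · subst h2
          simp [delP, Prog.eval, setArr_arr, Expr.eval, hx, hU, hW, h1]
        · simp [delP, Prog.eval, setArr_arr, Expr.eval, hx, hU, hW, h1, h2]
    rw [key, h.sum v hv, St.del_at]
    split_ifs with h1
    · rw [← Finset.sum_erase_add _ _ ((hmem v).2 h1)]; ring
    · rw [Finset.erase_eq_of_notMem (fun h2 => h1 ((hmem v).1 h2))]; simp
  · intro v hv hdv
    by_cases h1 : e ∈ σ.at_ v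
    · have h2 := hd v h1
      unfold St.deg at hdv h2
      rw [St.del_at, Finset.card_erase_of_mem h1] at hdv
      omega
    · have h2 : (σ.del e).at_ v = σ.at_ v := by
        rw [St.del_at, Finset.erase_eq_of_notMem h1]
      unfold St.deg at hdv
      rw [h2] at hdv ⊢
      simpa [delP, Prog.eval, setArr_arr] using h.inc v hv hdv

/-- The new edge becomes the sample edge of both its ends, so a vertex that reaches degree two by
the insertion has a valid one. -/
lemma Rep.add (h : Rep n m s σ) {u w xu xw : ℕ} (hx : s.reg x = e) (hu : s.reg xu = u)
    (hw : s.reg xw = w) (he : e ∉ σ.E) (huw : u ≠ w) :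
    Rep n m ((addP c x xu xw).eval s) (σ.add e u w) := by
  have hnat : ∀ v, e ∉ σ.at_ v := fun v h => he (St.mem_E_of_at h)
  refine ⟨by simpa using h.r0, by simpa using h.r1, by simpa using h.r2, ?_, ?_, ?_, ?_, ?_, ?_, ?_⟩
  · intro f hf
    by_cases hfe : f = e
    · subst hfe; simp [addP, Prog.eval, setArr_arr, Expr.eval, hx, hu, St.add]
    · simpa [addP, Prog.eval, setArr_arr, Expr.eval, hx, hfe, St.add] using
        h.U f (by simpa [hfe] using hf)
  · intro f hf
    by_cases hfe : f = e
    · subst hfe; simp [addP, Prog.eval, setArr_arr, Expr.eval, hx, hw, St.add]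
    · simpa [addP, Prog.eval, setArr_arr, Expr.eval, hx, hfe, St.add] using
        h.W f (by simpa [hfe] using hf)
  · intro f hf a
    have := a.2
    have h0 : 2 + (a : ℕ) ≠ 0 := by omega
    have h0' : 2 + (a : ℕ) ≠ 1 := by omega
    have h1 : 2 + (a : ℕ) ≠ c + 2 := by omega
    have h2 : 2 + (a : ℕ) ≠ c + 3 := by omega
    have h3 : 2 + (a : ℕ) ≠ c + 5 := by omega
    have h4 : 2 + (a : ℕ) ≠ c + 4 := by omega
    change _ = if a ∈ σ.L f then (1 : ℤ) else 0
    simpa [addP, Prog.eval, setArr_arr, h0, h0', h1, h2, h3, h4] using h.L f hf a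
  · intro f hf
    by_cases hfe : f = e
    · subst hfe; simp [addP, Prog.eval, setArr_arr, Expr.eval, hx]
    · simpa [addP, Prog.eval, setArr_arr, Expr.eval, hx, hfe] using h.alive f hf
  · intro v hv
    have key : ((addP c x xu xw).eval s).arr (c + 2) v =
        s.arr (c + 2) v + if v = u ∨ v = w then 1 else 0 := by
      by_cases h1 : v = u
      · subst h1
        simp [addP, Prog.eval, setArr_arr, Expr.eval, hu, hw, huw]
      · by_cases h2 : v = w
        · subst h2
          simp [addP, Prog.eval, setArr_arr, Expr.eval, hu, hw, h1]
        · simp [addP, Prog.eval, setArr_arr, Expr.eval, hu, hw, h1, h2]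
    rw [key, h.deg v hv]
    unfold St.deg
    rw [St.add_at he]
    split_ifs with h1
    · rw [Finset.card_insert_of_notMem (hnat v)]; push_cast; rfl
    · simp
  · intro v hv
    have key : ((addP c x xu xw).eval s).arr (c + 3) v =
        s.arr (c + 3) v + if v = u ∨ v = w then (e : ℤ) else 0 := by
      by_cases h1 : v = u
      · subst h1
        simp [addP, Prog.eval, setArr_arr, Expr.eval, hu, hw, huw, hx]
      · by_cases h2 : v = w
        · subst h2
          simp [addP, Prog.eval, setArr_arr, Expr.eval, hu, hw, h1, hx]
        · simp [addP, Prog.eval, setArr_arr, Expr.eval, hu, hw, h1, h2]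
    rw [key, h.sum v hv, St.add_at he]
    split_ifs with h1
    · rw [Finset.sum_insert (hnat v)]; ring
    · simp
  · intro v hv hdv
    unfold St.deg at hdv
    rw [St.add_at he] at hdv ⊢
    by_cases h1 : v = u ∨ v = w
    · refine ⟨e, by simp [h1], ?_⟩
      rcases h1 with rfl | rfl
      · simp [addP, Prog.eval, setArr_arr, Expr.eval, hx, hu, hw]
      · simp [addP, Prog.eval, setArr_arr, Expr.eval, hx, hu, hw]
    · rw [if_neg h1] at hdv ⊢
      push Not at h1
      simpa [addP, Prog.eval, setArr_arr, Expr.eval, hx, hu, hw, h1] using h.inc v hv hdv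

end

end RAM

/-! ## One reduction attempt -/

namespace St
variable {c : ℕ} {σ : St c} {e f u v w : ℕ} {n m : ℕ}

lemma deg_del_le : (σ.del f).deg v ≤ σ.deg v := by
  unfold deg; rw [del_at]; exact Finset.card_erase_le

/-- Both ends of `e` have degree at most two. -/
def Low (σ : St c) (e : ℕ) : Prop := ∀ v, e ∈ σ.at_ v → σ.deg v ≤ 2

lemma Low.del (h : σ.Low e) : (σ.del f).Low e := fun v hv =>
  deg_del_le.trans (h v (by rw [del_at] at hv; exact Finset.mem_of_mem_erase hv))

lemma low_of_joins (hj : σ.Joins e u w) (hu : σ.deg u ≤ 2) (hw : σ.deg w ≤ 2) : σ.Low e := by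
  intro v hv
  obtain ⟨x, hx⟩ := exists_joins hv
  rcases joins_eq hx hj with ⟨rfl, -⟩ | ⟨rfl, -⟩ <;> assumption

lemma exists_at_eq_pair (he : e ∈ σ.at_ v) (hd : σ.deg v = 2) : ∃ f, σ.at_ v = {e, f} ∧ e ≠ f := by
  obtain ⟨f, hf⟩ : ∃ f, f ∈ (σ.at_ v).erase e := by
    apply Finset.card_pos.1
    rw [Finset.card_erase_of_mem he]
    unfold deg at hd
    omega
  rw [Finset.mem_erase] at hf
  exact ⟨f, at_eq_pair he hf.2 hf.1.symm hd, hf.1.symm⟩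

lemma at_eq_singleton (he : e ∈ σ.at_ v) (hd : σ.deg v = 1) : σ.at_ v = {e} := by
  obtain ⟨f, hf⟩ := Finset.card_eq_one.1 hd
  rw [hf] at he ⊢
  rw [Finset.mem_singleton.1 he]

end St

namespace RAM
open St

@[simp] lemma eval_seq (p q : Prog) (s : Store) : (Prog.seq p q).eval s = q.eval (p.eval s) := rfl
@[simp] lemma eval_skip (s : Store) : Prog.skip.eval s = s := rfl
@[simp] lemma eval_assign (x : ℕ) (e : Expr) (s : Store) :
    (Prog.assign x e).eval s = s.setReg x (e.eval s) := rfl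

/-- Put the end of the edge in `x` other than the vertex in `y` into `z`. -/
def otherEnd (x y z : ℕ) : Prog :=
  .assign z (.sub (.add (.read 0 (.reg x)) (.read 1 (.reg x))) (.reg y))

/-- Put the edge at the vertex in `y` other than the edge in `x` into `z`. -/
def otherEdge (c y x z : ℕ) : Prog := .assign z (.sub (.read (c + 3) (.reg y)) (.reg x))

/-- Test whether the vertex in `x` has degree `d`. -/
def ifDeg (c d x : ℕ) (p q : Prog) : Prog :=
  .ite (.read (c + 2) (.reg x)) (.const d) (.ite (.const d) (.read (c + 2) (.reg x)) p q) q

/-- Test whether two registers agree. -/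
def ifEq (x y : ℕ) (p q : Prog) : Prog := .ite (.reg x) (.reg y) (.ite (.reg y) (.reg x) p q) q

section
variable {c n m : ℕ} {s : Store} {σ : St c} {e f u v w x y z : ℕ}

/-- The sum of the two ends minus the known one; no comparison is needed. -/
lemma Rep.otherEnd (h : Rep n m s σ) (he : e ∈ σ.E) (hj : σ.Joins e v w) (hx : s.reg x = e)
    (hy : s.reg y = v) : (otherEnd x y z).eval s = s.setReg z w := by
  simp only [RAM.otherEnd, eval_assign, Expr.eval, hx, hy, h.U e he, h.W e he]
  congr 1
  rcases hj with ⟨rfl, rfl⟩ | ⟨rfl, rfl⟩ <;> ring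

/-- At degree two the stored sum of incident edges minus the known edge is the other edge, so no
adjacency list has to be searched. -/
lemma Rep.otherEdge (h : Rep n m s σ) (hv : v < n) (ha : σ.at_ v = {e, f}) (hef : e ≠ f)
    (hx : s.reg x = e) (hy : s.reg y = v) : (otherEdge c y x z).eval s = s.setReg z f := by
  simp only [RAM.otherEdge, eval_assign, Expr.eval, hx, hy, h.sum v hv, ha, Finset.sum_pair hef]
  congr 1
  ring

lemma Rep.ifDeg (h : Rep n m s σ) (hv : v < n) (hx : s.reg x = v) (d : ℕ) (p q : Prog) :
    (ifDeg c d x p q).eval s = if σ.deg v = d then p.eval s else q.eval s := by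
  simp only [RAM.ifDeg, Prog.eval, Expr.eval, hx, h.deg v hv, Nat.cast_le]
  split_ifs <;> first | rfl | omega

lemma ifEq_eval (p q : Prog) :
    (ifEq x y p q).eval s = if s.reg x = s.reg y then p.eval s else q.eval s := by
  change (if s.reg x ≤ s.reg y then if s.reg y ≤ s.reg x then p.eval s else q.eval s
    else q.eval s) = _
  by_cases h : s.reg x = s.reg y
  · simp [h]
  · rw [if_neg h]
    by_cases h' : s.reg x ≤ s.reg y
    · rw [if_pos h', if_neg (fun h2 => h (le_antisymm h' h2))]
    · rw [if_neg h']

lemma Rep.del_low (h : Rep n m s σ) (hw : σ.WF n m) (hx : s.reg x = e) (he : e ∈ σ.E)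
    (hl : σ.Low e) : Rep n m ((delP c x).eval s) (σ.del e) ∧ (σ.del e).WF n m ∧
      ((delP c x).eval s).reg = s.reg :=
  ⟨h.del hw hx he hl, hw.del, delP_reg _ _⟩

end

/-! ### The program

Register 3 holds a vertex; register 4 is set to 1 if a reduction is applied at it. -/

section
variable {c : ℕ}

/-- The cheaper chain for given lists. -/
noncomputable def shorterChain (l₁ l₂ l₃ l₄ : Finset (Fin c)) : List (Finset (Fin c)) :=
  (exists_shorter_chain l₁ l₂ l₃ l₄).choose

/-- The cost of passing to the shorter chain. -/
noncomputable def shorterCost (l₁ l₂ l₃ l₄ : Finset (Fin c)) : ℤ :=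
  (exists_shorter_chain l₁ l₂ l₃ l₄).choose_spec.choose

lemma shorterChain_spec (l₁ l₂ l₃ l₄ : Finset (Fin c)) :
    ((∃ a b, shorterChain l₁ l₂ l₃ l₄ = [a, b]) ∨ ∃ a b e, shorterChain l₁ l₂ l₃ l₄ = [a, b, e]) ∧
      ∀ i j w, Feas [l₁, l₂, l₃, l₄] i j (w + shorterCost l₁ l₂ l₃ l₄) ↔
        Feas (shorterChain l₁ l₂ l₃ l₄) i j w :=
  (exists_shorter_chain l₁ l₂ l₃ l₄).choose_spec.choose_spec

/-- Replace the inner edges of the chain by new ones with given lists. -/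
def contractP (d : ℤ) : List (Finset (Fin c)) → Prog
  | [a, b] => .seq (payP d) (.seq (delP c 5) (.seq (delP c 7) (.seq (delP c 11)
      (.seq (addP c 5 6 12) (.seq (setLP 9 a) (setLP 5 b))))))
  | [a, b, e] => .seq (payP d) (.seq (delP c 5) (.seq (delP c 7)
      (.seq (addP c 5 6 8) (.seq (setLP 9 a) (.seq (setLP 5 b) (setLP 11 e))))))
  | _ => .skip

/-- Contract a chain. -/
noncomputable def chainP (c : ℕ) : Prog :=
  dispatch (c := c) 9 fun l₂ => dispatch 5 fun l₃ => dispatch 7 fun l₄ => dispatch 11 fun l₅ =>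
    contractP (shorterCost l₂ l₃ l₄ l₅) (shorterChain l₂ l₃ l₄ l₅)

/-- Delete a triangle. -/
noncomputable def triangleP (c : ℕ) (tri : Prop) : Prog :=
  dispatch (c := c) 5 fun l₃ => dispatch 7 fun l₄ => dispatch 9 fun l₂ =>
    .seq (payP (triangleCost tri l₃ l₄ l₂)) (.seq (delP c 5) (.seq (delP c 7) (delP c 9)))

/-- Delete a cycle of length four. -/
noncomputable def cycleFourP (c : ℕ) : Prog :=
  dispatch (c := c) 5 fun l₃ => dispatch 7 fun l₄ => dispatch 11 fun l₅ => dispatch 9 fun l₂ =>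
    .seq (payP (cycleCost l₃ [l₄, l₅, l₂])) (.seq (delP c 5) (.seq (delP c 7)
      (.seq (delP c 11) (delP c 9))))

/-- Delete a cycle of length five. -/
noncomputable def cycleFiveP (c : ℕ) : Prog :=
  dispatch (c := c) 5 fun l₃ => dispatch 7 fun l₄ => dispatch 11 fun l₅ => dispatch 13 fun l₁ =>
    dispatch 9 fun l₂ =>
    .seq (payP (cycleCost l₃ [l₄, l₅, l₁, l₂])) (.seq (delP c 5) (.seq (delP c 7)
      (.seq (delP c 11) (.seq (delP c 13) (delP c 9)))))

/-- Delete an isolated edge. -/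
def isolatedP (c : ℕ) : Prog :=
  dispatch (c := c) 5 fun l => .seq (payP (pendantCost l)) (delP c 5)

/-- Delete a pendant edge. -/
def pendantP (c : ℕ) : Prog :=
  dispatch (c := c) 5 fun l => dispatch 7 fun l' =>
    .seq (setLP 7 (pendantList l l')) (.seq (payP (pendantCost l)) (delP c 5))

/-- Record a reduction. -/
def found (p : Prog) : Prog := .seq (.assign 4 (.const 1)) p

/-- The reductions at a vertex of degree one. -/
def reduceOne (c : ℕ) : Prog :=
  .seq (.assign 5 (.read (c + 3) (.reg 3))) (.seq (otherEnd 5 3 6)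
    (ifDeg c 1 6 (found (isolatedP c))
      (ifDeg c 2 6 (.seq (otherEdge c 6 5 7) (found (pendantP c))) .skip)))

/-- The reductions at the center of a path with three inner vertices of degree two and different
ends of degree two. -/
noncomputable def reduceInner (c : ℕ) : Prog :=
  .seq (otherEdge c 10 9 13) (.seq (otherEdge c 12 11 14)
    (ifEq 13 14 (found (cycleFiveP c)) (found (chainP c))))

/-- The reductions at the center of a path with three inner vertices of degree two. -/
noncomputable def reduceCenter (c : ℕ) (tri : Prop) : Prog :=
  .seq (otherEdge c 6 5 9) (.seq (otherEnd 9 6 10) (.seq (otherEdge c 8 7 11)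
    (.seq (otherEnd 11 8 12) (ifEq 9 11 (found (triangleP c tri))
      (ifDeg c 2 10 (ifDeg c 2 12
        (ifEq 10 12 (found (cycleFourP c)) (reduceInner c)) .skip) .skip)))))

/-- The reductions at a vertex of degree two. -/
noncomputable def reduceTwo (c : ℕ) (tri : Prop) : Prog :=
  .seq (.assign 5 (.read (c + 4) (.reg 3))) (.seq (otherEnd 5 3 6) (.seq (otherEdge c 3 5 7)
    (.seq (otherEnd 7 3 8) (ifDeg c 2 6 (ifDeg c 2 8 (reduceCenter c tri) .skip) .skip))))

/-- Apply a reduction at the vertex in register 3, if possible. -/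
noncomputable def reduceP (c : ℕ) (tri : Prop) : Prog :=
  ifDeg c 1 3 (reduceOne c) (ifDeg c 2 3 (reduceTwo c tri) .skip)

lemma contractP_straight (d : ℤ) (ls : List (Finset (Fin c))) : (contractP d ls).Straight := by
  unfold contractP
  split <;> simp [Prog.Straight, delP_straight, addP_straight, setLP_straight, payP]

lemma reduceP_straight (c : ℕ) (tri : Prop) : (reduceP c tri).Straight := by
  unfold reduceP reduceOne reduceTwo reduceCenter reduceInner ifDeg ifEq found otherEnd otherEdge
    isolatedP pendantP cycleFiveP cycleFourP triangleP chainP payP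
  repeat' first
    | exact delP_straight _
    | exact setLP_straight _ _
    | exact contractP_straight _ _
    | exact trivial
    | refine dispatch_straight _ _ fun _ => ?_
    | refine And.intro ?_ ?_

end

/-! ### Correctness -/

/-- The result of a reduction attempt at the vertex `v`, where `b` is the previous value of
register 4. -/
def Outcome {c : ℕ} (tri : Prop) (n m v : ℕ) (b : ℤ) (σ : St c) (s : Store) : Prop :=
  s.reg 3 = v ∧ ((s.reg 4 = b ∧ Rep n m s σ ∧ σ.Stuck v) ∨
    (s.reg 4 = 1 ∧ ∃ σ', Step tri n m σ σ' ∧ Rep n m s σ'))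

section
variable {c n m : ℕ} {s : Store} {σ : St c} {tri : Prop} {b : ℤ}
  {e f v w e₁ e₂ e₃ e₄ e₅ e₆ v₀ v₁ v₂ v₃ v₄ v₅ v₆ : ℕ}

/-- This and the following lemmas match the program of each rule with the corresponding reduction
step. Every edge to be deleted has low ends, which `Rep.del` requires and which later deletions
preserve. -/
lemma outcome_isolated (hr : Rep n m s σ) (h : σ.WF n m) (h3 : s.reg 3 = v) (h5 : s.reg 5 = e)
    (he : e ∈ σ.E) (hj : σ.Joins e v w) (hv : σ.at_ v = {e}) (hw : σ.at_ w = {e}) :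
    Outcome tri n m v b σ ((found (isolatedP c)).eval s) := by
  have hr1 := hr.setReg (x := 4) (by norm_num) 1
  have hl : σ.Low e := low_of_joins hj (by simp [deg, hv]) (by simp [deg, hw])
  change Outcome tri n m v b σ ((isolatedP c).eval (s.setReg 4 1))
  unfold isolatedP
  rw [hr1.dispatch_eval (e := e) (by simp [h5]) (h.lt_m e he), eval_seq]
  obtain ⟨hr2, -, hg2⟩ := (hr1.pay (pendantCost (σ.L e))).del_low h.pay (x := 5) (by simp [h5]) he hl
  exact ⟨by simp [h3], Or.inr ⟨by simp, _, step_isolated h he hj hv hw, hr2⟩⟩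

lemma outcome_pendant (hr : Rep n m s σ) (h : σ.WF n m) (h3 : s.reg 3 = v) (h5 : s.reg 5 = e)
    (h7 : s.reg 7 = f) (he : e ∈ σ.E) (hf : f ∈ σ.E) (hfe : f ≠ e) (hj : σ.Joins e v w)
    (hv : σ.at_ v = {e}) (hw : σ.at_ w = {e, f}) :
    Outcome tri n m v b σ ((found (pendantP c)).eval s) := by
  have hr1 := hr.setReg (x := 4) (by norm_num) 1
  have hl : σ.Low e := low_of_joins hj (by simp [deg, hv])
    (by unfold deg; rw [hw, Finset.card_pair hfe.symm])
  change Outcome tri n m v b σ ((pendantP c).eval (s.setReg 4 1))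
  unfold pendantP
  rw [hr1.dispatch_eval (e := e) (by simp [h5]) (h.lt_m e he),
    hr1.dispatch_eval (e := f) (by simp [h7]) (h.lt_m f hf), eval_seq, eval_seq]
  obtain ⟨hr2, -, hg2⟩ := ((hr1.setL (x := 7) (e := f) (by simp [h7])
    (pendantList (σ.L e) (σ.L f))).pay (pendantCost (σ.L e))).del_low h.setL.pay (x := 5)
    (by simp [h5]) he hl
  exact ⟨by simp [h3], Or.inr ⟨by simp, _, step_pendant h he hf hfe hj hv hw, hr2⟩⟩

lemma outcome_triangle (hr : Rep n m s σ) (h : σ.WF n m) (h3 : s.reg 3 = v₃) (h5 : s.reg 5 = e₃)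
    (h7 : s.reg 7 = e₄) (h9 : s.reg 9 = e₂) (hC : Center σ e₂ e₃ e₄ e₂ v₁ v₂ v₃ v₄ v₅) :
    Outcome tri n m v₃ b σ ((found (triangleP c tri)).eval s) := by
  have hr1 := hr.setReg (x := 4) (by norm_num) 1
  obtain ⟨m₂, m₃, m₄, -⟩ := hC.mem
  obtain ⟨h12, h23, h34, h45, h24, h13, h35, n₂₄, -⟩ := hC.distinct h
  have hS := hC.triangle (tri := tri) h
  obtain ⟨j₂, j₃, j₄, j₅, a₂, a₃, a₄, n₂₃, n₃₄, n₄₅⟩ := hC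
  have d₂ : σ.deg v₂ ≤ 2 := by unfold deg; rw [a₂]; exact Finset.card_le_two
  have d₃ : σ.deg v₃ ≤ 2 := by unfold deg; rw [a₃]; exact Finset.card_le_two
  have d₄ : σ.deg v₄ ≤ 2 := by unfold deg; rw [a₄]; exact Finset.card_le_two
  have h14 : v₁ = v₄ := by
    rcases joins_eq j₂ j₅ with ⟨h1, -⟩ | ⟨-, h2⟩
    · exact h1
    · exact absurd h2 h24
  change Outcome tri n m v₃ b σ ((triangleP c tri).eval (s.setReg 4 1))
  unfold triangleP
  rw [hr1.dispatch_eval (e := e₃) (by simp [h5]) (h.lt_m _ m₃),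
    hr1.dispatch_eval (e := e₄) (by simp [h7]) (h.lt_m _ m₄),
    hr1.dispatch_eval (e := e₂) (by simp [h9]) (h.lt_m _ m₂), eval_seq, eval_seq, eval_seq]
  have k₃ : σ.Low e₃ := low_of_joins j₃ d₂ d₃
  have k₄ : σ.Low e₄ := low_of_joins j₄ d₃ d₄
  have k₂ : σ.Low e₂ := low_of_joins j₂ (h14 ▸ d₄) d₂
  obtain ⟨hr2, w2, g2⟩ := (hr1.pay (triangleCost tri (σ.L e₃) (σ.L e₄) (σ.L e₂))).del_low h.pay
    (x := 5) (by simp [h5]) m₃ k₃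
  obtain ⟨hr3, w3, g3⟩ := hr2.del_low w2 (x := 7) (e := e₄) (by simp [h7])
    (by simp [n₃₄.symm, m₄]) (Low.del k₄)
  obtain ⟨hr4, w4, g4⟩ := hr3.del_low w3 (x := 9) (e := e₂) (by simp [h9])
    (by simp [n₂₃, n₂₄, m₂]) (Low.del (Low.del k₂))
  exact ⟨by simp [h3], Or.inr ⟨by simp, _, hS, hr4⟩⟩

lemma outcome_cycle_four (hr : Rep n m s σ) (h : σ.WF n m) (h3 : s.reg 3 = v₃) (h5 : s.reg 5 = e₃)
    (h7 : s.reg 7 = e₄) (h9 : s.reg 9 = e₂) (h11 : s.reg 11 = e₅)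
    (hC : Center σ e₂ e₃ e₄ e₅ v₁ v₂ v₃ v₄ v₁) (h25 : e₂ ≠ e₅) (hd : σ.deg v₁ = 2) :
    Outcome tri n m v₃ b σ ((found (cycleFourP c)).eval s) := by
  have hr1 := hr.setReg (x := 4) (by norm_num) 1
  obtain ⟨m₂, m₃, m₄, m₅⟩ := hC.mem
  obtain ⟨h12, h23, h34, h45, h24, h13, h35, n₂₄, n₃₅⟩ := hC.distinct h
  have hS := hC.cycle_four (tri := tri) h h25 hd
  obtain ⟨j₂, j₃, j₄, j₅, a₂, a₃, a₄, n₂₃, n₃₄, n₄₅⟩ := hC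
  have d₂ : σ.deg v₂ ≤ 2 := by unfold deg; rw [a₂]; exact Finset.card_le_two
  have d₃ : σ.deg v₃ ≤ 2 := by unfold deg; rw [a₃]; exact Finset.card_le_two
  have d₄ : σ.deg v₄ ≤ 2 := by unfold deg; rw [a₄]; exact Finset.card_le_two
  change Outcome tri n m v₃ b σ ((cycleFourP c).eval (s.setReg 4 1))
  unfold cycleFourP
  rw [hr1.dispatch_eval (e := e₃) (by simp [h5]) (h.lt_m _ m₃),
    hr1.dispatch_eval (e := e₄) (by simp [h7]) (h.lt_m _ m₄),
    hr1.dispatch_eval (e := e₅) (by simp [h11]) (h.lt_m _ m₅),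
    hr1.dispatch_eval (e := e₂) (by simp [h9]) (h.lt_m _ m₂), eval_seq, eval_seq, eval_seq,
    eval_seq]
  have k₃ : σ.Low e₃ := low_of_joins j₃ d₂ d₃
  have k₄ : σ.Low e₄ := low_of_joins j₄ d₃ d₄
  have k₅ : σ.Low e₅ := low_of_joins j₅ d₄ hd.le
  have k₂ : σ.Low e₂ := low_of_joins j₂ hd.le d₂
  obtain ⟨hr2, w2, g2⟩ := (hr1.pay (cycleCost (σ.L e₃) [σ.L e₄, σ.L e₅, σ.L e₂])).del_low h.pay
    (x := 5) (by simp [h5]) m₃ k₃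
  obtain ⟨hr3, w3, g3⟩ := hr2.del_low w2 (x := 7) (e := e₄) (by simp [h7])
    (by simp [n₃₄.symm, m₄]) (Low.del k₄)
  obtain ⟨hr4, w4, g4⟩ := hr3.del_low w3 (x := 11) (e := e₅) (by simp [h11])
    (by simp [n₃₅.symm, n₄₅.symm, m₅]) (Low.del (Low.del k₅))
  obtain ⟨hr5, w5, g5⟩ := hr4.del_low w4 (x := 9) (e := e₂) (by simp [h9])
    (by simp [n₂₃, n₂₄, h25, m₂]) (Low.del (Low.del (Low.del k₂)))
  exact ⟨by simp [h3], Or.inr ⟨by simp, _, hS, hr5⟩⟩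

lemma outcome_cycle_five (hr : Rep n m s σ) (h : σ.WF n m) (h3 : s.reg 3 = v₃) (h5 : s.reg 5 = e₃)
    (h7 : s.reg 7 = e₄) (h9 : s.reg 9 = e₂) (h11 : s.reg 11 = e₅) (h13' : s.reg 13 = e₁)
    (hC : Center σ e₂ e₃ e₄ e₅ v₁ v₂ v₃ v₄ v₅) (h25 : e₂ ≠ e₅)
    (h15 : v₁ ≠ v₅) (a₁ : σ.at_ v₁ = {e₁, e₂}) (n₁₂ : e₁ ≠ e₂) (a₅ : σ.at_ v₅ = {e₅, e₁})
    (n₅₁ : e₅ ≠ e₁) :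
    Outcome tri n m v₃ b σ ((found (cycleFiveP c)).eval s) := by
  have hr1 := hr.setReg (x := 4) (by norm_num) 1
  obtain ⟨m₂, m₃, m₄, m₅⟩ := hC.mem
  obtain ⟨h14, h2v5⟩ := hC.chain_aux h h25 h15
  obtain ⟨h12, h23, h34, h45, h24, h13, h35, n₂₄, n₃₅⟩ := hC.distinct h
  have hS := hC.cycle_five (tri := tri) h h25 h15 a₁ n₁₂ a₅ n₅₁
  obtain ⟨j₂, j₃, j₄, j₅, a₂, a₃, a₄, n₂₃, n₃₄, n₄₅⟩ := hC
  have d₁ : σ.deg v₁ ≤ 2 := by unfold deg; rw [a₁]; exact Finset.card_le_two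
  have d₂ : σ.deg v₂ ≤ 2 := by unfold deg; rw [a₂]; exact Finset.card_le_two
  have d₃ : σ.deg v₃ ≤ 2 := by unfold deg; rw [a₃]; exact Finset.card_le_two
  have d₄ : σ.deg v₄ ≤ 2 := by unfold deg; rw [a₄]; exact Finset.card_le_two
  have d₅ : σ.deg v₅ ≤ 2 := by unfold deg; rw [a₅]; exact Finset.card_le_two
  have m₁ : e₁ ∈ σ.E := mem_E_of_at (v := v₁) (by simp [a₁])
  obtain ⟨z, hz⟩ := exists_joins (σ := σ) (e := e₁) (v := v₅) (by simp [a₅])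
  obtain ⟨y, hy⟩ := exists_joins (σ := σ) (e := e₁) (v := v₁) (by simp [a₁])
  have j₁ : σ.Joins e₁ v₅ v₁ := by
    rcases joins_eq hz hy with ⟨h1, -⟩ | ⟨-, h2⟩
    · exact absurd h1.symm h15
    · rwa [h2] at hz
  have n₁₃ : e₁ ≠ e₃ := by
    rintro rfl
    rcases joins_eq j₁ j₃ with ⟨p, q⟩ | ⟨p, q⟩
    · exact h13 q
    · exact h12 q
  have n₁₄ : e₁ ≠ e₄ := by
    rintro rfl
    rcases joins_eq j₁ j₄ with ⟨p, q⟩ | ⟨p, q⟩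
    · exact h14 q
    · exact h13 q
  change Outcome tri n m v₃ b σ ((cycleFiveP c).eval (s.setReg 4 1))
  unfold cycleFiveP
  rw [hr1.dispatch_eval (e := e₃) (by simp [h5]) (h.lt_m _ m₃),
    hr1.dispatch_eval (e := e₄) (by simp [h7]) (h.lt_m _ m₄),
    hr1.dispatch_eval (e := e₅) (by simp [h11]) (h.lt_m _ m₅),
    hr1.dispatch_eval (e := e₁) (by simp [h13']) (h.lt_m _ m₁),
    hr1.dispatch_eval (e := e₂) (by simp [h9]) (h.lt_m _ m₂), eval_seq, eval_seq, eval_seq,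
    eval_seq, eval_seq]
  have k₃ : σ.Low e₃ := low_of_joins j₃ d₂ d₃
  have k₄ : σ.Low e₄ := low_of_joins j₄ d₃ d₄
  have k₅ : σ.Low e₅ := low_of_joins j₅ d₄ d₅
  have k₁ : σ.Low e₁ := low_of_joins j₁ d₅ d₁
  have k₂ : σ.Low e₂ := low_of_joins j₂ d₁ d₂
  obtain ⟨hr2, w2, g2⟩ := (hr1.pay (cycleCost (σ.L e₃) [σ.L e₄, σ.L e₅, σ.L e₁, σ.L e₂])).del_low
    h.pay (x := 5) (by simp [h5]) m₃ k₃
  obtain ⟨hr3, w3, g3⟩ := hr2.del_low w2 (x := 7) (e := e₄) (by simp [h7])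
    (by simp [n₃₄.symm, m₄]) (Low.del k₄)
  obtain ⟨hr4, w4, g4⟩ := hr3.del_low w3 (x := 11) (e := e₅) (by simp [h11])
    (by simp [n₃₅.symm, n₄₅.symm, m₅]) (Low.del (Low.del k₅))
  obtain ⟨hr5, w5, g5⟩ := hr4.del_low w4 (x := 13) (e := e₁) (by simp [h13'])
    (by simp [n₁₃, n₁₄, n₅₁.symm, m₁]) (Low.del (Low.del (Low.del k₁)))
  obtain ⟨hr6, w6, g6⟩ := hr5.del_low w5 (x := 9) (e := e₂) (by simp [h9])
    (by simp [n₂₃, n₂₄, h25, n₁₂.symm, m₂]) (Low.del (Low.del (Low.del (Low.del k₂))))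
  exact ⟨by simp [h3], Or.inr ⟨by simp, _, hS, hr6⟩⟩

/-- The decision tree ends in the program for the shorter chain of the four actual lists. The number
of e₃ is deleted and reused for the inserted edge, so no new edge number is needed. -/
lemma outcome_chain (hr : Rep n m s σ) (h : σ.WF n m) (h3 : s.reg 3 = v₃) (h5 : s.reg 5 = e₃)
    (h6 : s.reg 6 = v₂) (h7 : s.reg 7 = e₄) (h8 : s.reg 8 = v₄) (h9 : s.reg 9 = e₂)
    (h11 : s.reg 11 = e₅) (h12' : s.reg 12 = v₅)
    (hC : Chain σ e₁ e₂ e₃ e₄ e₅ e₆ v₀ v₁ v₂ v₃ v₄ v₅ v₆) :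
    Outcome tri n m v₃ b σ ((found (chainP c)).eval s) := by
  have hr1 := hr.setReg (x := 4) (by norm_num) 1
  have d₂ : σ.deg v₂ ≤ 2 := by unfold deg; rw [hC.a₂]; exact Finset.card_le_two
  have d₃ : σ.deg v₃ ≤ 2 := by unfold deg; rw [hC.a₃]; exact Finset.card_le_two
  have d₄ : σ.deg v₄ ≤ 2 := by unfold deg; rw [hC.a₄]; exact Finset.card_le_two
  have d₅ : σ.deg v₅ ≤ 2 := by unfold deg; rw [hC.a₅]; exact Finset.card_le_two
  have de := hC.nd_e
  have dv := hC.nd_v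
  simp only [List.nodup_cons, List.mem_cons, List.not_mem_nil, or_false, not_or] at de dv
  have n₃₄ : e₃ ≠ e₄ := de.2.2.1.1
  have n₃₅ : e₃ ≠ e₅ := de.2.2.1.2.1
  have n₄₅ : e₄ ≠ e₅ := de.2.2.2.1.1
  have h24 := dv.2.1.2.1
  have h25 := dv.2.1.2.2
  change Outcome tri n m v₃ b σ ((chainP c).eval (s.setReg 4 1))
  unfold chainP
  rw [hr1.dispatch_eval (e := e₂) (by simp [h9]) (h.lt_m _ hC.m₂),
    hr1.dispatch_eval (e := e₃) (by simp [h5]) (h.lt_m _ hC.m₃),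
    hr1.dispatch_eval (e := e₄) (by simp [h7]) (h.lt_m _ hC.m₄),
    hr1.dispatch_eval (e := e₅) (by simp [h11]) (h.lt_m _ hC.m₅)]
  have k₃ : σ.Low e₃ := low_of_joins hC.j₃ d₂ d₃
  have k₄ : σ.Low e₄ := low_of_joins hC.j₄ d₃ d₄
  have k₅ : σ.Low e₅ := low_of_joins hC.j₅ d₄ d₅
  obtain ⟨hls, hf⟩ := shorterChain_spec (σ.L e₂) (σ.L e₃) (σ.L e₄) (σ.L e₅)
  generalize shorterCost (σ.L e₂) (σ.L e₃) (σ.L e₄) (σ.L e₅) = d at *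
  obtain ⟨hr2, w2, g2⟩ := (hr1.pay d).del_low h.pay (x := 5) (by simp [h5]) hC.m₃ k₃
  obtain ⟨hr3, w3, g3⟩ := hr2.del_low w2 (x := 7) (e := e₄) (by simp [h7])
    (by simp [n₃₄.symm, hC.m₄]) (Low.del k₄)
  rcases hls with ⟨p, q, hls⟩ | ⟨p, q, r, hls⟩
  · rw [hls] at hf ⊢
    obtain ⟨hr4, w4, g4⟩ := hr3.del_low w3 (x := 11) (e := e₅) (by simp [h11])
      (by simp [n₃₅.symm, n₄₅.symm, hC.m₅]) (Low.del (Low.del k₅))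
    have hr5 := hr4.add (x := 5) (xu := 6) (xw := 12) (e := e₃) (u := v₂) (w := v₅) (by simp [h5])
      (by simp [h6]) (by simp [h12']) (by simp) h25
    have hr6 := hr5.setL (x := 9) (e := e₂) (by simp [h9]) p
    have hr7 := hr6.setL (x := 5) (e := e₃) (by simp [h5]) q
    refine ⟨?_, Or.inr ⟨?_, _, hC.step₂ h hf, hr7⟩⟩
    · simp [contractP, h3]
    · simp [contractP]
  · rw [hls] at hf ⊢
    have hr5 := hr3.add (x := 5) (xu := 6) (xw := 8) (e := e₃) (u := v₂) (w := v₄) (by simp [h5])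
      (by simp [h6]) (by simp [h8]) (by simp) h24
    have hr6 := hr5.setL (x := 9) (e := e₂) (by simp [h9]) p
    have hr7 := hr6.setL (x := 5) (e := e₃) (by simp [h5]) q
    have hr8 := hr7.setL (x := 11) (e := e₅) (by simp [h11]) r
    refine ⟨?_, Or.inr ⟨?_, _, hC.step₁ h hf, hr8⟩⟩
    · simp [contractP, h3]
    · simp [contractP]

lemma outcome_stuck (hr : Rep n m s σ) (h3 : s.reg 3 = v) (h4 : s.reg 4 = b) (h : σ.Stuck v) :
    Outcome tri n m v b σ (Prog.skip.eval s) := ⟨h3, Or.inl ⟨h4, hr, h⟩⟩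

lemma outcome_one (hr : Rep n m s σ) (h : σ.WF n m) (hv : v < n) (h3 : s.reg 3 = v)
    (h4 : s.reg 4 = b) (hd : σ.deg v = 1) :
    Outcome tri n m v b σ ((reduceOne c).eval s) := by
  obtain ⟨e, ha⟩ := Finset.card_eq_one.1 hd
  have hev : e ∈ σ.at_ v := by simp [ha]
  have he := mem_E_of_at hev
  obtain ⟨w, hj⟩ := exists_joins hev
  have hwn := (h.joins_lt he hj).2
  have hew := mem_at_right he hj
  unfold reduceOne
  rw [eval_seq, eval_seq, eval_assign]
  have h5 : (Expr.read (c + 3) (.reg 3)).eval s = e := by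
    simp [Expr.eval, h3, hr.sum v hv, ha]
  rw [h5]
  have hr1 := hr.setReg (x := 5) (by norm_num) e
  rw [hr1.otherEnd he hj (by simp) (by simp [h3])]
  have hr2 := hr1.setReg (x := 6) (by norm_num) w
  rw [hr2.ifDeg hwn (by simp)]
  split_ifs with h1
  · exact outcome_isolated hr2 h (by simp [h3]) (by simp) he hj ha (at_eq_singleton hew h1)
  rw [hr2.ifDeg hwn (by simp)]
  split_ifs with h2
  · obtain ⟨f, hf, hef⟩ := exists_at_eq_pair hew h2
    rw [eval_seq, hr2.otherEdge hwn hf hef (by simp) (by simp)]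
    have hr3 := hr2.setReg (x := 7) (by norm_num) f
    exact outcome_pendant hr3 h (by simp [h3]) (by simp) (by simp) he
      (mem_E_of_at (v := w) (by simp [hf])) hef.symm hj ha hf
  -- The neighbor has degree neither one nor two, and it is not isolated, so its degree is at least
  -- three.
  · refine outcome_stuck hr2 (by simp [h3]) (by simp [h4]) ⟨fun _ => ⟨e, he, w, hj, ?_⟩,
      fun h => by omega⟩
    have : 0 < σ.deg w := Finset.card_pos.2 ⟨e, hew⟩
    omega

lemma outcome_inner (hr : Rep n m s σ) (h : σ.WF n m) (h3 : s.reg 3 = v₃) (h5 : s.reg 5 = e₃)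
    (h6 : s.reg 6 = v₂) (h7 : s.reg 7 = e₄) (h8 : s.reg 8 = v₄) (h9 : s.reg 9 = e₂)
    (h10 : s.reg 10 = v₁) (h11 : s.reg 11 = e₅) (h12 : s.reg 12 = v₅)
    (hC : Center σ e₂ e₃ e₄ e₅ v₁ v₂ v₃ v₄ v₅) (h25 : e₂ ≠ e₅) (h15 : v₁ ≠ v₅)
    (d₁ : σ.deg v₁ = 2) (d₅ : σ.deg v₅ = 2) :
    Outcome tri n m v₃ b σ ((reduceInner c).eval s) := by
  obtain ⟨m₂, m₃, m₄, m₅⟩ := hC.mem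
  obtain ⟨e₁, a₁, n₁⟩ := exists_at_eq_pair (mem_at_left m₂ hC.j₂) d₁
  obtain ⟨e₆, a₅, n₅⟩ := exists_at_eq_pair (mem_at_right m₅ hC.j₅) d₅
  unfold reduceInner
  rw [eval_seq, eval_seq, hr.otherEdge (h.joins_lt m₂ hC.j₂).1 a₁ n₁ h9 h10]
  have hr1 := hr.setReg (x := 13) (by norm_num) e₁
  rw [hr1.otherEdge (h.joins_lt m₅ hC.j₅).2 a₅ n₅ (by simp [h11]) (by simp [h12])]
  have hr2 := hr1.setReg (x := 14) (by norm_num) e₆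
  rw [Finset.pair_comm] at a₁
  rw [ifEq_eval]
  have hiff : ((s.setReg 13 e₁).setReg 14 e₆).reg 13 = ((s.setReg 13 e₁).setReg 14 e₆).reg 14 ↔
      e₁ = e₆ := by simp
  split_ifs with h16
  · rw [hiff] at h16
    subst h16
    exact outcome_cycle_five hr2 h (by simp [h3]) (by simp [h5]) (by simp [h7]) (by simp [h9])
      (by simp [h11]) (by simp) hC h25 h15 a₁ n₁.symm a₅ n₅
  · rw [hiff] at h16
    obtain ⟨v₀, j₁⟩ := exists_joins (σ := σ) (e := e₁) (v := v₁) (by simp [a₁])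
    obtain ⟨v₆, j₆⟩ := exists_joins (σ := σ) (e := e₆) (v := v₅) (by simp [a₅])
    exact outcome_chain hr2 h (by simp [h3]) (by simp [h5]) (by simp [h6]) (by simp [h7])
      (by simp [h8]) (by simp [h9]) (by simp [h11]) (by simp [h12])
      (hC.chain h h25 h15 a₁ n₁.symm a₅ n₅ (joins_symm j₁) j₆ h16)

/-- Registers 3, 5, 7 hold the center and its two edges, 6 and 8 its neighbors, 9 and 11 the next
edges, 10 and 12 their outer ends; 13 and 14 later receive the edges beyond. Comparing 9 with 11,
then 10 with 12, then 13 with 14 recognizes cycles of length three, four and five. -/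
lemma outcome_center (hr : Rep n m s σ) (h : σ.WF n m) (h3 : s.reg 3 = v₃) (h4 : s.reg 4 = b)
    (h5 : s.reg 5 = e₃) (h6 : s.reg 6 = v₂) (h7 : s.reg 7 = e₄) (h8 : s.reg 8 = v₄)
    (m₃ : e₃ ∈ σ.E) (m₄ : e₄ ∈ σ.E) (j₃ : σ.Joins e₃ v₃ v₂) (j₄ : σ.Joins e₄ v₃ v₄)
    (a₃ : σ.at_ v₃ = {e₃, e₄}) (n₃₄ : e₃ ≠ e₄) (d₂ : σ.deg v₂ = 2) (d₄ : σ.deg v₄ = 2) :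
    Outcome tri n m v₃ b σ ((reduceCenter c tri).eval s) := by
  obtain ⟨e₂, a₂, n₂⟩ := exists_at_eq_pair (mem_at_right m₃ j₃) d₂
  obtain ⟨e₅, a₄, n₄⟩ := exists_at_eq_pair (mem_at_right m₄ j₄) d₄
  have b₂ : e₂ ∈ σ.at_ v₂ := by simp [a₂]
  have b₅ : e₅ ∈ σ.at_ v₄ := by simp [a₄]
  have m₂ := mem_E_of_at b₂
  have m₅ := mem_E_of_at b₅
  obtain ⟨v₁, j₂⟩ := exists_joins b₂
  obtain ⟨v₅, j₅⟩ := exists_joins b₅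
  have hC : Center σ e₂ e₃ e₄ e₅ v₁ v₂ v₃ v₄ v₅ :=
    ⟨joins_symm j₂, joins_symm j₃, j₄, j₅, by rw [a₂, Finset.pair_comm], a₃, a₄, n₂.symm, n₃₄, n₄⟩
  have d₃ : σ.deg v₃ = 2 := by unfold deg; rw [a₃, Finset.card_pair n₃₄]
  unfold reduceCenter
  rw [eval_seq, eval_seq, eval_seq, eval_seq,
    hr.otherEdge (h.joins_lt m₃ j₃).2 a₂ n₂ h5 h6]
  have hr1 := hr.setReg (x := 9) (by norm_num) e₂
  rw [hr1.otherEnd m₂ j₂ (by simp) (by simp [h6])]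
  have hr2 := hr1.setReg (x := 10) (by norm_num) v₁
  rw [hr2.otherEdge (h.joins_lt m₄ j₄).2 a₄ n₄ (by simp [h7]) (by simp [h8])]
  have hr3 := hr2.setReg (x := 11) (by norm_num) e₅
  rw [hr3.otherEnd m₅ j₅ (by simp) (by simp [h8])]
  have hr4 := hr3.setReg (x := 12) (by norm_num) v₅
  set s' := (((s.setReg 9 e₂).setReg 10 v₁).setReg 11 e₅).setReg 12 v₅ with hs'
  have g3 : s'.reg 3 = v₃ := by simp [hs', h3]
  have g4 : s'.reg 4 = b := by simp [hs', h4]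
  have g5 : s'.reg 5 = e₃ := by simp [hs', h5]
  have g6 : s'.reg 6 = v₂ := by simp [hs', h6]
  have g7 : s'.reg 7 = e₄ := by simp [hs', h7]
  have g8 : s'.reg 8 = v₄ := by simp [hs', h8]
  have g9 : s'.reg 9 = e₂ := by simp [hs']
  have g10 : s'.reg 10 = v₁ := by simp [hs']
  have g11 : s'.reg 11 = e₅ := by simp [hs']
  have g12 : s'.reg 12 = v₅ := by simp [hs']
  clear_value s'
  have hn1 := (h.joins_lt m₂ j₂).2
  have hn5 := (h.joins_lt m₅ j₅).2
  rw [ifEq_eval, g9, g11]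
  split_ifs with h25
  · have h25 := Nat.cast_inj.1 h25
    subst h25
    exact outcome_triangle hr4 h g3 g5 g7 g9 hC
  have h25 : e₂ ≠ e₅ := fun h => h25 (by rw [h])
  rw [hr4.ifDeg hn1 g10]
  -- An outer end of degree other than two is the witness that no rule applies at the center. The
  -- same test precedes the comparison of the two outer ends, so a four-cycle is deleted only if it
  -- is a whole component.
  split_ifs with d₁
  swap
  · exact outcome_stuck hr4 g3 g4 ⟨fun h => by omega,
      fun _ => ⟨e₃, m₃, v₂, j₃, Or.inr ⟨e₂, m₂, v₁, j₂, d₁⟩⟩⟩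
  rw [hr4.ifDeg hn5 g12]
  split_ifs with d₅
  swap
  · exact outcome_stuck hr4 g3 g4 ⟨fun h => by omega,
      fun _ => ⟨e₄, m₄, v₄, j₄, Or.inr ⟨e₅, m₅, v₅, j₅, d₅⟩⟩⟩
  rw [ifEq_eval, g10, g12]
  split_ifs with h15
  · have h15 := Nat.cast_inj.1 h15
    subst h15
    exact outcome_cycle_four hr4 h g3 g5 g7 g9 g11 hC h25 d₁
  · exact outcome_inner hr4 h g3 g5 g6 g7 g8 g9 g10 g11 g12 hC h25 (fun h => h15 (by rw [h])) d₁ d₅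

lemma outcome_two (hr : Rep n m s σ) (h : σ.WF n m) (hv : v < n) (h3 : s.reg 3 = v)
    (h4 : s.reg 4 = b) (hd : σ.deg v = 2) :
    Outcome tri n m v b σ ((reduceTwo c tri).eval s) := by
  obtain ⟨e₃, he₃, hinc⟩ := hr.inc v hv hd
  obtain ⟨e₄, a₃, n₃₄⟩ := exists_at_eq_pair he₃ hd
  have he₄ : e₄ ∈ σ.at_ v := by simp [a₃]
  have m₃ := mem_E_of_at he₃
  have m₄ := mem_E_of_at he₄
  obtain ⟨v₂, j₃⟩ := exists_joins he₃
  obtain ⟨v₄, j₄⟩ := exists_joins he₄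
  unfold reduceTwo
  rw [eval_seq, eval_seq, eval_seq, eval_seq, eval_assign]
  have h5 : (Expr.read (c + 4) (.reg 3)).eval s = e₃ := by
    simp [Expr.eval, h3, hinc]
  rw [h5]
  have hr1 := hr.setReg (x := 5) (by norm_num) e₃
  rw [hr1.otherEnd m₃ j₃ (by simp) (by simp [h3])]
  have hr2 := hr1.setReg (x := 6) (by norm_num) v₂
  rw [hr2.otherEdge hv a₃ n₃₄ (by simp) (by simp [h3])]
  have hr3 := hr2.setReg (x := 7) (by norm_num) e₄
  rw [hr3.otherEnd m₄ j₄ (by simp) (by simp [h3])]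
  have hr4 := hr3.setReg (x := 8) (by norm_num) v₄
  rw [hr4.ifDeg (h.joins_lt m₃ j₃).2 (by simp)]
  split_ifs with d₂
  swap
  · exact outcome_stuck hr4 (by simp [h3]) (by simp [h4]) ⟨fun h => by omega,
      fun _ => ⟨e₃, m₃, v₂, j₃, Or.inl d₂⟩⟩
  rw [hr4.ifDeg (h.joins_lt m₄ j₄).2 (by simp)]
  split_ifs with d₄
  swap
  · exact outcome_stuck hr4 (by simp [h3]) (by simp [h4]) ⟨fun h => by omega,
      fun _ => ⟨e₄, m₄, v₄, j₄, Or.inl d₄⟩⟩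
  exact outcome_center hr4 h (by simp [h3]) (by simp [h4]) (by simp) (by simp) (by simp) (by simp)
    m₃ m₄ j₃ j₄ a₃ n₃₄ d₂ d₄

lemma outcome_reduceP (hr : Rep n m s σ) (h : σ.WF n m) (hv : v < n) (h3 : s.reg 3 = v)
    (h4 : s.reg 4 = b) : Outcome tri n m v b σ ((reduceP c tri).eval s) := by
  unfold reduceP
  rw [hr.ifDeg hv h3]
  split_ifs with d₁
  · exact outcome_one hr h hv h3 h4 d₁
  rw [hr.ifDeg hv h3]
  split_ifs with d₂
  · exact outcome_two hr h hv h3 h4 d₂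
  · exact outcome_stuck hr h3 h4 ⟨fun h => absurd h d₁, fun h => absurd h d₂⟩

end

end RAM

/-! ## The kernel -/

/-- Counting and enumerating are inverse to each other below the count, which is how edges and
vertices are renumbered. -/
lemma Nat.nth_of_lt_count {p : ℕ → Prop} [DecidablePred p] {j n : ℕ} (h : j < Nat.count p n) :
    p (Nat.nth p j) ∧ Nat.count p (Nat.nth p j) = j := by
  have hc : ∀ hf : (Set.ofPred p).Finite, j < hf.toFinset.card := by
    intro hf
    refine h.trans_le ?_
    rw [Nat.count_eq_card_filter_range]
    refine Finset.card_le_card fun a ha => ?_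
    simpa using (Finset.mem_filter.1 ha).2
  exact ⟨Nat.nth_mem _ hc, Nat.count_nth hc⟩

namespace St
variable {c : ℕ} {σ σ' : St c} {e u v : ℕ} {n m : ℕ} {tri : Prop}

/-- The number of vertices below `v` that are not isolated. -/
def rank (σ : St c) (v : ℕ) : ℕ := Nat.count (fun u => σ.deg u ≠ 0) v

/-- The number of edges below `e`. -/
def edgeRank (σ : St c) (e : ℕ) : ℕ := Nat.count (fun f => f ∈ σ.E) e

/-- The edge list with edges and vertices renumbered consecutively. -/
noncomputable def compact (σ : St c) : St c where
  E := Finset.range σ.E.card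
  U j := σ.rank (σ.U (Nat.nth (fun f => f ∈ σ.E) j))
  W j := σ.rank (σ.W (Nat.nth (fun f => f ∈ σ.E) j))
  L j := σ.L (Nat.nth (fun f => f ∈ σ.E) j)
  k := σ.k

lemma rank_eq_live : σ.rank n = σ.live n := by
  unfold rank live
  rw [Nat.count_eq_card_filter_range]

lemma WF.edgeRank (h : σ.WF n m) : σ.edgeRank m = σ.E.card := by
  unfold St.edgeRank
  rw [Nat.count_eq_card_filter_range]
  congr 1
  ext f
  simp only [Finset.mem_filter, Finset.mem_range]
  exact ⟨fun h => h.2, fun hf => ⟨h.lt_m f hf, hf⟩⟩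

lemma deg_ne_zero (he : e ∈ σ.at_ v) : σ.deg v ≠ 0 := (Finset.card_pos.2 ⟨e, he⟩).ne'

lemma deg_U_ne_zero (he : e ∈ σ.E) : σ.deg (σ.U e) ≠ 0 :=
  deg_ne_zero (mem_at.2 ⟨he, Or.inl rfl⟩)

lemma deg_W_ne_zero (he : e ∈ σ.E) : σ.deg (σ.W e) ≠ 0 :=
  deg_ne_zero (mem_at.2 ⟨he, Or.inr rfl⟩)

lemma rank_injective (hu : σ.deg u ≠ 0) (hv : σ.deg v ≠ 0) (h : σ.rank u = σ.rank v) : u = v :=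
  Nat.count_injective (p := fun u => σ.deg u ≠ 0) hu hv h

lemma rank_lt (hu : σ.deg u ≠ 0) (h : u < n) : σ.rank u < σ.live n := by
  rw [← rank_eq_live]
  exact Nat.count_strict_mono (p := fun u => σ.deg u ≠ 0) hu h

lemma WF.nth_mem (h : σ.WF n m) {j : ℕ} (hj : j < σ.E.card) :
    Nat.nth (fun f => f ∈ σ.E) j ∈ σ.E := by
  rw [← h.edgeRank] at hj
  exact (Nat.nth_of_lt_count hj).1

lemma WF.edgeRank_nth (h : σ.WF n m) {j : ℕ} (hj : j < σ.E.card) :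
    σ.edgeRank (Nat.nth (fun f => f ∈ σ.E) j) = j := by
  rw [← h.edgeRank] at hj
  exact (Nat.nth_of_lt_count hj).2

lemma nth_edgeRank (he : e ∈ σ.E) : Nat.nth (fun f => f ∈ σ.E) (σ.edgeRank e) = e :=
  Nat.nth_count (p := fun f => f ∈ σ.E) he

lemma WF.edgeRank_lt (h : σ.WF n m) (he : e ∈ σ.E) : σ.edgeRank e < σ.E.card := by
  rw [← h.edgeRank]
  exact Nat.count_strict_mono (p := fun f => f ∈ σ.E) he (h.lt_m e he)

/-- Ends of edges are not isolated, and ranks are injective on vertices that are not isolated, so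
the renumbered graph is again simple. -/
lemma WF.compact (h : σ.WF n m) : σ.compact.WF (σ.live n) σ.E.card where
  lt_m e he := Finset.mem_range.1 he
  U_lt e he := by
    have := h.nth_mem (Finset.mem_range.1 he)
    exact rank_lt (deg_U_ne_zero this) (h.U_lt _ this)
  W_lt e he := by
    have := h.nth_mem (Finset.mem_range.1 he)
    exact rank_lt (deg_W_ne_zero this) (h.W_lt _ this)
  ne e he heq := by
    have := h.nth_mem (Finset.mem_range.1 he)
    exact h.ne _ this (rank_injective (deg_U_ne_zero this) (deg_W_ne_zero this) heq)
  inj e he f hf u v h1 h2 := by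
    have he := Finset.mem_range.1 he
    have hf := Finset.mem_range.1 hf
    have me := h.nth_mem he
    have mf := h.nth_mem hf
    have key : Nat.nth (fun f => f ∈ σ.E) e = Nat.nth (fun f => f ∈ σ.E) f := by
      refine h.inj _ me _ mf _ _ (Or.inl ⟨rfl, rfl⟩) ?_
      have hUW := fun a b c d => rank_injective (σ := σ) (u := a) (v := b) c d
      have e1 := deg_U_ne_zero me
      have e2 := deg_W_ne_zero me
      have f1 := deg_U_ne_zero mf
      have f2 := deg_W_ne_zero mf
      rcases h1 with ⟨p, q⟩ | ⟨p, q⟩ <;> rcases h2 with ⟨p', q'⟩ | ⟨p', q'⟩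
      · exact Or.inl ⟨hUW _ _ f1 e1 (p'.trans p.symm), hUW _ _ f2 e2 (q'.trans q.symm)⟩
      · exact Or.inr ⟨hUW _ _ f1 e2 (p'.trans q.symm), hUW _ _ f2 e1 (q'.trans p.symm)⟩
      · exact Or.inr ⟨hUW _ _ f1 e2 (p'.trans q.symm), hUW _ _ f2 e1 (q'.trans p.symm)⟩
      · exact Or.inl ⟨hUW _ _ f1 e1 (p'.trans p.symm), hUW _ _ f2 e2 (q'.trans q.symm)⟩
    rw [← h.edgeRank_nth he, ← h.edgeRank_nth hf, key]

/-- New vertex numbers are sent back to the old names by enumerating the live vertices, so the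
compacted instance is the same graph without its isolated vertices. -/
lemma represents_compact (h : σ.WF n m) : Represents σ (σ.compact.toInstance (σ.live n))
    (fun v => Nat.nth (fun u => σ.deg u ≠ 0) v) where
  inj u v huv := by
    have hu : (u : ℕ) < σ.rank n := u.2.trans_eq rank_eq_live.symm
    have hv : (v : ℕ) < σ.rank n := v.2.trans_eq rank_eq_live.symm
    apply Fin.ext
    rw [← (Nat.nth_of_lt_count hu).2, ← (Nat.nth_of_lt_count hv).2]
    exact congrArg _ huv
  ends e he := by
    have hc := h.compact
    have hU := deg_U_ne_zero he
    have hW := deg_W_ne_zero he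
    have hr : σ.edgeRank e ∈ σ.compact.E := Finset.mem_range.2 (h.edgeRank_lt he)
    have hj : σ.compact.Joins (σ.edgeRank e)
        (⟨σ.rank (σ.U e), rank_lt hU (h.U_lt e he)⟩ : Fin (σ.live n))
        (⟨σ.rank (σ.W e), rank_lt hW (h.W_lt e he)⟩ : Fin (σ.live n)) := by
      left
      simp only [St.compact, nth_edgeRank he, and_self]
    refine ⟨⟨σ.rank (σ.U e), rank_lt hU (h.U_lt e he)⟩, ⟨σ.rank (σ.W e), rank_lt hW (h.W_lt e he)⟩,
      (toInstance_adj hc _ _).2 ⟨_, hr, hj⟩, ?_, ?_⟩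
    · left
      exact ⟨(Nat.nth_count (p := fun u => σ.deg u ≠ 0) hU).symm,
        (Nat.nth_count (p := fun u => σ.deg u ≠ 0) hW).symm⟩
    · refine Eq.trans ?_ (toInstance_list hc hr hj).symm
      simp only [St.compact, nth_edgeRank he]
  surj u v huv := by
    obtain ⟨j, hj, hjoin⟩ := (toInstance_adj h.compact u v).1 huv
    have me := h.nth_mem (Finset.mem_range.1 hj)
    refine ⟨_, me, ?_⟩
    have hn : ∀ {x}, σ.deg x ≠ 0 → Nat.nth (fun u => σ.deg u ≠ 0) (σ.rank x) = x := fun hx =>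
      Nat.nth_count (p := fun u => σ.deg u ≠ 0) hx
    rcases hjoin with ⟨p, q⟩ | ⟨p, q⟩
    · left; simp only [← p, ← q]
      exact ⟨(hn (deg_U_ne_zero me)).symm, (hn (deg_W_ne_zero me)).symm⟩
    · right; simp only [← p, ← q]
      exact ⟨(hn (deg_U_ne_zero me)).symm, (hn (deg_W_ne_zero me)).symm⟩
  uniq := h.inj
  k_eq := rfl

lemma Yes.nonneg (h : σ.Yes tri) : 0 ≤ σ.k := by
  obtain ⟨x, -, -, h⟩ := h
  refine le_trans (Finset.sum_nonneg fun e _ => ?_) h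
  unfold wt; split_ifs <;> norm_num

/-- All edges weak is always allowed, so budgets above the number of edges may be cut down to it. -/
lemma yes_of_card_le (h : (σ.E.card : ℤ) ≤ σ.k) : σ.Yes tri := by
  refine ⟨fun _ => none, fun _ _ a h => by simp at h, fun _ _ _ _ _ a h => by simp at h, ?_⟩
  simpa [wt] using h

/-- Replace the budget. -/
def setK (σ : St c) (k : ℤ) : St c := { σ with k := k }

lemma WF.setK (h : σ.WF n m) {k : ℤ} : (σ.setK k).WF n m := ⟨h.lt_m, h.U_lt, h.W_lt, h.ne, h.inj⟩

/-- A no-instance with one edge. -/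
def single (c : ℕ) : St c := ⟨Finset.range 1, fun _ => 0, fun _ => 1, fun _ => ∅, 0⟩

lemma wf_single : (single c).WF 2 1 where
  lt_m e he := Finset.mem_range.1 he
  U_lt e he := by simp [single]
  W_lt e he := by simp [single]
  ne e he := by simp [single]
  inj e he f hf _ _ _ _ := by
    simp only [single, Finset.mem_range] at he hf
    omega

lemma not_yes_single : ¬ (single c).Yes tri := by
  rintro ⟨x, h1, -, h2⟩
  have h0 : x 0 = none := by
    cases hx : x 0 with
    | none => rfl
    | some a => exact absurd (h1 0 (by simp [single]) a hx) (by simp [single])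
  simp [single, wt, h0] at h2

/-- Several reduction steps. -/
def Reach (tri : Prop) (n m : ℕ) : St c → St c → Prop := Relation.ReflTransGen (Step tri n m)

lemma Reach.wf (h : Reach tri n m σ σ') (hw : σ.WF n m) : σ'.WF n m := by
  induction h with
  | refl => exact hw
  | tail _ h _ => exact h.wf

lemma Reach.yes (h : Reach tri n m σ σ') : σ'.Yes tri ↔ σ.Yes tri := by
  induction h with
  | refl => rfl
  | tail _ h ih => exact h.yes.trans ih

lemma Reach.del2 (h : Reach tri n m σ σ') {x : ℕ} (hx : σ.Del2 x) : σ'.Del2 x := by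
  induction h with
  | refl => exact hx
  | tail _ h ih => exact h.del2 ih

lemma Reach.deg_le_two (h : Reach tri n m σ σ') (hd : ∀ v, σ'.deg v ≤ 2) (v : ℕ) :
    σ.deg v ≤ 2 := by
  induction h generalizing v with
  | refl => exact hd v
  | tail _ h ih => exact ih (h.deg_le_two hd) v

/-- The edge list that is returned. -/
def final (σ : St c) : St c :=
  if σ.k < 0 then (if σ.E.card = 0 then σ.setK (-1) else single c)
  else σ.setK (min σ.k σ.E.card)

/-- The steps preserve the answer and bound the deletion distance of the reduced graph by ξ₂ of the
input, so the count for irreducible graphs applies. Adjusting the budget changes no answer: negative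
budgets are hopeless and those above the number of edges are all equivalent. -/
lemma isKernelOf {Q : ELInstance c → Prop} {σ₀ : St c} {I : ELInstance c} {ι : Fin I.n → ℕ}
    (hQ : ∀ (σ : St c) I ι, Represents σ I ι → (Q I ↔ σ.Yes tri)) (hr : Represents σ₀ I ι)
    (hR : Reach tri n m σ₀ σ) (h : σ.WF n m) (hs : ∀ v < n, σ.Stuck v) {τ : St c} {n' : ℕ}
    {ι' : Fin (τ.toInstance n').n → ℕ} (hτ : Represents σ.final (τ.toInstance n') ι')
    (hn' : n' = if σ.k < 0 ∧ σ.E.card ≠ 0 then 2 else σ.live n) :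
    IsKernelOf Q (τ.toInstance n') I := by
  obtain ⟨hE, hV⟩ := bounds_of_stuck h hs (hR.del2 hr.del2)
  have hyes : σ.final.Yes tri ↔ σ.Yes tri := by
    unfold final
    split_ifs with h1 h2
    · exact ⟨fun h => absurd h.nonneg (by simp [setK]), fun h => absurd h.nonneg (by omega)⟩
    · exact ⟨fun h => absurd h not_yes_single, fun h => absurd h.nonneg (by omega)⟩
    · rcases le_or_gt σ.k σ.E.card with h3 | h3
      · rw [min_eq_left h3]; rfl
      · exact iff_of_true (yes_of_card_le (by simp [setK, h3.le])) (yes_of_card_le h3.le)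
  obtain ⟨ψ, hψ⟩ := hτ.exists_name
  -- An edgeless result has maximum degree at most two, hence so had the input.
  have hxi : σ.E.card = 0 → xi I.G 2 = 0 := fun h0 => by
    refine hr.xi_eq_zero (hR.deg_le_two fun v => ?_)
    rw [Finset.card_eq_zero] at h0
    simp [deg, at_, h0]
  refine ⟨(hQ _ _ _ hτ).trans (hyes.trans (hR.yes.trans (hQ _ _ _ hr).symm)), ?_, ?_, ?_, ?_⟩
  · rw [hψ.numEdges]
    unfold final
    split_ifs
    · exact hE
    -- The reduced graph still has an edge here, so its size bound forces ξ₂ ≥ 1, and there is room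
    -- for one edge and two vertices.
    · simp only [single, Finset.card_range]; omega
    · exact hE
  · change n' ≤ _
    rw [hn']
    split_ifs <;> omega
  · rw [← hτ.k_eq, hψ.numEdges]
    unfold final
    split_ifs
    · simp only [setK]; omega
    · simp [single]
    · simp [setK]
  · rw [← hτ.k_eq]
    unfold final
    split_ifs with h1 h2
    · exact Or.inr ⟨hxi h2, rfl⟩
    · left; simp [single]
    · left; simp only [setK]; omega

end St

/-! ## The whole program -/

namespace RAM
open St

lemma setArr_arr_ne {s : Store} {a b : ℕ} {i z : ℤ} (h : b ≠ a) : (s.setArr a i z).arr b = s.arr b := by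
  funext j; rw [setArr_arr, if_neg (fun h' => h h'.1)]

lemma linear_le {A B N M : ℕ} (h : N ≤ M) : A * N + B ≤ (A + B) * (M + 1) := by
  have := Nat.mul_le_mul_left A h
  have h2 : (A + B) * (M + 1) = A * M + B * M + A + B := by ring
  rw [h2]
  have : 0 ≤ B * M := Nat.zero_le _
  omega

lemma le_sq (n : ℕ) : n ≤ n ^ 2 := by nlinarith [Nat.zero_le n]

/-- `for x := 0 to y - 1 do p`. -/
def forP (x y : ℕ) (p : Prog) : Prog := .seq (.assign x (.const 0)) (forLoop x y p)

lemma run_forP {x y N : ℕ} {p : Prog} (hp : p.Straight) (Inv : ℕ → Store → Prop)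
    (hI : ∀ i s, Inv i s → s.reg x = i ∧ s.reg y = N)
    (hstep : ∀ i s, i < N → Inv i s →
      Inv (i + 1) ((p.eval s).setReg x ((p.eval s).reg x + 1)))
    {s : Store} (h0 : Inv 0 (s.setReg x 0)) {M : ℕ} (hM : N ≤ M) :
    Run (forP x y p) s ((p.bound + 16) * (M + 1)) (Inv N) := by
  have h1 : Run (.assign x (.const 0)) s 2 (fun s' => s' = s.setReg x 0) :=
    run_straight (p := .assign x (.const 0)) trivial s
  refine (h1.seq (Q' := Inv N) (B' := (p.bound + 9) * N + 5) ?_).mono ?_ fun _ h => h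
  · rintro _ rfl
    exact run_forLoop hp Inv hI hstep h0
  · have : (p.bound + 9 + 7) * (M + 1) = (p.bound + 16) * (M + 1) := by ring
    have := linear_le (A := p.bound + 9) (B := 7) hM
    omega

lemma run_assign (x : ℕ) (z : ℤ) (s : Store) {M : ℕ} :
    Run (.assign x (.const z)) s (2 * (M + 1)) (fun s' => s' = s.setReg x z) :=
  (run_straight (p := .assign x (.const z)) trivial s).mono (by simp [Prog.bound, Expr.cost])
    fun _ h => h

section
variable {c n m : ℕ} {s : Store} {σ : St c}

lemma Rep.congr {s' : Store} (h : Rep n m s σ) (hr : ∀ x < 3, s'.reg x = s.reg x)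
    (ha : ∀ a < c + 6, s'.arr a = s.arr a) : Rep n m s' σ where
  r0 := by rw [hr 0 (by omega)]; exact h.r0
  r1 := by rw [hr 1 (by omega)]; exact h.r1
  r2 := by rw [hr 2 (by omega)]; exact h.r2
  U e he := by rw [ha 0 (by omega)]; exact h.U e he
  W e he := by rw [ha 1 (by omega)]; exact h.W e he
  L e he a := by rw [ha _ (by omega)]; exact h.L e he a
  alive e he := by rw [ha _ (by omega)]; exact h.alive e he
  deg v hv := by rw [ha _ (by omega)]; exact h.deg v hv
  sum v hv := by rw [ha _ (by omega)]; exact h.sum v hv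
  inc v hv hd := by rw [ha _ (by omega)]; exact h.inc v hv hd

/-! ### Reading the input -/

/-- The store `s` lists all edges of `σ`. -/
structure Lists {c : ℕ} (n m : ℕ) (s : Store) (σ : St c) : Prop where
  r0 : s.reg 0 = n
  r1 : s.reg 1 = m
  r2 : s.reg 2 = σ.k
  U : ∀ e < m, s.arr 0 e = σ.U e
  W : ∀ e < m, s.arr 1 e = σ.W e
  L : ∀ e < m, ∀ a : Fin c, s.arr (2 + a) e = if a ∈ σ.L e then 1 else 0
  E : σ.E = Finset.range m

/-- Clear the degrees. -/
def clearDegP (c : ℕ) : Prog :=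
  forP 3 0 (.seq (.write (c + 2) (.reg 3) (.const 0)) (.write (c + 3) (.reg 3) (.const 0)))

/-- Mark all edges as absent. -/
def clearAliveP (c : ℕ) : Prog := forP 3 1 (.write (c + 5) (.reg 3) (.const 0))

/-- Insert the edges. -/
def insertP (c : ℕ) : Prog :=
  forP 3 1 (.seq (.assign 5 (.read 0 (.reg 3))) (.seq (.assign 6 (.read 1 (.reg 3)))
    (addP c 3 5 6)))

/-- Read the graph. -/
def loadP (c : ℕ) : Prog := .seq (clearDegP c) (.seq (clearAliveP c) (insertP c))

lemma run_clearDegP (h : Lists n m s σ) {M : ℕ} (hM : n ≤ M) :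
    Run (clearDegP c) s (22 * (M + 1)) fun s' => Lists n m s' σ ∧
      ∀ v < n, s'.arr (c + 2) v = 0 ∧ s'.arr (c + 3) v = 0 := by
  refine (run_forP (N := n) (by simp [Prog.Straight]) (fun i s' => s'.reg 3 = i ∧ Lists n m s' σ ∧
    ∀ v < i, s'.arr (c + 2) v = 0 ∧ s'.arr (c + 3) v = 0) ?_ ?_ ?_ hM).mono (le_of_eq rfl) ?_
  · exact fun i s' h => ⟨h.1, h.2.1.r0⟩
  · rintro i s' hi ⟨h3, hl, hz⟩
    simp only [Prog.eval, Expr.eval, setArr_reg, h3]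
    refine ⟨by simp, ⟨by simpa using hl.r0, by simpa using hl.r1, by simpa using hl.r2, ?_, ?_, ?_,
      hl.E⟩, ?_⟩
    · intro e he; simpa [setArr_arr] using hl.U e he
    · intro e he; simpa [setArr_arr] using hl.W e he
    · intro e he a
      have := a.2
      rw [setReg_arr, setArr_arr_ne (by omega), setArr_arr_ne (by omega)]
      exact hl.L e he a
    · intro v hv
      by_cases hvi : v = i
      · subst hvi; simp [setArr_arr]
      · have := hz v (by omega)
        simpa [setArr_arr, hvi] using this
  · exact ⟨by simp, ⟨by simpa using h.r0, by simpa using h.r1, by simpa using h.r2, h.U, h.W, h.L,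
      h.E⟩, by simp⟩
  · exact fun s' h => h.2

lemma run_clearAliveP (h : Lists n m s σ)
    (hz : ∀ v < n, s.arr (c + 2) v = 0 ∧ s.arr (c + 3) v = 0) {M : ℕ} (hM : m ≤ M) :
    Run (clearAliveP c) s (19 * (M + 1)) fun s' => Lists n m s' σ ∧
      (∀ v < n, s'.arr (c + 2) v = 0 ∧ s'.arr (c + 3) v = 0) ∧ ∀ e < m, s'.arr (c + 5) e = 0 := by
  refine (run_forP (N := m) (by simp [Prog.Straight]) (fun i s' => s'.reg 3 = i ∧ Lists n m s' σ ∧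
    (∀ v < n, s'.arr (c + 2) v = 0 ∧ s'.arr (c + 3) v = 0) ∧ ∀ e < i, s'.arr (c + 5) e = 0)
    ?_ ?_ ?_ hM).mono (le_of_eq rfl) ?_
  · exact fun i s' h => ⟨h.1, h.2.1.r1⟩
  · rintro i s' hi ⟨h3, hl, hz, ha⟩
    simp only [Prog.eval, Expr.eval, setArr_reg, h3]
    refine ⟨by simp, ⟨by simpa using hl.r0, by simpa using hl.r1, by simpa using hl.r2, ?_, ?_, ?_,
      hl.E⟩, ?_, ?_⟩
    · intro e he; simpa [setArr_arr] using hl.U e he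
    · intro e he; simpa [setArr_arr] using hl.W e he
    · intro e he a
      have := a.2
      rw [setReg_arr, setArr_arr_ne (by omega)]
      exact hl.L e he a
    · intro v hv; simpa [setArr_arr] using hz v hv
    · intro e he
      by_cases hei : e = i
      · subst hei; simp [setArr_arr]
      · simpa [setArr_arr, hei] using ha e (by omega)
  · exact ⟨by simp, ⟨by simpa using h.r0, by simpa using h.r1, by simpa using h.r2, h.U, h.W, h.L,
      h.E⟩, hz, by simp⟩
  · exact fun s' h => h.2

/-- The first `i` edges. -/
def upTo (σ : St c) (i : ℕ) : St c := { σ with E := Finset.range i }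

lemma upTo_succ (σ : St c) (i : ℕ) : (upTo σ i).add i (σ.U i) (σ.W i) = upTo σ (i + 1) := by
  simp [upTo, St.add, Finset.range_add_one]

/-- The edge list grows from empty to full, and every inserted edge is absent before its turn. The
given endpoints are remembered separately, since the store invariant speaks only of edges already
inserted. -/
lemma run_insertP (h : Lists n m s σ) (hw : σ.WF n m)
    (hz : ∀ v < n, s.arr (c + 2) v = 0 ∧ s.arr (c + 3) v = 0) (ha : ∀ e < m, s.arr (c + 5) e = 0)
    {M : ℕ} (hM : m ≤ M) : Run (insertP c) s (((addP c 3 5 6).bound + 24) * (M + 1)) fun s' =>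
      Rep n m s' σ := by
  have hstr : (Prog.seq (.assign 5 (.read 0 (.reg 3))) (.seq (.assign 6 (.read 1 (.reg 3)))
      (addP c 3 5 6))).Straight := ⟨trivial, trivial, addP_straight _ _ _⟩
  refine (run_forP (N := m) hstr (fun i s' => s'.reg 3 = i ∧ Rep n m s' (upTo σ i) ∧
    ∀ e < m, s'.arr 0 e = σ.U e ∧ s'.arr 1 e = σ.W e) ?_ ?_ ?_ hM).mono ?_ ?_
  · exact fun i s' h => ⟨h.1, h.2.1.r1⟩
  · rintro i s' hi ⟨h3, hr, hUW⟩
    have hiE : i ∈ σ.E := by rw [h.E]; simpa using hi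
    have e1 : (Expr.read 0 (.reg 3)).eval s' = σ.U i := by
      simp only [Expr.eval, h3]; exact (hUW i hi).1
    have e2 : (Expr.read 1 (.reg 3)).eval (s'.setReg 5 (σ.U i)) = σ.W i := by
      simp only [Expr.eval, setReg_reg, setReg_arr]
      rw [if_neg (by norm_num), h3]; exact (hUW i hi).2
    simp only [eval_seq, eval_assign]
    rw [e1, e2]
    have hr1 := (hr.setReg (x := 5) (by norm_num) (σ.U i)).setReg (x := 6) (by norm_num) (σ.W i)
    set s₁ := (s'.setReg 5 (σ.U i)).setReg 6 (σ.W i) with hs₁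
    have hr2 := hr1.add (x := 3) (xu := 5) (xw := 6) (e := i) (u := σ.U i) (w := σ.W i)
      (by simp [hs₁, h3]) (by simp [hs₁]) (by simp [hs₁]) (by simp [upTo]) (hw.ne i hiE)
    rw [upTo_succ] at hr2
    refine ⟨by simp [hs₁, h3], hr2.setReg (by norm_num) _, fun e he => ?_⟩
    by_cases hei : e = i
    · subst hei
      simp [addP, Prog.eval, setArr_arr, Expr.eval, hs₁, h3]
    · simpa [addP, Prog.eval, setArr_arr, Expr.eval, hs₁, h3, hei] using hUW e he
  · have h0 : ∀ v, (upTo σ 0).at_ v = ∅ := fun v => Finset.filter_empty _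
    refine ⟨by simp, ⟨by simpa using h.r0, by simpa using h.r1, by simpa [upTo] using h.r2, ?_, ?_, h.L, ?_,
      ?_, ?_, ?_⟩, fun e he => ⟨h.U e he, h.W e he⟩⟩
    · intro e he; simp [upTo] at he
    · intro e he; simp [upTo] at he
    · intro e he; simpa [upTo] using ha e he
    · intro v hv; simpa [St.deg, h0] using (hz v hv).1
    · intro v hv; simpa [h0] using (hz v hv).2
    · intro v hv hd; simp [St.deg, h0] at hd
  · refine Nat.mul_le_mul_right _ ?_
    simp only [Prog.bound, Expr.cost]
    omega
  · intro s' h'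
    have : upTo σ m = σ := by unfold upTo; rw [← h.E]
    exact this ▸ h'.2.1

lemma exists_run_loadP (c : ℕ) : ∃ C, ∀ (n m : ℕ) (s : Store) (σ : St c), Lists n m s σ →
    σ.WF n m → m ≤ n ^ 2 → Run (loadP c) s (C * (n ^ 2 + 1)) fun s' => Rep n m s' σ := by
  refine ⟨22 + (19 + ((addP c 3 5 6).bound + 24)), fun n m s σ h hw hm => ?_⟩
  rw [add_mul, add_mul]
  exact (run_clearDegP h (le_sq n)).seq fun s₁ h₁ =>
    (run_clearAliveP h₁.1 h₁.2 hm).seq fun s₂ h₂ => run_insertP h₂.1 hw h₂.2.1 h₂.2.2 hm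

/-! ### Exhaustive reduction -/

/-- Try to reduce at every vertex. -/
noncomputable def sweepP (c : ℕ) (tri : Prop) : Prog :=
  .seq (.assign 4 (.const 0)) (forP 3 0 (reduceP c tri))

/-- Reduce as long as possible. -/
noncomputable def reduceAllP (c : ℕ) (tri : Prop) : Prog :=
  .seq (.assign 4 (.const 1)) (.loop (.const 1) (.reg 4) (sweepP c tri))

/-- Either no rule fired, so the graph was the same throughout and irreducibility was checked at
every vertex of it, or at least one vertex has been isolated. -/
lemma run_sweepP {tri : Prop} (h : Rep n m s σ) (hw : σ.WF n m) :
    Run (sweepP c tri) s (((reduceP c tri).bound + 18) * (n + 1)) fun s' => ∃ σ',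
      Reach tri n m σ σ' ∧ Rep n m s' σ' ∧ ((s'.reg 4 = 0 ∧ ∀ v < n, σ'.Stuck v) ∨
        (s'.reg 4 = 1 ∧ σ'.live n < σ.live n)) := by
  have : (reduceP c tri).bound + 18 = 2 + ((reduceP c tri).bound + 16) := by ring
  rw [this, add_mul]
  refine (run_assign 4 0 s).seq ?_
  rintro _ rfl
  refine (run_forP (N := n) (reduceP_straight c tri) (fun i s' => s'.reg 3 = i ∧ ∃ σ',
    Reach tri n m σ σ' ∧ Rep n m s' σ' ∧ ((s'.reg 4 = 0 ∧ σ' = σ ∧ ∀ v < i, σ.Stuck v) ∨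
        (s'.reg 4 = 1 ∧ σ'.live n < σ.live n))) ?_ ?_ ?_ le_rfl).mono le_rfl ?_
  · rintro i s' ⟨h3, σ', -, hr, -⟩
    exact ⟨h3, hr.r0⟩
  · rintro i s' hi ⟨h3, σ', hR, hr, hor⟩
    obtain ⟨g3, ⟨g4, gr, gs⟩ | ⟨g4, τ, gS, gr⟩⟩ :=
      outcome_reduceP (tri := tri) hr (hR.wf hw) hi h3 rfl
    · refine ⟨by simp [g3], σ', hR, gr.setReg (by norm_num) _, ?_⟩
      rcases hor with ⟨h4, rfl, hs⟩ | ⟨h4, hl⟩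
      -- Irreducibility at earlier vertices persists because nothing has changed since they were
      -- tested.
      · refine Or.inl ⟨by simp [g4, h4], rfl, fun v hv => ?_⟩
        rcases Nat.lt_succ_iff_lt_or_eq.1 hv with hv | rfl
        · exact hs v hv
        · exact gs
      · exact Or.inr ⟨by simp [g4, h4], hl⟩
    · refine ⟨by simp [g3], τ, hR.tail gS, gr.setReg (by norm_num) _, Or.inr ⟨by simp [g4], ?_⟩⟩
      rcases hor with ⟨h4, rfl, hs⟩ | ⟨h4, hl⟩
      · exact gS.live_lt
      · exact gS.live_lt.trans hl
  · refine ⟨by simp, σ, Relation.ReflTransGen.refl, ?_, Or.inl ⟨by simp, rfl, by simp⟩⟩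
    exact (h.setReg (by norm_num) _).setReg (by norm_num) _
  · rintro s' ⟨-, σ', hR, hr, ⟨h4, rfl, hs⟩ | hor⟩
    · exact ⟨_, hR, hr, Or.inl ⟨h4, hs⟩⟩
    · exact ⟨_, hR, hr, Or.inr hor⟩

lemma live_le : σ.live n ≤ n := by
  unfold live
  exact (Finset.card_filter_le _ _).trans (by simp)

/-- The number of live vertices starts at most n and drops in every sweep but the last. Linear
sweeps therefore take quadratic time in total. -/
lemma exists_run_reduceAllP (c : ℕ) (tri : Prop) : ∃ C, ∀ (n m : ℕ) (s : Store) (σ : St c),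
    Rep n m s σ → σ.WF n m → Run (reduceAllP c tri) s (C * (n ^ 2 + 1)) fun s' => ∃ σ',
      Reach tri n m σ σ' ∧ Rep n m s' σ' ∧ ∀ v < n, σ'.Stuck v := by
  set A := (reduceP c tri).bound + 18 with hA
  refine ⟨2 + (4 * A + 12), fun n m s σ h hw => ?_⟩
  rw [add_mul]
  refine (run_assign 4 1 s).seq ?_
  rintro _ rfl
  refine (run_while (x := 4) (B := A * (n + 1)) (fun k s' => s'.reg 4 = 1 ∧ ∃ σ',
    Reach tri n m σ σ' ∧ Rep n m s' σ' ∧ σ'.live n = k) _ (fun k s' h => h.1) ?_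
    (k := σ.live n) ?_).mono ?_ fun _ h => h
  · rintro k s' ⟨h4, σ', hR, hr, rfl⟩
    refine (run_sweepP hr (hR.wf hw)).mono le_rfl ?_
    rintro s'' ⟨τ, hR', hr', ⟨h0, hs⟩ | ⟨h1, hl⟩⟩
    · exact Or.inl ⟨h0, τ, hR.trans hR', hr', hs⟩
    · exact Or.inr ⟨_, hl, h1, τ, hR.trans hR', hr', rfl⟩
  · exact ⟨by simp, σ, Relation.ReflTransGen.refl, h.setReg (by norm_num) _, rfl⟩
  · have h1 : σ.live n + 1 ≤ n + 1 := Nat.succ_le_succ live_le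
    have h2 := Nat.mul_le_mul_left (A * (n + 1) + 3) h1
    have h3 := le_sq n
    have h4 := Nat.mul_le_mul_left A h3
    nlinarith

/-! ### Writing the output -/

/-- Number the vertices that are not isolated. -/
def rankP (c : ℕ) : Prog :=
  .seq (.assign 4 (.const 0)) (forP 3 0 (.ite (.const 1) (.read (c + 2) (.reg 3))
    (.seq (.write (c + 6) (.reg 3) (.reg 4)) (.assign 4 (.add (.reg 4) (.const 1)))) .skip))

/-- Register 4 counts the live vertices seen so far; this is the rank of the next one and, at the
end, the number of vertices of the output. -/
lemma run_rankP (h : Rep n m s σ) {M : ℕ} (hM : n ≤ M) :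
    Run (rankP c) s (30 * (M + 1)) fun s' => Rep n m s' σ ∧ s'.reg 4 = σ.live n ∧
      ∀ v < n, σ.deg v ≠ 0 → s'.arr (c + 6) v = σ.rank v := by
  rw [show 30 = 2 + 28 from rfl, add_mul]
  refine (run_assign 4 0 s).seq ?_
  rintro _ rfl
  refine (run_forP (N := n) (by simp [Prog.Straight]) (fun i s' => s'.reg 3 = i ∧ Rep n m s' σ ∧
    s'.reg 4 = σ.rank i ∧ ∀ v < i, σ.deg v ≠ 0 → s'.arr (c + 6) v = σ.rank v) ?_ ?_ ?_ hM).mono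
    (le_of_eq rfl) ?_
  · exact fun i s' h => ⟨h.1, h.2.1.r0⟩
  · rintro i s' hi ⟨h3, hr, h4, hv⟩
    have hsucc : σ.rank (i + 1) = σ.rank i + if σ.deg i ≠ 0 then 1 else 0 := Nat.count_succ _ _
    by_cases hd : σ.deg i ≠ 0
    · have hc : (Expr.const 1).eval s' ≤ (Expr.read (c + 2) (.reg 3)).eval s' := by
        simp only [Expr.eval, h3, hr.deg i hi]; omega
      simp only [Prog.eval, if_pos hc]
      simp only [Expr.eval, setArr_reg, h3, h4]
      rw [if_pos hd] at hsucc
      refine ⟨by simp [h3], ?_, by simp [hsucc], ?_⟩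
      · refine hr.congr (fun x hx => ?_) fun a ha => ?_
        · simp [show x ≠ 3 by omega, show x ≠ 4 by omega]
        · exact setArr_arr_ne (by omega)
      · intro v hvi hdv
        by_cases hve : v = i
        · subst hve; simp [setArr_arr]
        · simpa [setArr_arr, hve] using hv v (by omega) hdv
    · have hc : ¬ (Expr.const 1).eval s' ≤ (Expr.read (c + 2) (.reg 3)).eval s' := by
        simp only [Expr.eval, h3, hr.deg i hi]; omega
      simp only [Prog.eval, if_neg hc]
      rw [if_neg hd] at hsucc
      refine ⟨by simp [h3], hr.setReg (by norm_num) _, by simp [h4, hsucc], ?_⟩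
      intro v hvi hdv
      exact hv v (by rcases Nat.lt_succ_iff_lt_or_eq.1 hvi with h | rfl
                     · exact h
                     · exact absurd hdv hd) hdv
  · refine ⟨by simp, (h.setReg (by norm_num) _).setReg (by norm_num) _, by simp [St.rank], by simp⟩
  · rintro s' ⟨-, hr, h4, hv⟩
    exact ⟨hr, by rw [h4, rank_eq_live], hv⟩

/-- Copy the list of the edge in register 3 to the edge in register 5. -/
def copyP {c : ℕ} : List (Fin c) → Prog
  | [] => .skip
  | a :: as => .seq (.write (2 + a) (.reg 5) (.read (2 + a) (.reg 3))) (copyP as)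

lemma copyP_straight (as : List (Fin c)) : (copyP as).Straight := by
  induction as with
  | nil => trivial
  | cons a as ih => exact ⟨trivial, ih⟩

@[simp] lemma copyP_reg (as : List (Fin c)) (s : Store) : ((copyP as).eval s).reg = s.reg := by
  induction as generalizing s with
  | nil => rfl
  | cons a as ih => simp [copyP, Prog.eval, ih]

lemma copyP_arr (as : List (Fin c)) (s : Store) (b : ℕ) (j : ℤ) : ((copyP as).eval s).arr b j =
    if j = s.reg 5 ∧ ∃ a ∈ as, b = 2 + (a : ℕ) then s.arr b (s.reg 3) else s.arr b j := by
  induction as generalizing s with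
  | nil => simp [copyP]
  | cons a as ih =>
    simp only [copyP, Prog.eval, ih, setArr_reg, setArr_arr, Expr.eval, List.mem_cons]
    by_cases hj : j = s.reg 5
    · by_cases h1 : ∃ a ∈ as, b = 2 + (a : ℕ)
      · have h2 : ∃ a', (a' = a ∨ a' ∈ as) ∧ b = 2 + (a' : ℕ) := by
          obtain ⟨a', h, h'⟩ := h1; exact ⟨a', Or.inr h, h'⟩
        simp only [hj, h1, h2, and_self, and_true, if_true]
        split_ifs with h3
        · rw [h3.1]
        · rfl
      · rw [if_neg (fun h => h1 h.2)]
        by_cases h2 : b = 2 + (a : ℕ)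
        · rw [if_pos ⟨h2, hj⟩, if_pos ⟨hj, a, Or.inl rfl, h2⟩, h2]
        · rw [if_neg (fun h => h2 h.1), if_neg]
          rintro ⟨-, a', rfl | h, h'⟩
          · exact h2 h'
          · exact h1 ⟨a', h, h'⟩
    · simp [hj]

lemma copyP_arr_list (s : Store) (a : Fin c) (j : ℤ) :
    ((copyP (List.finRange c)).eval s).arr (2 + a) j =
      if j = s.reg 5 then s.arr (2 + a) (s.reg 3) else s.arr (2 + a) j := by
  have h : ∃ a' ∈ List.finRange c, 2 + (a : ℕ) = 2 + (a' : ℕ) := ⟨a, by simp, rfl⟩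
  simp only [copyP_arr, h, and_true]

lemma copyP_arr_other (s : Store) {b : ℕ} (hb : b < 2 ∨ c + 2 ≤ b) :
    ((copyP (List.finRange c)).eval s).arr b = s.arr b := by
  funext j
  rw [copyP_arr, if_neg]
  rintro ⟨-, a, -, h⟩
  have := a.2
  omega

/-- Move the edge in register 3 to the place in register 5. -/
def moveP (c : ℕ) : Prog :=
  .seq (.write 0 (.reg 5) (.read (c + 6) (.read 0 (.reg 3))))
  (.seq (.write 1 (.reg 5) (.read (c + 6) (.read 1 (.reg 3))))
  (.seq (copyP (List.finRange c)) (.assign 5 (.add (.reg 5) (.const 1)))))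

/-- Renumber the edges. -/
def compactP (c : ℕ) : Prog :=
  .seq (.assign 5 (.const 0)) (forP 3 1 (.ite (.const 1) (.read (c + 5) (.reg 3)) (moveP c) .skip))

/-- The state of the renumbering when the edges below `i` have been moved. -/
structure Moved {c : ℕ} (m i : ℕ) (s s' : Store) (σ : St c) : Prop where
  r3 : s'.reg 3 = i
  r5 : s'.reg 5 = σ.edgeRank i
  reg : ∀ x, x ≠ 3 → x ≠ 5 → s'.reg x = s.reg x
  alive : s'.arr (c + 5) = s.arr (c + 5)
  rank : s'.arr (c + 6) = s.arr (c + 6)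
  later : ∀ e : ℕ, i ≤ e → s'.arr 0 e = s.arr 0 e ∧ s'.arr 1 e = s.arr 1 e ∧
    ∀ a : Fin c, s'.arr (2 + a) e = s.arr (2 + a) e
  done : ∀ e < i, e ∈ σ.E → s'.arr 0 (σ.edgeRank e) = σ.rank (σ.U e) ∧
    s'.arr 1 (σ.edgeRank e) = σ.rank (σ.W e) ∧
    ∀ a : Fin c, s'.arr (2 + a) (σ.edgeRank e) = if a ∈ σ.L e then 1 else 0

lemma edgeRank_le (e : ℕ) : σ.edgeRank e ≤ e := Nat.count_le _

/-- Moving in place is safe because the new number of an edge never exceeds the old one: entries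
still to be read are not overwritten, and distinct edges get distinct places. -/
lemma Moved.step {i : ℕ} {s' : Store} (h : Rep n m s σ) (hw : σ.WF n m)
    (hv : ∀ v < n, σ.deg v ≠ 0 → s.arr (c + 6) v = σ.rank v) (hi : i < m)
    (hM : Moved m i s s' σ) (hE : i ∈ σ.E) :
    Moved m (i + 1) s (((moveP c).eval s').setReg 3 (((moveP c).eval s').reg 3 + 1)) σ := by
  have hsucc : σ.edgeRank (i + 1) = σ.edgeRank i + 1 := by
    refine (Nat.count_succ _ _).trans ?_
    rw [if_pos hE]; rfl
  obtain ⟨l0, l1, l2⟩ := hM.later i le_rfl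
  have hU : s'.arr (c + 6) (s'.arr 0 i) = σ.rank (σ.U i) := by
    rw [l0, h.U i hE, hM.rank]; exact hv _ (hw.U_lt i hE) (deg_U_ne_zero hE)
  have hW : s'.arr (c + 6) (s'.arr 1 i) = σ.rank (σ.W i) := by
    rw [l1, h.W i hE, hM.rank]; exact hv _ (hw.W_lt i hE) (deg_W_ne_zero hE)
  have a0 : ∀ j, ((moveP c).eval s').arr 0 j =
      if j = σ.edgeRank i then (σ.rank (σ.U i) : ℤ) else s'.arr 0 j := by
    intro j
    simp only [moveP, eval_seq, eval_assign, setReg_arr]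
    rw [copyP_arr_other _ (by omega)]
    simp [Prog.eval, Expr.eval, setArr_arr, hM.r3, hM.r5, hU]
  have a1 : ∀ j, ((moveP c).eval s').arr 1 j =
      if j = σ.edgeRank i then (σ.rank (σ.W i) : ℤ) else s'.arr 1 j := by
    intro j
    simp only [moveP, eval_seq, eval_assign, setReg_arr]
    rw [copyP_arr_other _ (by omega)]
    simp [Prog.eval, Expr.eval, setArr_arr, hM.r3, hM.r5, hW]
  have a2 : ∀ (a : Fin c) j, ((moveP c).eval s').arr (2 + a) j =
      if j = σ.edgeRank i then (if a ∈ σ.L i then 1 else 0) else s'.arr (2 + a) j := by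
    intro a j
    simp only [moveP, eval_seq, eval_assign, setReg_arr]
    rw [copyP_arr_list]
    simp only [Prog.eval, Expr.eval, setArr_reg, hM.r3, hM.r5]
    rw [setArr_arr_ne (by omega), setArr_arr_ne (by omega), l2 a, h.L i hi]
  have a3 : ∀ b, c + 2 ≤ b → ((moveP c).eval s').arr b = s'.arr b := by
    intro b hb
    simp only [moveP, eval_seq, eval_assign, setReg_arr]
    rw [copyP_arr_other _ (by omega)]
    simp only [Prog.eval]
    rw [setArr_arr_ne (by omega), setArr_arr_ne (by omega)]
  have hreg : ((moveP c).eval s').reg = (s'.setReg 5 (s'.reg 5 + 1)).reg := by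
    simp only [moveP, eval_seq, eval_assign]
    funext x
    simp [Prog.eval, Expr.eval]
  refine ⟨?_, ?_, ?_, ?_, ?_, ?_, ?_⟩
  · simp [hreg, hM.r3]
  · simp [hreg, hM.r5, hsucc]
  · intro x h3 h5
    simp [hreg, h3, h5, hM.reg x h3 h5]
  · exact (a3 _ (by omega)).trans hM.alive
  · exact (a3 _ (by omega)).trans hM.rank
  · intro e he
    -- Only the place `edgeRank i`, which is at most i, is written, so positions beyond i stay as
    -- they were.
    have hne : ¬ ((e : ℤ) = (σ.edgeRank i : ℕ)) := by
      have := edgeRank_le (σ := σ) i; omega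
    simp only [setReg_arr, a0, a1, a2, if_neg hne]
    exact hM.later e (by omega)
  · intro e he heE
    by_cases hei : e = i
    · subst hei
      simp only [setReg_arr, a0, a1, a2, if_true, true_and, implies_true]
    · have hne : ¬ ((σ.edgeRank e : ℤ) = (σ.edgeRank i : ℕ)) := by
        have : σ.edgeRank e < σ.edgeRank i :=
          Nat.count_strict_mono (p := fun f => f ∈ σ.E) heE (by omega)
        omega
      simp only [setReg_arr, a0, a1, a2, if_neg hne]
      exact hM.done e (by omega) heE

lemma run_compactP (h : Rep n m s σ) (hw : σ.WF n m)
    (hv : ∀ v < n, σ.deg v ≠ 0 → s.arr (c + 6) v = σ.rank v) {M : ℕ} (hM : m ≤ M) :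
    Run (compactP c) s (((moveP c).bound + 23) * (M + 1)) fun s' => ∃ s₁ : Store,
      (∀ x, x ≠ 5 → s₁.reg x = s.reg x) ∧ Moved m m s₁ s' σ := by
  rw [show (moveP c).bound + 23 = 2 + ((moveP c).bound + 21) by ring, add_mul]
  refine (run_assign 5 0 s).seq ?_
  rintro _ rfl
  have hr := h.setReg (x := 5) (by norm_num) 0
  refine (run_forP (N := m) ?_ (fun i s' => Moved m i (s.setReg 5 0) s' σ) ?_ ?_ ?_ hM).mono ?_ ?_
  · exact ⟨⟨trivial, trivial, copyP_straight _, trivial⟩, trivial⟩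
  · intro i s' hM
    exact ⟨hM.r3, by rw [hM.reg 1 (by norm_num) (by norm_num)]; exact hr.r1⟩
  · intro i s' hi hM
    have hal : (Expr.read (c + 5) (.reg 3)).eval s' = if i ∈ σ.E then 1 else 0 := by
      simp only [Expr.eval, hM.r3, hM.alive]; exact hr.alive i hi
    by_cases hE : i ∈ σ.E
    · have hc : (Expr.const 1).eval s' ≤ (Expr.read (c + 5) (.reg 3)).eval s' := by
        rw [hal, if_pos hE]; exact le_rfl
      simp only [Prog.eval, if_pos hc]
      exact Moved.step hr hw hv hi hM hE
    · have hc : ¬ (Expr.const 1).eval s' ≤ (Expr.read (c + 5) (.reg 3)).eval s' := by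
        rw [hal, if_neg hE]; simp [Expr.eval]
      simp only [Prog.eval, if_neg hc]
      have hsucc : σ.edgeRank (i + 1) = σ.edgeRank i := by
        refine (Nat.count_succ _ _).trans ?_
        rw [if_neg hE]; rfl
      refine ⟨by simp [hM.r3], by simp [hM.r5, hsucc], ?_, hM.alive, hM.rank, ?_, ?_⟩
      · intro x h3 h5
        simp [h3, hM.reg x h3 h5]
      · exact fun e he => hM.later e (by omega)
      · intro e he heE
        refine hM.done e ?_ heE
        rcases Nat.lt_succ_iff_lt_or_eq.1 he with h | rfl
        · exact h
        · exact absurd heE hE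
  · refine ⟨by simp, by simp [edgeRank], ?_, rfl, rfl, ?_, ?_⟩
    · intro x h3 h5; simp [h3, h5]
    · intro e he; exact ⟨rfl, rfl, fun _ => rfl⟩
    · intro e he; omega
  · refine Nat.mul_le_mul_right _ ?_
    simp only [Prog.bound, Expr.cost]
    omega
  · intro s' hM
    exact ⟨_, fun x hx => by simp [hx], hM⟩

/-- Write a no-instance. -/
def singleP (c : ℕ) : Prog :=
  .seq (.assign 0 (.const 2)) (.seq (.assign 1 (.const 1)) (.seq (.assign 2 (.const 0))
  (.seq (.assign 5 (.const 0)) (.seq (.write 0 (.reg 5) (.const 0)) (.seq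
  (.write 1 (.reg 5) (.const 1)) (setLP (c := c) 5 ∅))))))

/-- Write the sizes and adjust the budget. -/
def finishP (c : ℕ) : Prog :=
  .seq (.assign 0 (.reg 4)) (.seq (.assign 1 (.reg 5)) (.ite (.reg 2) (.const (-1))
    (.ite (.const 1) (.reg 1) (singleP c) (.assign 2 (.const (-1))))
    (.ite (.reg 1) (.reg 2) (.assign 2 (.reg 1)) .skip)))

lemma finishP_straight (c : ℕ) : (finishP c).Straight :=
  ⟨trivial, trivial, ⟨⟨trivial, trivial, trivial, trivial, trivial, trivial, setLP_straight _ _⟩,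
    trivial⟩, trivial, trivial⟩

lemma encodes_single {s : Store} : Encodes ((singleP c).eval s) ((single c).toInstance 2) := by
  refine encodes_toInstance wf_single rfl _ ?_ ?_ ?_ ?_ ?_ ?_
  · simp [singleP, Prog.eval, Expr.eval]
  · simp [singleP, Prog.eval, Expr.eval]
  · simp [singleP, single, Prog.eval, Expr.eval]
  · intro e he
    have : e = 0 := by omega
    subst this
    simp only [singleP, eval_seq]
    rw [setLP_arr_other _ _ _ _ (by omega)]
    simp [Prog.eval, Expr.eval, setArr_arr, single]
  · intro e he
    have : e = 0 := by omega
    subst this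
    simp only [singleP, eval_seq]
    rw [setLP_arr_other _ _ _ _ (by omega)]
    simp [Prog.eval, Expr.eval, setArr_arr, single]
  · intro e he a
    have : e = 0 := by omega
    subst this
    simp only [singleP, eval_seq]
    rw [setLP_arr_list]
    simp [Prog.eval, Expr.eval, single]

lemma encodes_compact {s s' : Store} (hw : σ.WF n m) {k : ℤ} (hM : Moved m m s s' σ)
    {s'' : Store} (harr : s''.arr = s'.arr) (h0 : s''.reg 0 = σ.live n)
    (h1 : s''.reg 1 = σ.E.card) (h2 : s''.reg 2 = k) :
    Encodes s'' ((σ.setK k).compact.toInstance (σ.live n)) := by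
  have hdone : ∀ j < σ.E.card, _ := fun j hj =>
    hM.done _ (hw.lt_m _ (hw.nth_mem hj)) (hw.nth_mem hj)
  refine encodes_toInstance (hw.setK (k := k)).compact rfl _ h0 h1 h2 ?_ ?_ ?_
  · intro j hj
    have := (hdone j hj).1
    rw [hw.edgeRank_nth hj] at this
    rw [harr]; exact this
  · intro j hj
    have := (hdone j hj).2.1
    rw [hw.edgeRank_nth hj] at this
    rw [harr]; exact this
  · intro j hj a
    have := (hdone j hj).2.2 a
    rw [hw.edgeRank_nth hj] at this
    rw [harr]; exact this

/-- The branches of the program are those of `final`: over the integers a negative budget is one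
that is at most -1, and the cap is a minimum. The one-edge no-instance is written out directly,
without compaction. -/
lemma finishP_spec {s s' : Store} (hw : σ.WF n m) (h4 : s.reg 4 = σ.live n) (h2 : s.reg 2 = σ.k)
    (hM : Moved m m s s' σ) : ∃ (τ : St c) (n' : ℕ) (ι : Fin (τ.toInstance n').n → ℕ),
      Encodes ((finishP c).eval s') (τ.toInstance n') ∧
      Represents σ.final (τ.toInstance n') ι ∧
      n' = if σ.k < 0 ∧ σ.E.card ≠ 0 then 2 else σ.live n := by
  have g4 : s'.reg 4 = σ.live n := by rw [hM.reg 4 (by norm_num) (by norm_num), h4]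
  have g2 : s'.reg 2 = σ.k := by rw [hM.reg 2 (by norm_num) (by norm_num), h2]
  have g5 : s'.reg 5 = σ.E.card := by rw [hM.r5, hw.edgeRank]
  set s₁ := (s'.setReg 0 (σ.live n)).setReg 1 σ.E.card with hs₁
  have e0 : s₁.reg 0 = σ.live n := by simp [hs₁]
  have e1 : s₁.reg 1 = σ.E.card := by simp [hs₁]
  have e2 : s₁.reg 2 = σ.k := by simp [hs₁, g2]
  have heval : (finishP c).eval s' = if σ.k ≤ -1 then
      (if (1 : ℤ) ≤ σ.E.card then (singleP c).eval s₁ else s₁.setReg 2 (-1))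
      else (if (σ.E.card : ℤ) ≤ σ.k then s₁.setReg 2 σ.E.card else s₁) := by
    have hs : (Prog.assign 1 (.reg 5)).eval ((Prog.assign 0 (.reg 4)).eval s') = s₁ := by
      simp [Expr.eval, g4, g5, hs₁]
    simp only [finishP, eval_seq, hs]
    simp only [Prog.eval, Expr.eval]
    split_ifs <;> simp_all
  rw [heval]
  by_cases hk : σ.k < 0
  · rw [if_pos (by omega)]
    by_cases hE : σ.E.card = 0
    · have hf : σ.final = σ.setK (-1) := by unfold final; rw [if_pos hk, if_pos hE]
      rw [if_neg (by omega), if_neg (fun h => h.2 hE), hf]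
      exact ⟨_, _, _, encodes_compact hw hM (k := -1) rfl (by simpa using e0) (by simpa using e1)
        (by simp), represents_compact hw.setK, rfl⟩
    · have hf : σ.final = single c := by unfold final; rw [if_pos hk, if_neg hE]
      rw [if_pos (by omega), if_pos ⟨hk, hE⟩, hf]
      exact ⟨_, _, _, encodes_single, represents_toInstance wf_single, rfl⟩
  · have hf : σ.final = σ.setK (min σ.k σ.E.card) := by unfold final; rw [if_neg hk]
    rw [if_neg (by omega), hf]
    refine ⟨_, _, _, encodes_compact hw hM (k := min σ.k σ.E.card) ?_ ?_ ?_ ?_,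
      represents_compact hw.setK, (if_neg fun h => hk h.1).symm⟩
    · split_ifs <;> rfl
    · split_ifs <;> simp [e0]
    · split_ifs <;> simp [e1]
    · split_ifs with h
      · simp [min_eq_right h]
      · rw [e2, min_eq_left (by omega)]

end

end RAM

/-! ## The kernelization -/

namespace RAM
open St

/-- The program for the kernel. -/
noncomputable def kernelP (c : ℕ) (tri : Prop) : Prog :=
  .seq (loadP c) (.seq (reduceAllP c tri) (.seq (rankP c) (.seq (compactP c) (finishP c))))

/-- The edge list in a store. -/
def ofStore (c m : ℕ) (s : Store) : St c where
  E := Finset.range m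
  U e := (s.arr 0 e).toNat
  W e := (s.arr 1 e).toNat
  L e := Finset.univ.filter fun a => s.arr (2 + a) e = 1
  k := s.reg 2

/-- The input format gives a bijection between indices and edges, so the stored list has neither
omissions nor repetitions, whatever the order and orientation. -/
lemma ofStore_spec {c : ℕ} {s : Store} {I : ELInstance c} (h : Encodes s I) :
    Lists I.n I.numEdges s (ofStore c I.numEdges s) ∧
      (ofStore c I.numEdges s).WF I.n I.numEdges ∧
      Represents (ofStore c I.numEdges s) I (fun v => (v : ℕ)) := by
  obtain ⟨h0, h1, h2, edge, hedge⟩ := h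
  set σ := ofStore c I.numEdges s with hσ
  have hE : ∀ e ∈ σ.E, e < I.numEdges := fun e he => Finset.mem_range.1 he
  have key : ∀ e (he : e < I.numEdges), ∃ u v : Fin I.n, (edge ⟨e, he⟩ : Sym2 (Fin I.n)) = s(u, v) ∧
      s.arr 0 e = (u : ℕ) ∧ s.arr 1 e = (v : ℕ) ∧ σ.U e = u ∧ σ.W e = v ∧ I.G.Adj u v ∧
      σ.L e = I.Ψ s(u, v) ∧ ∀ a : Fin c, s.arr (2 + a) e = if a ∈ σ.L e then 1 else 0 := by
    intro e he
    obtain ⟨⟨u, v, huv, hu, hv⟩, hl⟩ := hedge ⟨e, he⟩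
    have hL : σ.L e = I.Ψ s(u, v) := by
      ext a
      have := hl a
      simp only [huv] at this
      simp only [hσ, ofStore, Finset.mem_filter, Finset.mem_univ, true_and, this]
      split_ifs with h <;> simp [h]
    refine ⟨u, v, huv, hu, hv, by simp [hσ, ofStore, hu], by simp [hσ, ofStore, hv], ?_, hL, ?_⟩
    · have := (edge ⟨e, he⟩).2
      rw [huv] at this
      exact this
    · intro a
      rw [hL, ← huv]
      exact hl a
  have huniq : ∀ e ∈ σ.E, ∀ f ∈ σ.E, ∀ u v, σ.Joins e u v → σ.Joins f u v → e = f := by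
    intro e he f hf x y h1 h2
    obtain ⟨u, v, huv, -, -, hU, hW, -⟩ := key e (hE e he)
    obtain ⟨u', v', huv', -, -, hU', hW', -⟩ := key f (hE f hf)
    unfold Joins at h1 h2
    rw [hU, hW] at h1
    rw [hU', hW'] at h2
    have hs : s(u, v) = s(u', v') := by
      rw [Sym2.eq_iff]
      rcases h1 with ⟨p, q⟩ | ⟨p, q⟩ <;> rcases h2 with ⟨p', q'⟩ | ⟨p', q'⟩
      · exact Or.inl ⟨Fin.ext (p.trans p'.symm), Fin.ext (q.trans q'.symm)⟩
      · exact Or.inr ⟨Fin.ext (p.trans q'.symm), Fin.ext (q.trans p'.symm)⟩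
      · exact Or.inr ⟨Fin.ext (p.trans q'.symm), Fin.ext (q.trans p'.symm)⟩
      · exact Or.inl ⟨Fin.ext (p.trans p'.symm), Fin.ext (q.trans q'.symm)⟩
    rw [← huv, ← huv'] at hs
    exact Fin.mk.inj (edge.injective (Subtype.ext hs))
  refine ⟨⟨h0, h1, rfl, ?_, ?_, ?_, rfl⟩, ⟨hE, ?_, ?_, ?_, huniq⟩, ⟨Fin.val_injective, ?_, ?_, huniq,
    h2⟩⟩
  · intro e he
    obtain ⟨u, v, -, hu, -, hU, -⟩ := key e he
    rw [hu, hU]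
  · intro e he
    obtain ⟨u, v, -, -, hv, -, hW, -⟩ := key e he
    rw [hv, hW]
  · intro e he a
    obtain ⟨u, v, -, -, -, -, -, -, -, hl⟩ := key e he
    exact hl a
  · intro e he
    obtain ⟨u, v, -, -, -, hU, -⟩ := key e (hE e he)
    rw [hU]; exact u.2
  · intro e he
    obtain ⟨u, v, -, -, -, -, hW, -⟩ := key e (hE e he)
    rw [hW]; exact v.2
  · intro e he
    obtain ⟨u, v, -, -, -, hU, hW, ha, -⟩ := key e (hE e he)
    rw [hU, hW]
    exact fun h => ha.ne (Fin.ext h)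
  · intro e he
    obtain ⟨u, v, -, -, -, hU, hW, ha, hL, -⟩ := key e (hE e he)
    exact ⟨u, v, ha, Or.inl ⟨hU, hW⟩, hL⟩
  · intro u v ha
    obtain ⟨i, hi⟩ := edge.surjective ⟨s(u, v), ha⟩
    obtain ⟨u', v', huv, -, -, hU, hW, -⟩ := key i i.2
    refine ⟨i, Finset.mem_range.2 i.2, ?_⟩
    have : s(u', v') = s(u, v) := huv.symm.trans (congrArg Subtype.val hi)
    unfold Joins
    rw [hU, hW]
    rcases Sym2.eq_iff.1 this with ⟨rfl, rfl⟩ | ⟨rfl, rfl⟩ <;> simp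

/-- Edges inject into ordered pairs of vertices; this makes the passes over the edges quadratic in
n. -/
lemma card_le_sq {c n m : ℕ} {σ : St c} (h : σ.WF n m) (hE : σ.E = Finset.range m) : m ≤ n ^ 2 := by
  have : σ.E.card ≤ (Finset.range n ×ˢ Finset.range n).card := by
    refine Finset.card_le_card_of_injOn (fun e => (σ.U e, σ.W e)) ?_ ?_
    · intro e he
      simpa using ⟨h.U_lt e he, h.W_lt e he⟩
    · intro e he f hf hef
      have hef := Prod.mk.inj hef
      exact h.inj e he f hf _ _ (Or.inl ⟨rfl, rfl⟩) (Or.inl ⟨hef.1.symm, hef.2.symm⟩)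
  rw [hE] at this
  simpa [sq] using this

/-- All phases are bounded by multiples of n² + 1, and the constants add up. The problem enters only
through `hQ`, its translation into conflicts of edges. -/
theorem exists_computesKernel {c : ℕ} {Q : ELInstance c → Prop} (tri : Prop)
    (hQ : ∀ (σ : St c) I ι, Represents σ I ι → (Q I ↔ σ.Yes tri)) :
    ∃ C, ComputesKernel Q (kernelP c tri) C := by
  obtain ⟨C₁, hC₁⟩ := exists_run_loadP c
  obtain ⟨C₂, hC₂⟩ := exists_run_reduceAllP c tri
  refine ⟨C₁ + (C₂ + (30 + (((moveP c).bound + 23) + (finishP c).bound))), fun I s hs => ?_⟩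
  obtain ⟨hl, hw, hr⟩ := ofStore_spec hs
  set σ₀ := ofStore c I.numEdges s
  have hm := card_le_sq hw hl.E
  have hrun : Run (kernelP c tri) s (C₁ * (I.n ^ 2 + 1) + (C₂ * (I.n ^ 2 + 1) +
      (30 * (I.n ^ 2 + 1) + (((moveP c).bound + 23) * (I.n ^ 2 + 1) + (finishP c).bound))))
      fun s' => ∃ I', Encodes s' I' ∧ IsKernelOf Q I' I := by
    refine (hC₁ _ _ _ _ hl hw hm).seq fun s₁ hs₁ => ?_
    refine (hC₂ _ _ _ _ hs₁ hw).seq ?_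
    rintro s₂ ⟨σ, hR, hr₂, hst⟩
    have hwσ := hR.wf hw
    refine (run_rankP hr₂ (le_sq _)).seq ?_
    rintro s₃ ⟨hr₃, h4, hv⟩
    refine (run_compactP hr₃ hwσ hv hm).seq ?_
    rintro s₄ ⟨s₅, h5, hM⟩
    refine (run_straight (finishP_straight c) s₄).mono le_rfl ?_
    rintro _ rfl
    obtain ⟨τ, n', ι, henc, hrep, hn'⟩ := finishP_spec hwσ
      (by rw [h5 4 (by norm_num), h4]) (by rw [h5 2 (by norm_num), hr₃.r2]) hM
    exact ⟨_, henc, isKernelOf hQ hr hR hwσ hst hrep hn'⟩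
  obtain ⟨t, s', he, ht, I', h1, h2⟩ := hrun
  refine ⟨t, s', I', he, ht.trans ?_, h1, h2⟩
  have : (finishP c).bound ≤ (finishP c).bound * (I.n ^ 2 + 1) := Nat.le_mul_of_pos_right _ (by omega)
  simp only [add_mul]
  omega

end RAM

/-- Apart from the constants paid for a triangle component, the same program serves both problems.
-/
theorem theorem4 (c : ℕ) :
    (∃ (P : RAM.Prog) (C : ℕ), ComputesKernel (c := c) ELInstance.IsYesECS P C) ∧
    (∃ (P : RAM.Prog) (C : ℕ), ComputesKernel (c := c) ELInstance.IsYesMultiSTC P C) :=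
  ⟨⟨_, RAM.exists_computesKernel False fun _ _ _ h => h.yesECS⟩,
    ⟨_, RAM.exists_computesKernel True fun _ _ _ h => h.yesMultiSTC⟩⟩
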